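/- Let $p\ge 3$. Let $D$ be a closed connected oriented Euclidean cone surface obtained from finitely many copies of the regular $p$-gon by gluing all their sides in pairs by orientation preserving isometries (a side is never glued to itself). The singular set $\Sigma\subset D$ is the set of vertices of the polygons (points of cone angle $2\pi$ are allowed). A flag is a triple consisting of a polygon, a side of this polygon and an endpoint of this side. $D$ is called a *Platonic surface* if its group of isometries (homeomorphisms preserving $\Sigma$ that are isometries in flat charts on $D\smallsetminus\Sigma$) acts transitively on flags; its *rotation group* is the group of orientation preserving isometries. A *saddle connection* is a geodesic segment that connects two points of $\Sigma$ and has no point of $\Sigma$ in its interior; it is *closed* if its two endpoints coincide. Let $\pi_D:\tilde D\to D$ be the unfolding of $D$, that is, the cover branched over $\Sigma$ that belongs to the kernel of the parallel transport homomorphism $H_1(D\smallsetminus\Sigma;\mathbb Z)\to SO(2)$. Let $\Pi_p$ be the translation surface made from one regular $p$-gon with opposite sides glued ($p$ even), or from two regular $p$-gons that differ by a rotation by $\pi$, with parallel sides glued ($p$ odd). Its hyperelliptic involution is the rotation by $\pi$ about the center of the polygon ($p$ even), respectively the exchange of the two polygons by the rotation by $\pi$ ($p$ odd). Let $\pi_\Pi:\tilde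 D\to\Pi_p$ be the natural translation covering that carries polygons to polygons. A point of $D$ is a *virtual-Weierstrass point* if it is $\pi_D(\tilde x)$ for a point $\tilde x$ such that $\pi_\Pi(\tilde x)$ is fixed by the hyperelliptic involution; it is *regular* if it is not in $\Sigma$. A saddle connection of $D$ is *virtual-Weierstrass* if it lifts to a saddle connection of $\tilde D$ whose image in $\Pi_p$ is carried to itself by the hyperelliptic involution. Let $D$ be a Platonic surface made of $p$-gons. Then: 1. If no involution in the rotation group of $D$ fixes both a vertex and a regular virtual-Weierstrass point, then $D$ has no closed virtual-Weierstrass saddle connection. 2. If an odd number of $p$-gons meets at each vertex, then $D$ has no closed virtual-Weierstrass saddle connection. 3. If $p=3$ or $p=4$, then every saddle connection of $D$ is virtual-Weierstrass. 4. If $p=3$ or $p=4$, and an odd number of $p$-gons meets at each vertex, then $D$ has no closed saddle connection. -/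

import Mathlib

open Filter Topology

noncomputable section

/-! ### The regular `n`-gon -/

/-- `vtx k = exp (2 π i k / n)`, the `k`-th vertex of the standard regular `n`-gon. -/
def vtx {n : ℕ} [NeZero n] (k : ZMod n) : ℂ := ZMod.stdAddChar k

/-- The standard (closed, solid) regular `n`-gon, with circumradius `1`. -/
def RegPoly (n : ℕ) [NeZero n] : Set ℂ := convexHull ℝ (Set.range (vtx : ZMod n → ℂ))

/-- The `k`-th side, from `vtx k` to `vtx (k + 1)` (counterclockwise). -/
def side {n : ℕ} [NeZero n] (k : ZMod n) : Set ℂ := segment ℝ (vtx k) (vtx (k + 1))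

/-- The orientation preserving isometry of the plane that carries the side `k` to the side `l` and
reverses the boundary orientation: `vtx k ↦ vtx (l + 1)` and `vtx (k + 1) ↦ vtx l`.
Its rotational part is `- exp (2 π i (l - k) / n)`. -/
def sideMap {n : ℕ} [NeZero n] (k l : ZMod n) (z : ℂ) : ℂ :=
  vtx (l + 1) + vtx l - vtx (l - k) * z

theorem vtx_add {n : ℕ} [NeZero n] (k l : ZMod n) : vtx (k + l) = vtx k * vtx l :=
  AddChar.map_add_eq_mul _ _ _

theorem sideMap_start {n : ℕ} [NeZero n] (k l : ZMod n) :
    sideMap k l (vtx k) = vtx (l + 1) := by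
  have h : vtx (l - k) * vtx k = vtx l := by rw [← vtx_add, sub_add_cancel]
  rw [sideMap, h]; ring

theorem sideMap_end {n : ℕ} [NeZero n] (k l : ZMod n) :
    sideMap k l (vtx (k + 1)) = vtx l := by
  have h : vtx (l - k) * vtx (k + 1) = vtx (l + 1) := by
    rw [← vtx_add]; congr 1; ring
  rw [sideMap, h]; ring

theorem vtx_mem_regPoly {n : ℕ} [NeZero n] (k : ZMod n) : vtx k ∈ RegPoly n :=
  subset_convexHull ℝ _ ⟨k, rfl⟩

theorem vtx_mul_mem_regPoly {n : ℕ} [NeZero n] (a : ZMod n) {z : ℂ} (hz : z ∈ RegPoly n) :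
    vtx a * z ∈ RegPoly n := by
  have h : (LinearMap.mulLeft ℝ (vtx a)) '' RegPoly n ⊆ RegPoly n := by
    rw [RegPoly, LinearMap.image_convexHull]
    apply convexHull_mono
    rintro _ ⟨_, ⟨k, rfl⟩, rfl⟩
    exact ⟨a + k, by simp [vtx_add]⟩
  exact h ⟨z, hz, rfl⟩

theorem vtx_mul_mem_side {n : ℕ} [NeZero n] (a k : ZMod n) {z : ℂ} (hz : z ∈ side k) :
    vtx a * z ∈ side (k + a) := by
  obtain ⟨s, t, hs, ht, hst, rfl⟩ := hz
  refine ⟨s, t, hs, ht, hst, ?_⟩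
  have e : k + a + 1 = (k + 1) + a := by ring
  rw [e, vtx_add k a, vtx_add (k + 1) a]
  simp only [Complex.real_smul]; ring

theorem sideMap_vtx_mul {n : ℕ} [NeZero n] (k l a b : ZMod n) (z : ℂ) :
    sideMap (k + a) (l + b) (vtx a * z) = vtx b * sideMap k l z := by
  have h1 : l + b + 1 = b + (l + 1) := by ring
  have h2 : vtx (l + b - (k + a)) * (vtx a * z) = vtx b * (vtx (l - k) * z) := by
    rw [← mul_assoc, ← mul_assoc, ← vtx_add, ← vtx_add]; congr 2; ring
  rw [sideMap, sideMap, h2, h1, vtx_add b (l + 1), vtx_add l b]; ring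

/-! ### Cone surfaces with a regular `n`-gon decomposition -/

/-- Copies of the regular `n`-gon, indexed by `Face`, together with a pairing of all their sides.
The side `(f, k)` is glued to the side `glue (f, k)` by the orientation preserving isometry
`sideMap`. -/
structure PolygonGluing (n : ℕ) where
  /-- the polygons -/
  Face : Type*
  /-- the pairing of the sides -/
  glue : Face × ZMod n → Face × ZMod n
  glue_glue : ∀ e, glue (glue e) = e
  glue_ne : ∀ e, glue e ≠ e

namespace PolygonGluing

variable {n : ℕ} [NeZero n]

/-- The identification of the points of glued sides. -/
def Rel (D : PolygonGluing n) (x y : (_ : D.Face) × RegPoly n) : Prop :=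
  ∃ k l : ZMod n, D.glue (x.1, k) = (y.1, l) ∧ (x.2 : ℂ) ∈ side k ∧
    (y.2 : ℂ) = sideMap k l (x.2 : ℂ)

/-- The surface: the quotient of the disjoint union of the polygons by the equivalence relation
that the gluing generates. -/
def Surface (D : PolygonGluing n) : Type _ := Quot D.Rel

/-- The quotient topology. -/
instance (D : PolygonGluing n) : TopologicalSpace D.Surface :=
  inferInstanceAs (TopologicalSpace (Quot D.Rel))

/-- The point of the surface that is the point `z` of the polygon `f`. -/
def pt (D : PolygonGluing n) (f : D.Face) (z : RegPoly n) : D.Surface := Quot.mk _ ⟨f, z⟩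

/-- The `k`-th vertex of the polygon `f`, as a point of the surface. -/
def corner (D : PolygonGluing n) (c : D.Face × ZMod n) : D.Surface :=
  D.pt c.1 ⟨vtx c.2, vtx_mem_regPoly c.2⟩

/-- The singular set: the vertices of the polygons (it may contain points of cone angle `2 π`). -/
def sing (D : PolygonGluing n) : Set D.Surface := Set.range D.corner

/-- The number of polygons that meet at the point `v`, counted with multiplicity: the number of
corners of polygons at `v`. -/
def valence (D : PolygonGluing n) (v : D.Surface) : ℕ :=
  Nat.card {c : D.Face × ZMod n // D.corner c = v}

/-- `x` is the point `z` of the polygon `f`. -/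
def HasCoord (D : PolygonGluing n) (f : D.Face) (z : ℂ) (x : D.Surface) : Prop :=
  ∃ hz : z ∈ RegPoly n, D.pt f ⟨z, hz⟩ = x

/-- The flat charts around the points that are not vertices. In the chart `(f, k)` the polygon
`f` is the standard polygon of the plane and the polygon on the other side of the side `k` is
developed across this side; `z` is a coordinate of `x`. -/
def ChartCoord (D : PolygonGluing n) (c : D.Face × ZMod n) (z : ℂ) (x : D.Surface) : Prop :=
  D.HasCoord c.1 z x ∨ D.HasCoord (D.glue c).1 (sideMap c.2 (D.glue c).2 z) x

/-- The open region of the plane in which `ChartCoord` is a flat (local) coordinate: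
the interior of the union of the standard polygon and the developed one. -/
def chartRegion (D : PolygonGluing n) (c : D.Face × ZMod n) : Set ℂ :=
  interior (RegPoly n ∪ {z | sideMap c.2 (D.glue c).2 z ∈ RegPoly n})

/-! ### Isometries -/

/-- `h` is, in flat charts at any nonsingular point and its image, given by a map in `G`. -/
def LocallyIn (D : PolygonGluing n) (G : Set (ℂ → ℂ)) (h : D.Surface → D.Surface) : Prop :=
  ∀ c, ∀ z ∈ D.chartRegion c, ∃ c', ∃ A ∈ G, A z ∈ D.chartRegion c' ∧
    ∀ᶠ w in 𝓝 z, ∀ x, D.ChartCoord c w x → D.ChartCoord c' (A w) (h x)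

/-- Isometries of the cone surface (with its singular set). -/
def IsIsometry (D : PolygonGluing n) (h : D.Surface ≃ₜ D.Surface) : Prop :=
  h '' D.sing = D.sing ∧ D.LocallyIn {A | Isometry A} h

/-- The rotation group: orientation preserving isometries. -/
def IsRotation (D : PolygonGluing n) (h : D.Surface ≃ₜ D.Surface) : Prop :=
  h '' D.sing = D.sing ∧
    D.LocallyIn {A | ∃ a b : ℂ, ‖a‖ = 1 ∧ A = fun z => a * z + b} h

/-- A flag: a polygon, a side of it, and an endpoint of that side
(`false`: the initial one, `true`: the terminal one, in counterclockwise order). -/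
abbrev Flag (D : PolygonGluing n) : Type _ := D.Face × ZMod n × Bool

/-- The endpoint of the side that belongs to the flag. -/
def flagVertex (D : PolygonGluing n) (F : D.Flag) : ℂ :=
  if F.2.2 then vtx (F.2.1 + 1) else vtx F.2.1

/-- The other endpoint of the side. -/
def flagOther (D : PolygonGluing n) (F : D.Flag) : ℂ :=
  if F.2.2 then vtx F.2.1 else vtx (F.2.1 + 1)

/-- `h` carries the polygon, the side and the vertex of `F` isometrically to those of `F'`. -/
def CarriesFlag (D : PolygonGluing n) (h : D.Surface → D.Surface) (F F' : D.Flag) : Prop :=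
  ∃ A : ℂ → ℂ, Isometry A ∧ A (D.flagVertex F) = D.flagVertex F' ∧
    A (D.flagOther F) = D.flagOther F' ∧
    ∀ z x, D.HasCoord F.1 z x → D.HasCoord F'.1 (A z) (h x)

/-- Platonic surfaces: closed connected surfaces decomposed into regular polygons, whose
isometry group acts transitively on flags. -/
structure IsPlatonic (D : PolygonGluing n) : Prop where
  finite : Finite D.Face
  connected : ConnectedSpace D.Surface
  flag_transitive : ∀ F F' : D.Flag, ∃ h : D.Surface ≃ₜ D.Surface,
    D.IsIsometry h ∧ D.CarriesFlag h F F'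

/-! ### Saddle connections -/

/-- `γ`, restricted to `[0, L]`, is a saddle connection of length `L`, parametrized by arc length:
it starts and ends in a singular point, it is a straight segment of a polygon close to each
endpoint, and close to any `t ∈ (0, L)` it is a straight segment in a flat chart
(so it does not meet the singular set there). -/
structure IsSaddleConnection (D : PolygonGluing n) (L : ℝ) (γ : ℝ → D.Surface) : Prop where
  pos : 0 < L
  start_mem : γ 0 ∈ D.sing
  end_mem : γ L ∈ D.sing
  start_straight : ∃ f, ∃ z u : ℂ, ‖u‖ = 1 ∧
    ∀ᶠ s : ℝ in 𝓝[≥] 0, D.HasCoord f (z + s * u) (γ s)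
  end_straight : ∃ f, ∃ z u : ℂ, ‖u‖ = 1 ∧
    ∀ᶠ s : ℝ in 𝓝[≤] L, D.HasCoord f (z + ((s - L : ℝ) : ℂ) * u) (γ s)
  straight : ∀ t ∈ Set.Ioo 0 L, ∃ c, ∃ z ∈ D.chartRegion c, ∃ u : ℂ, ‖u‖ = 1 ∧
    ∀ᶠ s : ℝ in 𝓝 t, D.ChartCoord c (z + ((s - t : ℝ) : ℂ) * u) (γ s)

/-! ### Maps that carry polygons to polygons -/

/-- A map between surfaces that carries each polygon onto a polygon by a rotation about the
center, by the angle `2 π rot / n`, and respects the gluings. -/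
structure PolyHom (D E : PolygonGluing n) where
  face : D.Face → E.Face
  rot : D.Face → ZMod n
  compat : ∀ f k, E.glue (face f, k + rot f) =
    (face (D.glue (f, k)).1, (D.glue (f, k)).2 + rot (D.glue (f, k)).1)

/-- The induced map of surfaces. -/
def PolyHom.map {D E : PolygonGluing n} (φ : PolyHom D E) : D.Surface → E.Surface :=
  Quot.lift
    (fun x => E.pt (φ.face x.1) ⟨vtx (φ.rot x.1) * x.2, vtx_mul_mem_regPoly _ x.2.2⟩) (by
      rintro ⟨f, z⟩ ⟨f', z'⟩ ⟨k, l, hg, hz, hz'⟩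
      refine Quot.sound ⟨k + φ.rot f, l + φ.rot f', ?_, vtx_mul_mem_side _ _ hz, ?_⟩
      · have := φ.compat f k
        rw [hg] at this
        exact this
      · change vtx (φ.rot f') * (z' : ℂ) = _
        rw [hz', sideMap_vtx_mul])

/-! ### The unfolding -/

/-- Parallel transport of a direction `ρ` from the polygon `f` to the polygon across its side `k`.
If the polygon `f` is placed in the plane after the rotation by `ρ`, then its neighbour, developed
across the side `k`, is placed after the rotation by the new direction. -/
def transport (D : PolygonGluing n) (x : D.Face × Circle) (k : ZMod n) : D.Face × Circle :=
  ((D.glue (x.1, k)).1, -ZMod.toCircle (k - (D.glue (x.1, k)).2) * x.2)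

/-- The polygons with a direction that can be reached from the base polygon `o` with direction `1`
by parallel transport along paths that avoid the vertices. -/
def Reachable (D : PolygonGluing n) (o : D.Face) : D.Face × Circle → Prop :=
  Relation.ReflTransGen (fun x y => ∃ k, D.transport x k = y) (o, 1)

/-- The unfolding: the cover, branched over the singular set, which belongs to the kernel of the
parallel transport homomorphism. Its polygons are the pairs (endpoint, parallel transport)
of paths starting in the base polygon `o`. The polygon `(f, ρ)` is to be thought of as placed in
the plane after the rotation by `ρ`; all gluings are then translations. -/
def unfolding (D : PolygonGluing n) (o : D.Face) : PolygonGluing n where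
  Face := {x : D.Face × Circle // D.Reachable o x}
  glue e := (⟨D.transport e.1.1 e.2, e.1.2.tail ⟨e.2, rfl⟩⟩, (D.glue (e.1.1.1, e.2)).2)
  glue_glue := by
    rintro ⟨⟨⟨f, ρ⟩, h⟩, k⟩
    have hg := D.glue_glue (f, k)
    have h1 : (D.glue ((D.glue (f, k)).1, (D.glue (f, k)).2)).1 = f := congrArg Prod.fst hg
    have h2 : (D.glue ((D.glue (f, k)).1, (D.glue (f, k)).2)).2 = k := congrArg Prod.snd hg
    refine Prod.ext (Subtype.ext (Prod.ext h1 ?_)) h2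
    change -ZMod.toCircle ((D.glue (f, k)).2 -
      (D.glue ((D.glue (f, k)).1, (D.glue (f, k)).2)).2) *
        (-ZMod.toCircle (k - (D.glue (f, k)).2) * ρ) = ρ
    rw [h2, neg_mul, neg_mul, mul_neg, neg_neg, ← mul_assoc, ← AddChar.map_add_eq_mul]
    simp
  glue_ne := by
    rintro ⟨⟨⟨f, ρ⟩, h⟩, k⟩ heq
    simp only [transport, Prod.mk.injEq, Subtype.mk.injEq] at heq
    exact D.glue_ne (f, k) (Prod.ext heq.1.1 heq.2)

/-- The covering of the surface by its unfolding. -/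
def unfoldingHom (D : PolygonGluing n) (o : D.Face) : PolyHom (D.unfolding o) D where
  face x := x.1.1
  rot _ := 0
  compat f k := by
    simp only [add_zero]
    rfl

/-! ### The surfaces made of one or two regular polygons -/

/-- For even `n` one polygon; for odd `n` two polygons, one of them placed in
the plane as the standard one, the other one after the rotation by `-1`. -/
abbrev VeechFace (n : ℕ) : Type := {ε : Circle // ε = 1 ∨ (Odd n ∧ ε = -1)}

/-- For even `n` the same polygon, for odd `n` the other one. -/
def VeechFace.opp (ε : VeechFace n) : VeechFace n :=
  if h : Even n then ε else ⟨-ε.1, by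
    have ho : Odd n := Nat.not_even_iff_odd.mp h
    rcases ε.2 with h1 | h1
    · exact Or.inr ⟨ho, by rw [h1]⟩
    · exact Or.inl (by rw [h1.2, neg_neg])⟩

/-- For even `n` half a turn; for odd `n` none. -/
def halfTurn (n : ℕ) : ZMod n := if Even n then ((n / 2 : ℕ) : ZMod n) else 0

theorem VeechFace.opp_opp (ε : VeechFace n) : ε.opp.opp = ε := by
  unfold VeechFace.opp
  by_cases h : Even n
  · simp [h]
  · simp [h]

theorem halfTurn_add_self (n : ℕ) : halfTurn n + halfTurn n = 0 := by
  unfold halfTurn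
  split_ifs with h
  · obtain ⟨m, rfl⟩ := h
    have : (m + m) / 2 = m := by omega
    rw [this, ← Nat.cast_add, ZMod.natCast_self]
  · simp

/-- The surface `Π_n`. For even `n`: one polygon with opposite sides glued.
For odd `n`: two polygons, one the image of the other under the rotation by `-1`,
with parallel sides glued. All gluings are translations. -/
def veechSurface (n : ℕ) [NeZero n] : PolygonGluing n where
  Face := VeechFace n
  glue e := (e.1.opp, e.2 + halfTurn n)
  glue_glue e := by
    refine Prod.ext (VeechFace.opp_opp e.1) ?_
    change e.2 + halfTurn n + halfTurn n = e.2
    rw [add_assoc, halfTurn_add_self, add_zero]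
  glue_ne := by
    rintro ⟨ε, k⟩ heq
    have h1 : ε.opp = ε := congrArg Prod.fst heq
    have h2 : k + halfTurn n = k := congrArg Prod.snd heq
    by_cases h : Even n
    · rw [add_eq_left] at h2
      simp only [halfTurn, h, if_true] at h2
      rw [ZMod.natCast_eq_zero_iff] at h2
      have hn : n ≠ 0 := NeZero.ne n
      obtain ⟨m, rfl⟩ := h
      have := Nat.le_of_dvd (by omega) h2
      omega
    · simp only [VeechFace.opp, h, dif_neg, not_false_eq_true, Subtype.ext_iff] at h1
      have h3 : -((ε.1 : Circle) : ℂ) = ((ε.1 : Circle) : ℂ) := congrArg Subtype.val h1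
      exact Circle.coe_ne_zero ε.1 (neg_eq_self.mp h3)

/-- The hyperelliptic involution of `Π_n`: for even `n` the rotation by `π` about the center of the
polygon, for odd `n` the exchange of the two polygons by the rotation by `π`. -/
def hyperelliptic (n : ℕ) [NeZero n] : PolyHom (veechSurface n) (veechSurface n) where
  face ε := VeechFace.opp ε
  rot _ := halfTurn n
  compat _ _ := rfl

theorem neg_one_eq_toCircle_halfTurn (h : Even n) :
    (-1 : Circle) = ZMod.toCircle (halfTurn n) := by
  have hn : n ≠ 0 := NeZero.ne n
  obtain ⟨m, rfl⟩ := h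
  have hm : (m : ℂ) ≠ 0 := by
    have : m ≠ 0 := by omega
    exact_mod_cast this
  have h2 : (m + m) / 2 = m := by omega
  have h1 : halfTurn (m + m) = ((m : ℕ) : ZMod (m + m)) := by simp [halfTurn, h2]
  apply Subtype.ext
  change (-1 : ℂ) = _
  rw [h1, ZMod.toCircle_natCast, ← Complex.exp_pi_mul_I]
  congr 1
  push_cast
  field_simp
  ring

theorem toCircle_pow_card (a : ZMod n) : (ZMod.toCircle a) ^ n = 1 := by
  rw [← AddChar.map_nsmul_eq_pow]
  simp

/-- Any direction of the unfolding is, for exactly one polygon of `Π_n`, the direction of this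
polygon up to a rotational symmetry. -/
theorem exists_veechFace (D : PolygonGluing n) (o : D.Face) {x : D.Face × Circle}
    (hx : D.Reachable o x) :
    ∃ ε : VeechFace n, ∃ a : ZMod n, x.2 = ε.1 * ZMod.toCircle a := by
  induction hx with
  | refl => exact ⟨⟨1, Or.inl rfl⟩, 0, by simp⟩
  | tail _ hstep ih =>
    obtain ⟨k, rfl⟩ := hstep
    obtain ⟨ε, a, h⟩ := ih
    simp only [transport, h]
    set j := k - (D.glue _).2
    by_cases hn : Even n
    · refine ⟨ε, halfTurn n + j + a, ?_⟩
      rw [AddChar.map_add_eq_mul, AddChar.map_add_eq_mul, ← neg_one_eq_toCircle_halfTurn hn,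
        neg_one_mul]
      simp only [neg_mul, mul_neg]
      rw [mul_left_comm]
    · refine ⟨ε.opp, j + a, ?_⟩
      simp only [VeechFace.opp, hn, dif_neg, not_false_eq_true]
      rw [AddChar.map_add_eq_mul]
      simp only [neg_mul]
      rw [mul_left_comm]

theorem veechFace_unique {ε ε' : VeechFace n} {a a' : ZMod n}
    (h : (ε.1 : Circle) * ZMod.toCircle a = ε'.1 * ZMod.toCircle a') : ε = ε' ∧ a = a' := by
  have hε : ε = ε' := by
    by_cases hn : Even n
    · have h0 : ¬ Odd n := Nat.not_odd_iff_even.mpr hn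
      apply Subtype.ext
      rw [ε.2.resolve_right (fun q => h0 q.1), ε'.2.resolve_right (fun q => h0 q.1)]
    · have ho : Odd n := Nat.not_even_iff_odd.mp hn
      have hp : ∀ δ : VeechFace n, (δ.1 : Circle) ^ n = δ.1 := by
        intro δ
        rcases δ.2 with h1 | h1
        · rw [h1, one_pow]
        · rw [h1.2, ho.neg_one_pow]
      have := congrArg (fun c : Circle => c ^ n) h
      simp only [mul_pow, toCircle_pow_card, mul_one, hp] at this
      exact Subtype.ext this
  subst hε
  exact ⟨rfl, ZMod.injective_toCircle (mul_left_cancel h)⟩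

/-- The natural translation covering of `Π_n` by the unfolding: the polygon `(f, ρ)`, placed in the
plane after the rotation by `ρ`, is carried by a translation to the polygon of `Π_n` with parallel
sides. In the coordinates of the standard polygon this is the rotation by `rot`, where
`ρ = ε * exp (2 π i rot / n)` and `ε` is the direction of the polygon of `Π_n`. -/
def veechHom (D : PolygonGluing n) (o : D.Face) : PolyHom (D.unfolding o) (veechSurface n) where
  face x := (D.exists_veechFace o x.2).choose
  rot x := (D.exists_veechFace o x.2).choose_spec.choose
  compat x k := by
    set y := ((D.unfolding o).glue (x, k)).1 with hy
    set l := (D.glue (x.1.1, k)).2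
    have hx1 := (D.exists_veechFace o x.2).choose_spec.choose_spec
    have hy1 := (D.exists_veechFace o y.2).choose_spec.choose_spec
    set ε := (D.exists_veechFace o x.2).choose
    set a := (D.exists_veechFace o x.2).choose_spec.choose
    set δ := (D.exists_veechFace o y.2).choose
    set b := (D.exists_veechFace o y.2).choose_spec.choose
    have hyv : y.1.2 = -ZMod.toCircle (k - l) * x.1.2 := rfl
    have hxy : -ZMod.toCircle (k - l) * (ε.1 * ZMod.toCircle a) = δ.1 * ZMod.toCircle b := by
      have h3 : x.1.2 = ε.1 * ZMod.toCircle a := hx1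
      have h4 : y.1.2 = δ.1 * ZMod.toCircle b := hy1
      rw [← h3, ← h4, hyv]
    have key : VeechFace.opp ε = δ ∧ k - l + a + halfTurn n = b := by
      apply veechFace_unique
      rw [← hxy]
      by_cases hn : Even n
      · simp only [VeechFace.opp, hn, dif_pos]
        rw [AddChar.map_add_eq_mul, AddChar.map_add_eq_mul, ← neg_one_eq_toCircle_halfTurn hn,
          mul_neg_one]
        simp only [neg_mul, mul_neg]
        rw [mul_left_comm]
      · simp only [VeechFace.opp, halfTurn, hn, dif_neg, if_false, not_false_eq_true, add_zero]
        rw [AddChar.map_add_eq_mul]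
        simp only [neg_mul]
        rw [mul_left_comm]
    change (VeechFace.opp ε, k + a + halfTurn n) = (δ, l + b)
    rw [key.1, ← key.2]
    congr 1
    ring

/-! ### Virtual Weierstrass points and saddle connections -/

/-- `x` lifts to a point of the unfolding whose image in `Π_n` is a Weierstrass point, that is, a
fixed point of the hyperelliptic involution. -/
def IsVirtualWeierstrassPoint (D : PolygonGluing n) (o : D.Face) (x : D.Surface) : Prop :=
  ∃ y : (D.unfolding o).Surface, (D.unfoldingHom o).map y = x ∧
    (hyperelliptic n).map ((D.veechHom o).map y) = (D.veechHom o).map y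

/-- The saddle connection `γ` on `[0, L]` lifts to a saddle connection of the unfolding whose image
in `Π_n` is invariant under the hyperelliptic involution. -/
def IsVirtualWeierstrassSaddle (D : PolygonGluing n) (o : D.Face) (L : ℝ) (γ : ℝ → D.Surface) :
    Prop :=
  ∃ δ : ℝ → (D.unfolding o).Surface, (D.unfolding o).IsSaddleConnection L δ ∧
    (∀ t ∈ Set.Icc 0 L, (D.unfoldingHom o).map (δ t) = γ t) ∧
    (hyperelliptic n).map '' ((fun t => (D.veechHom o).map (δ t)) '' Set.Icc 0 L) =
      (fun t => (D.veechHom o).map (δ t)) '' Set.Icc 0 L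

end PolygonGluing

end

set_option linter.unusedSectionVars false

/-! ### Geometry of the regular polygon -/

section Geometry

variable {n : ℕ} [NeZero n]

theorem norm_vtx (k : ZMod n) : ‖vtx k‖ = 1 := by
  rw [vtx, ZMod.stdAddChar_apply]; exact Circle.norm_coe _

theorem vtx_zero : vtx (0 : ZMod n) = 1 := AddChar.map_zero_eq_one _

theorem vtx_ne_zero (k : ZMod n) : vtx k ≠ 0 := by
  rw [← norm_ne_zero_iff, norm_vtx]; exact one_ne_zero

theorem vtx_injective : Function.Injective (vtx : ZMod n → ℂ) := ZMod.injective_stdAddChar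

theorem conj_vtx (k : ZMod n) : (starRingEnd ℂ) (vtx k) = vtx (-k) := by
  have h : vtx (-k) * vtx k = 1 := by rw [← vtx_add, neg_add_cancel, vtx_zero]
  rw [← Complex.inv_eq_conj (norm_vtx k)]
  exact (eq_inv_of_mul_eq_one_left h).symm

theorem vtx_natCast_re (m : ℕ) : (vtx (m : ZMod n)).re = Real.cos (2 * Real.pi * m / n) := by
  have := ZMod.stdAddChar_coe (N := n) (m : ℤ)
  rw [Int.cast_natCast] at this
  rw [vtx, this]
  have e : (2 * Real.pi * Complex.I * ((m : ℤ) : ℂ) / n : ℂ)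
      = ((2 * Real.pi * m / n : ℝ) : ℂ) * Complex.I := by push_cast; ring
  rw [e, Complex.exp_ofReal_mul_I_re]

theorem vtx_natCast (m : ℕ) :
    vtx (m : ZMod n) = Complex.exp (((2 * Real.pi * m / n : ℝ) : ℂ) * Complex.I) := by
  have := ZMod.stdAddChar_coe (N := n) (m : ℤ)
  rw [Int.cast_natCast] at this
  rw [vtx, this]
  congr 1
  push_cast; ring

/-- Cosine decreases on `[0, π]` and is symmetric about `π`. -/
theorem Real.cos_lt_cos_of_mem_Ioo {a x : ℝ} (ha : 0 ≤ a) (h1 : a < x)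
    (h2 : x < 2 * Real.pi - a) : Real.cos x < Real.cos a := by
  rcases le_or_gt x Real.pi with h | h
  · exact Real.strictAntiOn_cos ⟨ha, by linarith⟩ ⟨by linarith, h⟩ h1
  · rw [← Real.cos_two_pi_sub x]
    exact Real.strictAntiOn_cos ⟨ha, by linarith⟩ ⟨by linarith, by linarith⟩ (by linarith)

/-- The sum of the endpoints of a side, an outward normal vector of this side. -/
noncomputable def sideSum (k : ZMod n) : ℂ := vtx k + vtx (k + 1)

/-- The height over the center in the direction of the side `k`. -/
noncomputable def height (k : ZMod n) : ℂ →L[ℝ] ℝ := innerSL ℝ (sideSum k)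

variable (n) in
/-- The height of the points of a side. -/
noncomputable def sideHeight : ℝ := 1 + (vtx (1 : ZMod n)).re

theorem height_apply (k : ZMod n) (z : ℂ) :
    height k z = (z * vtx (-k)).re + (z * vtx (-(k + 1))).re := by
  rw [height, innerSL_apply_apply, Complex.inner, sideSum, map_add, conj_vtx, conj_vtx, mul_add,
    Complex.add_re]

theorem height_vtx (k j : ZMod n) :
    height k (vtx j) = (vtx (j - k)).re + (vtx (j - k - 1)).re := by
  rw [height_apply, ← vtx_add, ← vtx_add, sub_sub, sub_eq_add_neg, sub_eq_add_neg]

theorem height_vtx_mul (a k : ZMod n) (z : ℂ) : height (k + a) (vtx a * z) = height k z := by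
  have h1 : vtx a * z * vtx (-(k + a)) = z * vtx (-k) := by
    have : vtx (-k) = vtx a * vtx (-(k + a)) := by rw [← vtx_add]; congr 1; ring
    rw [this]; ring
  have h2 : vtx a * z * vtx (-(k + a + 1)) = z * vtx (-(k + 1)) := by
    have : vtx (-(k + 1)) = vtx a * vtx (-(k + a + 1)) := by rw [← vtx_add]; congr 1; ring
    rw [this]; ring
  rw [height_apply, height_apply, h1, h2]

theorem re_vtx_neg_one : (vtx (-1 : ZMod n)).re = (vtx (1 : ZMod n)).re := by
  rw [← conj_vtx, Complex.conj_re]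

theorem height_vtx_self (k : ZMod n) : height k (vtx k) = sideHeight n := by
  rw [height_vtx, sub_self, zero_sub, vtx_zero, re_vtx_neg_one, Complex.one_re, sideHeight]

theorem height_vtx_succ (k : ZMod n) : height k (vtx (k + 1)) = sideHeight n := by
  rw [height_vtx, add_sub_cancel_left, sub_self, vtx_zero, Complex.one_re, sideHeight, add_comm]

theorem height_sideSum (k : ZMod n) : height k (sideSum k) = 2 * sideHeight n := by
  rw [sideSum, map_add, height_vtx_self, height_vtx_succ, two_mul]

section
variable (hn : 3 ≤ n)
include hn

theorem vtx_one_re : (vtx (1 : ZMod n)).re = Real.cos (2 * (Real.pi / n)) := by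
  have := vtx_natCast_re (n := n) 1
  rw [Nat.cast_one] at this
  rw [this]; congr 1; push_cast; ring

theorem sideHeight_eq : sideHeight n = 2 * Real.cos (Real.pi / n) * Real.cos (Real.pi / n) := by
  rw [sideHeight, vtx_one_re hn, Real.cos_two_mul]; ring

theorem cos_pi_div_pos : 0 < Real.cos (Real.pi / n) := by
  have h3 : (3 : ℝ) ≤ n := by exact_mod_cast hn
  have hpi := Real.pi_pos
  apply Real.cos_pos_of_mem_Ioo
  constructor
  · have : 0 ≤ Real.pi / n := by positivity
    linarith
  · exact div_lt_div_of_pos_left hpi (by norm_num) (by linarith)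

theorem sideHeight_pos : 0 < sideHeight n := by
  rw [sideHeight_eq hn]
  have := cos_pi_div_pos hn
  positivity

/-- The strict convexity of the polygon. With `j - k = q + 1`, sum-to-product turns the height into
`2 cos ((2q+1)π/n) cos (π/n)`, and the excluded vertices are exactly those for which `(2q+1)π/n` is
`π/n` modulo sign and full turns. -/
theorem height_vtx_lt {k j : ZMod n} (h1 : j ≠ k) (h2 : j ≠ k + 1) :
    height k (vtx j) < sideHeight n := by
  have h3 : (3 : ℝ) ≤ n := by exact_mod_cast hn
  have hpi := Real.pi_pos
  rw [height_vtx, sideHeight_eq hn]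
  set m := (j - k).val with hm
  have hmn : m < n := ZMod.val_lt _
  have hjk : j - k = (m : ZMod n) := by rw [hm, ZMod.natCast_zmod_val]
  have hm0 : m ≠ 0 := by
    intro h; rw [h, Nat.cast_zero] at hjk; exact h1 (sub_eq_zero.mp hjk)
  have hm1 : m ≠ 1 := by
    intro h; rw [h, Nat.cast_one] at hjk; exact h2 (by rw [← hjk]; ring)
  clear_value m
  obtain ⟨q, rfl⟩ : ∃ q, m = q + 1 := ⟨m - 1, by omega⟩
  have hq1 : (1 : ℝ) ≤ q := by exact_mod_cast (by omega : 1 ≤ q)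
  have hqn : (q : ℝ) + 2 ≤ n := by exact_mod_cast (by omega : q + 2 ≤ n)
  rw [hjk]
  have hq : ((q + 1 : ℕ) : ZMod n) - 1 = (q : ZMod n) := by push_cast; ring
  rw [hq, vtx_natCast_re, vtx_natCast_re, Real.cos_add_cos]
  have e1 : (2 * Real.pi * ((q + 1 : ℕ) : ℝ) / n + 2 * Real.pi * q / n) / 2
      = (2 * q + 1) * (Real.pi / n) := by push_cast; ring
  have e2 : (2 * Real.pi * ((q + 1 : ℕ) : ℝ) / n - 2 * Real.pi * q / n) / 2
      = Real.pi / n := by push_cast; ring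
  rw [e1, e2]
  have hd : 0 < Real.pi / n := by positivity
  have hdn : n * (Real.pi / n) = Real.pi := by field_simp
  have hlt : Real.cos ((2 * q + 1) * (Real.pi / n)) < Real.cos (Real.pi / n) := by
    apply Real.cos_lt_cos_of_mem_Ioo hd.le
    · nlinarith
    · nlinarith
  have := cos_pi_div_pos hn
  nlinarith

theorem height_vtx_le (k j : ZMod n) : height k (vtx j) ≤ sideHeight n := by
  by_cases h1 : j = k
  · rw [h1, height_vtx_self]
  by_cases h2 : j = k + 1
  · rw [h2, height_vtx_succ]
  exact (height_vtx_lt hn h1 h2).le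

theorem height_vtx_eq_iff {k j : ZMod n} :
    height k (vtx j) = sideHeight n ↔ j = k ∨ j = k + 1 := by
  constructor
  · intro h
    by_contra! hc
    exact (height_vtx_lt hn hc.1 hc.2).ne h
  · rintro (rfl | rfl)
    · exact height_vtx_self _
    · exact height_vtx_succ _

theorem height_le_of_mem {z : ℂ} (hz : z ∈ RegPoly n) (k : ZMod n) :
    height k z ≤ sideHeight n := by
  have hc : Convex ℝ {w : ℂ | height k w ≤ sideHeight n} :=
    convex_halfSpace_le (height k).isLinear _
  refine convexHull_min ?_ hc hz
  rintro _ ⟨j, rfl⟩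
  exact height_vtx_le hn k j

/-- The cones over the sides cover the plane. The cone is found by rounding down the argument in
units of `2π/n`; the coefficients come from the sine rule. -/
theorem exists_sector (z : ℂ) :
    ∃ k : ZMod n, ∃ s t : ℝ, 0 ≤ s ∧ 0 ≤ t ∧ z = s * vtx k + t * vtx (k + 1) := by
  have h3 : (3 : ℝ) ≤ n := by exact_mod_cast hn
  have hpi := Real.pi_pos
  obtain ⟨θ, hθ0, hz⟩ : ∃ θ : ℝ, 0 ≤ θ ∧ z = ‖z‖ * Complex.exp (θ * Complex.I) := by
    -- The shift by a full turn makes the angle nonnegative, as the natural floor requires.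
    refine ⟨z.arg + 2 * Real.pi, by linarith [Complex.neg_pi_lt_arg z], ?_⟩
    have : ((z.arg + 2 * Real.pi : ℝ) : ℂ) * Complex.I
        = z.arg * Complex.I + 2 * Real.pi * Complex.I := by push_cast; ring
    rw [this, Complex.exp_periodic, Complex.norm_mul_exp_arg_mul_I]
  set β := 2 * Real.pi / n with hβ
  have hβ0 : 0 < β := by positivity
  have hβpi : β < Real.pi := by
    rw [hβ, div_lt_iff₀ (by linarith)]; nlinarith
  set m := ⌊θ / β⌋₊
  set φ := θ - m * β with hφ
  have hφ0 : 0 ≤ φ := by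
    have := Nat.floor_le (div_nonneg hθ0 hβ0.le)
    rw [le_div_iff₀ hβ0] at this
    linarith
  have hφ1 : φ < β := by
    have := Nat.lt_floor_add_one (θ / β)
    rw [div_lt_iff₀ hβ0] at this
    linarith
  have hsin : 0 < Real.sin β := Real.sin_pos_of_pos_of_lt_pi hβ0 hβpi
  refine ⟨m, ‖z‖ * (Real.sin (β - φ) / Real.sin β), ‖z‖ * (Real.sin φ / Real.sin β), ?_, ?_, ?_⟩
  · have := Real.sin_nonneg_of_nonneg_of_le_pi (x := β - φ) (by linarith) (by linarith)
    positivity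
  · have := Real.sin_nonneg_of_nonneg_of_le_pi (x := φ) (by linarith) (by linarith)
    positivity
  · have hv1 : vtx ((m : ZMod n) + 1) = vtx (m : ZMod n) * Complex.exp (β * Complex.I) := by
      rw [vtx_add]
      have := vtx_natCast (n := n) 1
      rw [Nat.cast_one] at this
      rw [this, hβ]; push_cast; ring_nf
    have hv0 : Complex.exp (θ * Complex.I) = vtx (m : ZMod n) * Complex.exp (φ * Complex.I) := by
      rw [vtx_natCast, ← Complex.exp_add, hφ, hβ]; congr 1; push_cast; ring
    have key : (Real.sin β : ℂ) * Complex.exp (φ * Complex.I)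
        = Real.sin (β - φ) + Real.sin φ * Complex.exp (β * Complex.I) := by
      rw [Complex.exp_mul_I, Complex.exp_mul_I, Real.sin_sub]
      push_cast
      ring
    have hs : (Real.sin β : ℂ) ≠ 0 := by exact_mod_cast hsin.ne'
    have key2 : Complex.exp (φ * Complex.I) = (Real.sin (β - φ) / Real.sin β
        + Real.sin φ / Real.sin β * Complex.exp (β * Complex.I) : ℂ) := by
      rw [eq_comm, div_mul_eq_mul_div, ← add_div, ← key, mul_div_cancel_left₀ _ hs]
    conv_lhs => rw [hz]
    rw [hv0, hv1, key2]
    push_cast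
    ring

theorem height_combo (j k : ZMod n) (s t : ℝ) :
    height j (s * vtx k + t * vtx (k + 1)) = s * height j (vtx k) + t * height j (vtx (k + 1)) := by
  rw [← Complex.real_smul, ← Complex.real_smul, map_add, map_smul, map_smul]; rfl

theorem zero_mem_regPoly : (0 : ℂ) ∈ RegPoly n := by
  have hs : ∑ k : ZMod n, vtx k = 0 := by
    have : Fact (1 < n) := ⟨by omega⟩
    apply AddChar.sum_eq_zero_of_ne_one
    intro h
    have : vtx (1 : ZMod n) = vtx (0 : ZMod n) := by
      rw [vtx_zero]; exact DFunLike.congr_fun h 1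
    exact one_ne_zero (vtx_injective this)
  have hc : (0 : ℂ) = ∑ k : ZMod n, (1 / n : ℝ) • vtx k := by
    rw [← Finset.smul_sum, hs, smul_zero]
  rw [hc]
  apply (convex_convexHull ℝ _).sum_mem
  · intros; positivity
  · simp [ZMod.card]
  · intro i _; exact vtx_mem_regPoly i

/-- In the cone over the side `k`, the inequality for `k` alone says that the cone coordinates
satisfy `s + t ≤ 1`, so the point is a convex combination of `0` and two vertices. -/
theorem mem_regPoly_iff {z : ℂ} : z ∈ RegPoly n ↔ ∀ k : ZMod n, height k z ≤ sideHeight n := by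
  refine ⟨fun h => height_le_of_mem hn h, fun h => ?_⟩
  obtain ⟨k, s, t, hs, ht, rfl⟩ := exists_sector hn z
  have hk := h k
  rw [height_combo hn, height_vtx_self, height_vtx_succ] at hk
  have hst : s + t ≤ 1 := by
    have := sideHeight_pos hn
    by_contra! hc
    nlinarith
  have := (convex_convexHull ℝ (Set.range (vtx : ZMod n → ℂ))).sum_mem
    (t := Finset.univ) (w := ![1 - s - t, s, t]) (z := ![0, vtx k, vtx (k + 1)]) (by
      intro i _; fin_cases i <;> simp <;> linarith) (by
      simp [Fin.sum_univ_three]; ring) (by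
      intro i _
      fin_cases i
      · exact zero_mem_regPoly hn
      · exact vtx_mem_regPoly k
      · exact vtx_mem_regPoly (k + 1))
  simp only [Fin.sum_univ_three] at this
  simpa [RegPoly, Complex.real_smul] using this

theorem one_add_one_ne_zero_zmod : (1 : ZMod n) + 1 ≠ 0 := by
  intro h
  have : ((2 : ℕ) : ZMod n) = 0 := by push_cast; rw [← h]; norm_num
  rw [ZMod.natCast_eq_zero_iff] at this
  have := Nat.le_of_dvd (by norm_num) this
  omega

theorem one_ne_zero_zmod : (1 : ZMod n) ≠ 0 := by
  have : Fact (1 < n) := ⟨by omega⟩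
  exact one_ne_zero

theorem side_subset_regPoly (k : ZMod n) : side k ⊆ RegPoly n :=
  (convex_convexHull ℝ _).segment_subset (vtx_mem_regPoly k) (vtx_mem_regPoly (k + 1))

theorem mem_side_iff_exists {k : ZMod n} {z : ℂ} : z ∈ side k ↔
    ∃ s t : ℝ, 0 ≤ s ∧ 0 ≤ t ∧ s + t = 1 ∧ z = s * vtx k + t * vtx (k + 1) := by
  constructor
  · rintro ⟨s, t, hs, ht, hst, rfl⟩
    exact ⟨s, t, hs, ht, hst, by simp⟩
  · rintro ⟨s, t, hs, ht, hst, rfl⟩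
    exact ⟨s, t, hs, ht, hst, by simp⟩

theorem height_of_mem_side {k : ZMod n} {z : ℂ} (hz : z ∈ side k) : height k z = sideHeight n := by
  obtain ⟨s, t, hs, ht, hst, rfl⟩ := (mem_side_iff_exists hn).mp hz
  rw [height_combo hn, height_vtx_self, height_vtx_succ, ← add_mul, hst, one_mul]

/-- A convex combination of two adjacent vertices attains the maximal height over `k` only if every
vertex with positive weight does, and these vertices are the ends of the side `k`. -/
theorem mem_side_iff {k : ZMod n} {z : ℂ} :
    z ∈ side k ↔ z ∈ RegPoly n ∧ height k z = sideHeight n := by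
  refine ⟨fun h => ⟨side_subset_regPoly hn k h, height_of_mem_side hn h⟩, fun ⟨hz, hk⟩ => ?_⟩
  have hpos := sideHeight_pos hn
  obtain ⟨j, s, t, hs, ht, rfl⟩ := exists_sector hn z
  have hj := height_le_of_mem hn hz j
  rw [height_combo hn, height_vtx_self, height_vtx_succ] at hj
  rw [height_combo hn] at hk
  have h1 := height_vtx_le hn k j
  have h2 := height_vtx_le hn k (j + 1)
  have hst : s + t = 1 := by
    apply le_antisymm
    · by_contra! hc; nlinarith
    · by_contra! hc; nlinarith
  have hA : s = 0 ∨ height k (vtx j) = sideHeight n := by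
    by_contra! hc
    have : height k (vtx j) < sideHeight n := lt_of_le_of_ne h1 hc.2
    have : 0 < s := lt_of_le_of_ne hs hc.1.symm
    nlinarith
  have hB : t = 0 ∨ height k (vtx (j + 1)) = sideHeight n := by
    by_contra! hc
    have : height k (vtx (j + 1)) < sideHeight n := lt_of_le_of_ne h2 hc.2
    have : 0 < t := lt_of_le_of_ne ht hc.1.symm
    nlinarith
  rw [height_vtx_eq_iff hn] at hA hB
  have hv : ∀ i : ZMod n, i = k ∨ i = k + 1 → vtx i ∈ side k := by
    rintro i (rfl | rfl)
    · exact left_mem_segment ℝ _ _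
    · exact right_mem_segment ℝ _ _
  have hconv : Convex ℝ (side k) := convex_segment _ _
  rcases hA with rfl | hA
  · have : t = 1 := by linarith
    subst this
    simpa using hv _ (hB.resolve_left one_ne_zero)
  rcases hB with rfl | hB
  · have : s = 1 := by linarith
    subst this
    simpa using hv _ hA
  simpa using hconv (hv _ hA) (hv _ hB) hs ht hst

theorem regPoly_isClosed : IsClosed (RegPoly n) :=
  (Set.finite_range _).isClosed_convexHull ℝ

theorem norm_le_one_of_mem {z : ℂ} (hz : z ∈ RegPoly n) : ‖z‖ ≤ 1 := by
  have : RegPoly n ⊆ Metric.closedBall 0 1 := by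
    apply convexHull_min _ (convex_closedBall 0 1)
    rintro _ ⟨k, rfl⟩
    simp [norm_vtx]
  simpa using this hz

theorem mem_interior_regPoly_iff {z : ℂ} :
    z ∈ interior (RegPoly n) ↔ ∀ k : ZMod n, height k z < sideHeight n := by
  constructor
  · intro h k
    have hpos := sideHeight_pos hn
    -- An interior point can be pushed a little in the outward normal direction, so its height is
    -- not maximal.
    have hc : Tendsto (fun e : ℝ => z + e * sideSum k) (𝓝[>] 0) (𝓝 z) := by
      have : Continuous (fun e : ℝ => z + e * sideSum k) := by fun_prop
      have h2 := this.tendsto 0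
      simp only [Complex.ofReal_zero, zero_mul, add_zero] at h2
      exact h2.mono_left nhdsWithin_le_nhds
    have h1 := hc.eventually (isOpen_interior.mem_nhds h)
    obtain ⟨e, he, he0⟩ := (h1.and self_mem_nhdsWithin).exists
    have := height_le_of_mem hn (interior_subset he) k
    rw [map_add, ← Complex.real_smul, map_smul, height_sideSum, smul_eq_mul] at this
    have he0 : 0 < e := he0
    nlinarith
  · intro h
    have ho : IsOpen {w : ℂ | ∀ k : ZMod n, height k w < sideHeight n} := by
      simp only [Set.ofPred_forall]
      exact isOpen_iInter_of_finite fun k =>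
        isOpen_lt (height k).continuous continuous_const
    exact interior_maximal (fun w hw => (mem_regPoly_iff hn).mpr fun k => (hw k).le) ho h

theorem mem_interior_or_side {z : ℂ} (hz : z ∈ RegPoly n) :
    z ∈ interior (RegPoly n) ∨ ∃ k : ZMod n, z ∈ side k := by
  rw [mem_interior_regPoly_iff hn]
  by_contra! hc
  obtain ⟨⟨k, hk⟩, h2⟩ := hc
  exact h2 k ((mem_side_iff hn).mpr ⟨hz, le_antisymm (height_le_of_mem hn hz k) hk⟩)

theorem vtx_mem_side_iff {j k : ZMod n} : vtx j ∈ side k ↔ j = k ∨ j = k + 1 := by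
  rw [mem_side_iff hn, height_vtx_eq_iff hn]
  exact ⟨fun h => h.2, fun h => ⟨vtx_mem_regPoly j, h⟩⟩

/-- A point that is not a vertex lies on at most one side. -/
theorem side_unique {j k : ZMod n} {z : ℂ} (hz : z ∉ Set.range (vtx : ZMod n → ℂ))
    (hk : z ∈ side k) (hj : z ∈ side j) : j = k := by
  obtain ⟨s, t, hs, ht, hst, rfl⟩ := (mem_side_iff_exists hn).mp hk
  have hs0 : 0 < s := by
    refine lt_of_le_of_ne hs fun h => hz ⟨k + 1, ?_⟩
    have : t = 1 := by linarith
    rw [← h, this]; simp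
  have ht0 : 0 < t := by
    refine lt_of_le_of_ne ht fun h => hz ⟨k, ?_⟩
    have : s = 1 := by linarith
    rw [← h, this]; simp
  have h := height_of_mem_side hn hj
  rw [height_combo hn] at h
  have h1 := height_vtx_le hn j k
  have h2 := height_vtx_le hn j (k + 1)
  have hA : height j (vtx k) = sideHeight n := by
    by_contra hc
    have := mul_lt_mul_of_pos_left (lt_of_le_of_ne h1 hc) hs0
    have := mul_le_mul_of_nonneg_left h2 ht
    have e : s * sideHeight n + t * sideHeight n = sideHeight n := by rw [← add_mul, hst, one_mul]
    linarith
  have hB : height j (vtx (k + 1)) = sideHeight n := by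
    by_contra hc
    have := mul_lt_mul_of_pos_left (lt_of_le_of_ne h2 hc) ht0
    have := mul_le_mul_of_nonneg_left h1 hs
    have e : s * sideHeight n + t * sideHeight n = sideHeight n := by rw [← add_mul, hst, one_mul]
    linarith
  rw [height_vtx_eq_iff hn] at hA hB
  rcases hA with hA | hA
  · exact hA.symm
  rcases hB with hB | hB
  · exfalso
    rw [hA] at hB
    exact one_add_one_ne_zero_zmod hn (by linear_combination hB)
  · exact (add_right_cancel hB).symm

/-! ### The lens: a polygon and its neighbour developed in the plane -/

/-- The union of the polygon and its reflection in the midpoint of the side `k`. -/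
def lens (k : ZMod n) : Set ℂ := RegPoly n ∪ {z | sideSum k - z ∈ RegPoly n}

-- A gluing map is the half-turn about the midpoint of the side followed by a rotational symmetry of
-- the polygon. Hence the shape of a chart region depends only on the side, not on its partner.
omit hn in
theorem sideMap_eq (k l : ZMod n) (z : ℂ) : sideMap k l z = vtx (l - k) * (sideSum k - z) := by
  have h1 : vtx l = vtx (l - k) * vtx k := by rw [← vtx_add, sub_add_cancel]
  have h2 : vtx (l + 1) = vtx (l - k) * vtx (k + 1) := by rw [← vtx_add]; congr 1; ring
  rw [sideMap, sideSum, h1, h2]; ring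

omit hn in
theorem vtx_mul_mem_regPoly_iff (a : ZMod n) {z : ℂ} : vtx a * z ∈ RegPoly n ↔ z ∈ RegPoly n := by
  refine ⟨fun h => ?_, vtx_mul_mem_regPoly a⟩
  have := vtx_mul_mem_regPoly (-a) h
  rwa [← mul_assoc, ← vtx_add, neg_add_cancel, vtx_zero, one_mul] at this

omit hn in
theorem sideMap_mem_regPoly_iff {k l : ZMod n} {z : ℂ} :
    sideMap k l z ∈ RegPoly n ↔ sideSum k - z ∈ RegPoly n := by
  rw [sideMap_eq, vtx_mul_mem_regPoly_iff]

omit hn in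
theorem sideMap_sideMap (k l : ZMod n) (z : ℂ) : sideMap l k (sideMap k l z) = z := by
  have h1 : vtx (k - l) * vtx (l - k) = 1 := by rw [← vtx_add]; simp [vtx_zero]
  have h2 : vtx k = vtx (k - l) * vtx l := by rw [← vtx_add, sub_add_cancel]
  have h3 : vtx (k + 1) = vtx (k - l) * vtx (l + 1) := by rw [← vtx_add]; congr 1; ring
  rw [sideMap, sideMap, h2, h3]
  linear_combination z * h1

omit hn in
theorem continuous_sideMap (k l : ZMod n) : Continuous (sideMap k l) := by
  unfold sideMap; fun_prop

omit hn in
theorem sideMap_mem_side {k l : ZMod n} {z : ℂ} (hz : z ∈ side k) : sideMap k l z ∈ side l := by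
  obtain ⟨s, t, hs, ht, hst, rfl⟩ := hz
  refine ⟨t, s, ht, hs, by linarith, ?_⟩
  have h1 := sideMap_start k l
  have h2 := sideMap_end k l
  have hst' : (s : ℂ) + t = 1 := by exact_mod_cast hst
  simp only [Complex.real_smul]
  rw [sideMap] at h1 h2 ⊢
  linear_combination (-s : ℂ) * h1 - t * h2 + (vtx (l + 1) + vtx l) * hst'

omit hn in
theorem sideSum_sub_mem_side {k : ZMod n} {z : ℂ} (hz : z ∈ side k) : sideSum k - z ∈ side k := by
  have := sideMap_mem_side (l := k) hz
  rwa [sideMap_eq, sub_self, vtx_zero, one_mul] at this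

/-- The two halves of the lens lie on opposite sides of the line through the side `k`. -/
theorem mem_side_of_mem_of_sub_mem {k : ZMod n} {z : ℂ} (h1 : z ∈ RegPoly n)
    (h2 : sideSum k - z ∈ RegPoly n) : z ∈ side k := by
  refine (mem_side_iff hn).mpr ⟨h1, le_antisymm (height_le_of_mem hn h1 k) ?_⟩
  have := height_le_of_mem hn h2 k
  rw [map_sub, height_sideSum] at this
  linarith

omit hn in
theorem sideMap_mem_range_vtx {k l : ZMod n} {z : ℂ} (hk : z ∈ side k) (hn : 3 ≤ n)
    (h : z ∈ Set.range (vtx : ZMod n → ℂ)) : sideMap k l z ∈ Set.range (vtx : ZMod n → ℂ) := by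
  obtain ⟨j, rfl⟩ := h
  rcases (vtx_mem_side_iff hn).mp hk with rfl | rfl
  · exact ⟨_, (sideMap_start _ _).symm⟩
  · exact ⟨_, (sideMap_end _ _).symm⟩

theorem sideMap_mem_range_vtx_iff {k l : ZMod n} {z : ℂ} (hk : z ∈ side k) :
    sideMap k l z ∈ Set.range (vtx : ZMod n → ℂ) ↔ z ∈ Set.range (vtx : ZMod n → ℂ) := by
  refine ⟨fun h => ?_, sideMap_mem_range_vtx hk hn⟩
  rw [← sideMap_sideMap k l z]
  exact sideMap_mem_range_vtx (sideMap_mem_side hk) hn h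

/-- Interior points of a side are interior points of the lens. -/
theorem mem_interior_lens_of_mem_side {k : ZMod n} {z : ℂ} (hk : z ∈ side k)
    (hz : z ∉ Set.range (vtx : ZMod n → ℂ)) : z ∈ interior (lens k) := by
  -- Only the inequality for `k` is dropped, both for `w` and for its reflection. Whichever side of
  -- the line `w` is on, it then lies in one half of the lens.
  have ho : IsOpen {w : ℂ | ∀ j : ZMod n, j ≠ k →
      height j w < sideHeight n ∧ height j (sideSum k - w) < sideHeight n} := by
    simp only [Set.ofPred_forall]
    exact isOpen_iInter_of_finite fun j => isOpen_iInter_of_finite fun _ =>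
      (isOpen_lt (height j).continuous continuous_const).inter
        (isOpen_lt ((height j).continuous.comp (by fun_prop)) continuous_const)
  refine interior_maximal (fun w hw => ?_) ho (fun j hj => ?_)
  · rcases le_or_gt (height k w) (sideHeight n) with h | h
    · left
      rw [mem_regPoly_iff hn]
      intro j
      by_cases hj : j = k
      · rwa [hj]
      · exact (hw j hj).1.le
    · right
      change _ ∈ RegPoly n
      rw [mem_regPoly_iff hn]
      intro j
      by_cases hj : j = k
      · rw [hj, map_sub, height_sideSum]; linarith
      · exact (hw j hj).2.le
  · have hz' : sideSum k - z ∉ Set.range (vtx : ZMod n → ℂ) := by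
      have := (sideMap_mem_range_vtx_iff hn (l := k) hk).not.mpr hz
      rwa [sideMap_eq, sub_self, vtx_zero, one_mul] at this
    have aux : ∀ w ∈ side k, w ∉ Set.range (vtx : ZMod n → ℂ) → height j w < sideHeight n := by
      intro w hw hwv
      have hP := side_subset_regPoly hn k hw
      refine lt_of_le_of_ne (height_le_of_mem hn hP j) fun he => hj ?_
      exact side_unique hn hwv hw ((mem_side_iff hn).mpr ⟨hP, he⟩)
    exact ⟨aux _ hk hz, aux _ (sideSum_sub_mem_side hk) hz'⟩

theorem interior_subset_interior_lens (k : ZMod n) : interior (RegPoly n) ⊆ interior (lens k) :=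
  interior_mono Set.subset_union_left

theorem exists_mem_interior_lens {z : ℂ} (h : z ∈ RegPoly n)
    (hz : z ∉ Set.range (vtx : ZMod n → ℂ)) : ∃ k : ZMod n, z ∈ interior (lens k) := by
  rcases mem_interior_or_side hn h with h | ⟨k, hk⟩
  · exact ⟨0, interior_subset_interior_lens hn 0 h⟩
  · exact ⟨k, mem_interior_lens_of_mem_side hn hk hz⟩

/-- A point of the polygon that is interior to the lens is interior to the polygon or lies on the
common side. -/
theorem mem_interior_or_mem_side {k : ZMod n} {z : ℂ} (h : z ∈ RegPoly n)
    (hz : z ∈ interior (lens k)) : z ∈ interior (RegPoly n) ∨ z ∈ side k := by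
  rcases eq_or_lt_of_le (height_le_of_mem hn h k) with he | hlt
  · exact Or.inr ((mem_side_iff hn).mpr ⟨h, he⟩)
  · left
    have ho : IsOpen (interior (lens k) ∩ {w | height k w < sideHeight n}) :=
      isOpen_interior.inter (isOpen_lt (height k).continuous continuous_const)
    refine interior_maximal (fun w hw => ?_) ho ⟨hz, hlt⟩
    rcases interior_subset hw.1 with h1 | h1
    · exact h1
    · have h2 := height_le_of_mem hn h1 k
      rw [map_sub, height_sideSum] at h2
      have h3 : height k w < sideHeight n := hw.2
      linarith

theorem vtx_notMem_interior_regPoly (j : ZMod n) : vtx j ∉ interior (RegPoly n) := fun h =>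
  ((mem_interior_regPoly_iff hn).mp h j).ne (height_vtx_self j)

theorem notMem_interior_of_mem_side {k : ZMod n} {z : ℂ} (h : z ∈ side k) :
    z ∉ interior (RegPoly n) := fun h' =>
  ((mem_interior_regPoly_iff hn).mp h' k).ne (height_of_mem_side hn h)

theorem re_vtx_one_lt_one : (vtx (1 : ZMod n)).re < 1 := by
  rw [vtx_one_re hn]
  have h3 : (3 : ℝ) ≤ n := by exact_mod_cast hn
  have hpi := Real.pi_pos
  have h0 : 0 < Real.pi / n := by positivity
  have h1 : n * (Real.pi / n) = Real.pi := by field_simp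
  rw [← Real.cos_zero]
  apply Real.cos_lt_cos_of_mem_Ioo le_rfl <;> nlinarith

/-- A chord of the unit circle, prolonged beyond its endpoint `a`, leaves the disc. -/
theorem one_lt_norm_extension {a b : ℂ} (ha : ‖a‖ = 1) (hb : ‖b‖ = 1) (hab : a ≠ b) {e : ℝ}
    (he : 0 < e) : 1 < ‖a + e * (a - b)‖ := by
  have h1 : 0 < ‖a - b‖ := norm_pos_iff.mpr (sub_ne_zero.mpr hab)
  have h2 : ‖a - b‖ ^ 2 = 2 - 2 * inner ℝ a b := by
    rw [norm_sub_sq_real, ha, hb]; ring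
  have h3 : ‖a + e * (a - b)‖ ^ 2 = 1 + 2 * (e * (1 - inner ℝ a b)) + e ^ 2 * ‖a - b‖ ^ 2 := by
    rw [← Complex.real_smul, norm_add_sq_real, ha, inner_smul_right, inner_sub_right,
      real_inner_self_eq_norm_sq, ha, norm_smul, mul_pow, Real.norm_eq_abs, sq_abs]
    ring
  have h4 : 0 < ‖a - b‖ ^ 2 := by positivity
  have h5 : 1 < ‖a + e * (a - b)‖ ^ 2 := by
    rw [h3]
    have : 0 < e * (1 - inner ℝ a b) := mul_pos he (by linarith)
    have : 0 < e ^ 2 * ‖a - b‖ ^ 2 := by positivity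
    linarith
  nlinarith [norm_nonneg (a + e * (a - b))]

/-- Vertices are not interior points of the lens. -/
theorem vtx_notMem_interior_lens (j k : ZMod n) : vtx j ∉ interior (lens k) := by
  intro h
  -- Prolonging the common side beyond `vtx a` leaves the polygon; the half-turn sends this
  -- prolongation to the one beyond `vtx b`, so it leaves the developed polygon too.
  have aux : ∀ a b : ZMod n, a ≠ b → sideSum k = vtx a + vtx b → vtx a ∉ interior (lens k) := by
    intro a b hab hS hmem
    have hab' : vtx a ≠ vtx b := fun h => hab (vtx_injective h)
    have hc : Tendsto (fun e : ℝ => vtx a + e * (vtx a - vtx b)) (𝓝[>] 0) (𝓝 (vtx a)) := by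
      have : Continuous (fun e : ℝ => vtx a + e * (vtx a - vtx b)) := by fun_prop
      have h2 := this.tendsto 0
      simp only [Complex.ofReal_zero, zero_mul, add_zero] at h2
      exact h2.mono_left nhdsWithin_le_nhds
    obtain ⟨e, he, he0⟩ :=
      ((hc.eventually (isOpen_interior.mem_nhds hmem)).and self_mem_nhdsWithin).exists
    have he0 : 0 < e := he0
    rcases interior_subset he with h1 | h1
    · exact (one_lt_norm_extension hn (norm_vtx a) (norm_vtx b) hab' he0).not_ge
        (norm_le_one_of_mem hn h1)
    · refine (one_lt_norm_extension hn (norm_vtx b) (norm_vtx a) hab'.symm he0).not_ge ?_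
      have := norm_le_one_of_mem hn h1
      have e : sideSum k - (vtx a + e * (vtx a - vtx b)) = vtx b + e * (vtx b - vtx a) := by
        rw [hS]; ring
      rwa [e] at this
  have h1 : k ≠ k + 1 := by
    intro h; exact one_ne_zero_zmod hn (left_eq_add.mp h)
  rcases mem_interior_or_mem_side hn (vtx_mem_regPoly j) h with h' | h'
  · exact vtx_notMem_interior_regPoly hn j h'
  · rcases (vtx_mem_side_iff hn).mp h' with rfl | rfl
    · exact aux _ _ h1 rfl h
    · exact aux _ _ h1.symm (add_comm _ _) h

theorem notMem_range_vtx_of_mem_interior_lens {k : ZMod n} {z : ℂ} (h : z ∈ interior (lens k)) :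
    z ∉ Set.range (vtx : ZMod n → ℂ) := by
  rintro ⟨j, rfl⟩; exact vtx_notMem_interior_lens hn j k h

theorem notMem_range_vtx_of_mem_interior {z : ℂ} (h : z ∈ interior (RegPoly n)) :
    z ∉ Set.range (vtx : ZMod n → ℂ) := by
  rintro ⟨j, rfl⟩; exact vtx_notMem_interior_regPoly hn j h

/-- This identifies charts: the only chart of a polygon that is valid at a point of one of its sides
is the chart across that side. -/
theorem eq_of_mem_side_of_mem_interior_lens {j k : ZMod n} {z : ℂ} (hj : z ∈ side j)
    (h : z ∈ interior (lens k)) : j = k :=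
  side_unique hn (notMem_range_vtx_of_mem_interior_lens hn h)
    ((mem_interior_or_mem_side hn (side_subset_regPoly hn j hj) h).resolve_left
      (notMem_interior_of_mem_side hn hj)) hj

theorem midpoint_mem_side (k : ZMod n) : sideSum k / 2 ∈ side k :=
  (mem_side_iff_exists hn).mpr ⟨1 / 2, 1 / 2, by norm_num, by norm_num, by norm_num, by
    rw [sideSum]; push_cast; ring⟩

theorem midpoint_notMem_range_vtx (k : ZMod n) :
    sideSum k / 2 ∉ Set.range (vtx : ZMod n → ℂ) := by
  rintro ⟨j, hj⟩
  have hs := midpoint_mem_side hn k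
  rw [← hj, vtx_mem_side_iff hn] at hs
  have hne : vtx k ≠ vtx (k + 1) := by
    intro h; exact one_ne_zero_zmod hn (left_eq_add.mp (vtx_injective h))
  rcases hs with rfl | rfl
  · exact hne (by rw [sideSum] at hj; linear_combination 2 * hj)
  · exact hne (by rw [sideSum] at hj; linear_combination -2 * hj)

theorem zero_mem_interior : (0 : ℂ) ∈ interior (RegPoly n) := by
  rw [mem_interior_regPoly_iff hn]
  intro k; rw [map_zero]; exact sideHeight_pos hn

theorem mul_mem_interior_of_lt_one {z : ℂ} (hz : z ∈ RegPoly n) {s : ℝ} (h0 : 0 ≤ s)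
    (h1 : s < 1) : (s : ℂ) * z ∈ interior (RegPoly n) := by
  rw [mem_interior_regPoly_iff hn]
  intro k
  rw [← Complex.real_smul, map_smul, smul_eq_mul]
  have := height_le_of_mem hn hz k
  have := sideHeight_pos hn
  nlinarith

theorem vtx_mul_mem_interior (a : ZMod n) {z : ℂ} (hz : z ∈ interior (RegPoly n)) :
    vtx a * z ∈ interior (RegPoly n) := by
  rw [mem_interior_regPoly_iff hn] at hz ⊢
  intro k
  have := height_vtx_mul a (k - a) z
  rw [sub_add_cancel] at this
  rw [this]; exact hz _

omit hn in
theorem vtx_mul_mem_range_iff (a : ZMod n) {z : ℂ} :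
    vtx a * z ∈ Set.range (vtx : ZMod n → ℂ) ↔ z ∈ Set.range (vtx : ZMod n → ℂ) := by
  constructor
  · rintro ⟨j, hj⟩
    exact ⟨j - a, mul_left_cancel₀ (vtx_ne_zero a) (by rw [← hj, ← vtx_add]; congr 1; ring)⟩
  · rintro ⟨j, rfl⟩
    exact ⟨a + j, vtx_add _ _⟩

omit hn in
theorem sideSum_add (k a : ZMod n) : sideSum (k + a) = vtx a * sideSum k := by
  rw [sideSum, sideSum, mul_add, ← vtx_add, ← vtx_add]; congr 2 <;> ring

omit hn in
theorem vtx_mul_mem_lens_iff {k a : ZMod n} {z : ℂ} : vtx a * z ∈ lens (k + a) ↔ z ∈ lens k := by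
  simp only [lens, Set.mem_union, Set.mem_ofPred_eq, vtx_mul_mem_regPoly_iff, sideSum_add,
    ← mul_sub]

omit hn in
theorem vtx_mul_mem_interior_lens {k a : ZMod n} {z : ℂ} (hz : z ∈ interior (lens k)) :
    vtx a * z ∈ interior (lens (k + a)) := by
  have ho : IsOpenMap (fun w : ℂ => vtx a * w) :=
    (Homeomorph.mulLeft₀ (vtx a) (vtx_ne_zero a)).isOpenMap
  refine interior_maximal ?_ (ho _ isOpen_interior) ⟨z, hz, rfl⟩
  rintro _ ⟨w, hw, rfl⟩
  exact vtx_mul_mem_lens_iff.mpr (interior_subset hw)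

end

/-- A ray that starts at an interior point of the union of two closed convex sets stays in one of
them for some time. -/
theorem eventually_mem_or_of_convex {P Q : Set ℂ} (hP : Convex ℝ P) (hPc : IsClosed P)
    {z : ℂ} (hz : z ∈ interior (P ∪ Q)) (u : ℂ) :
    (∀ᶠ r : ℝ in 𝓝[>] 0, z + r * u ∈ P) ∨ (∀ᶠ r : ℝ in 𝓝[>] 0, z + r * u ∈ Q) := by
  have hcont : Continuous (fun r : ℝ => z + r * u) := by fun_prop
  have hc : Tendsto (fun r : ℝ => z + r * u) (𝓝[>] 0) (𝓝 z) := by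
    have h2 := hcont.tendsto 0
    simp only [Complex.ofReal_zero, zero_mul, add_zero] at h2
    exact h2.mono_left nhdsWithin_le_nhds
  -- If the ray meets `P` at arbitrarily small times, then `z ∈ P` by closedness, and convexity
  -- fills in a whole initial segment. Otherwise the ray must run in `Q`.
  by_cases hf : ∃ᶠ r : ℝ in 𝓝[>] 0, z + r * u ∈ P
  · left
    have hzP : z ∈ P := hPc.mem_of_frequently_of_tendsto hf hc
    obtain ⟨e, he, he0⟩ := (hf.and_eventually self_mem_nhdsWithin).exists
    have he0 : 0 < e := he0
    filter_upwards [Ioo_mem_nhdsGT he0] with r hr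
    have := hP hzP he (a := 1 - r / e) (b := r / e)
      (by rw [sub_nonneg, div_le_one he0]; exact hr.2.le) (div_nonneg hr.1.le he0.le) (by ring)
    convert this using 1
    have he' : (e : ℂ) ≠ 0 := by exact_mod_cast he0.ne'
    simp only [Complex.real_smul]
    push_cast
    field_simp
    ring
  · right
    rw [not_frequently] at hf
    filter_upwards [hf, hc.eventually (isOpen_interior.mem_nhds hz)] with r h1 h2
    exact (interior_subset h2).resolve_left h1

theorem eventually_mem_lens_cases {k : ZMod n} {z : ℂ} (hz : z ∈ interior (lens k)) (u : ℂ) :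
    (∀ᶠ r : ℝ in 𝓝[>] 0, z + r * u ∈ RegPoly n) ∨
      (∀ᶠ r : ℝ in 𝓝[>] 0, sideSum k - (z + r * u) ∈ RegPoly n) :=
  eventually_mem_or_of_convex (convex_convexHull ℝ _)
    ((Set.finite_range _).isClosed_convexHull ℝ) hz u

end Geometry

namespace PolygonGluing

/-! ### Coordinates on the surface -/

section Coordinates

variable {n : ℕ} [NeZero n] {D E : PolygonGluing n}

theorem rel_symm {x y : (_ : D.Face) × RegPoly n} (h : D.Rel x y) : D.Rel y x := by
  obtain ⟨k, l, hg, hx, hy⟩ := h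
  refine ⟨l, k, by rw [← hg, D.glue_glue], ?_, ?_⟩
  · rw [hy]; exact sideMap_mem_side hx
  · rw [hy, sideMap_sideMap]

theorem glue_symm {f g : D.Face} {k l : ZMod n} (hg : D.glue (f, k) = (g, l)) :
    D.glue (g, l) = (f, k) := by rw [← hg, D.glue_glue]

theorem HasCoord.mem {f : D.Face} {z : ℂ} {x : D.Surface} (h : D.HasCoord f z x) :
    z ∈ RegPoly n := h.1

theorem HasCoord.unique {f : D.Face} {z : ℂ} {x y : D.Surface} (h : D.HasCoord f z x)
    (h' : D.HasCoord f z y) : x = y := by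
  obtain ⟨_, rfl⟩ := h
  obtain ⟨_, rfl⟩ := h'
  rfl

theorem exists_hasCoord (x : D.Surface) : ∃ f z, D.HasCoord f z x := by
  obtain ⟨⟨f, z⟩, rfl⟩ := Quot.exists_rep x
  exact ⟨f, z, z.2, rfl⟩

theorem HasCoord.glue {f g : D.Face} {k l : ZMod n} (hg : D.glue (f, k) = (g, l)) {z : ℂ}
    {x : D.Surface} (hk : z ∈ side k) (h : D.HasCoord f z x) :
    D.HasCoord g (sideMap k l z) x := by
  obtain ⟨hz, rfl⟩ := h
  refine ⟨convexHull_mono subset_rfl ?_, ?_⟩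
  · exact (convex_convexHull ℝ _).segment_subset (vtx_mem_regPoly l) (vtx_mem_regPoly (l + 1))
      (sideMap_mem_side hk)
  · exact (Quot.sound ⟨k, l, hg, hk, rfl⟩ : D.pt f ⟨z, hz⟩ = _).symm

section
variable (hn : 3 ≤ n)
include hn

/-- Two coordinates of a point that is not a vertex. -/
theorem HasCoord.eq_or {f f' : D.Face} {z z' : ℂ} {x : D.Surface} (h : D.HasCoord f z x)
    (h' : D.HasCoord f' z' x) (hz : z ∉ Set.range (vtx : ZMod n → ℂ)) :
    (f = f' ∧ z = z') ∨ ∃ k l, D.glue (f, k) = (f', l) ∧ z ∈ side k ∧ z' = sideMap k l z := by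
  obtain ⟨hzP, rfl⟩ := h
  obtain ⟨hzP', h'⟩ := h'
  set a : (_ : D.Face) × RegPoly n := ⟨f, ⟨z, hzP⟩⟩
  -- Away from the vertices a point lies on at most one side, so a second gluing undoes the first.
  -- The class of `a` therefore consists of `a` and its direct partners, and this predicate descends
  -- to the quotient.
  have step : ∀ y w, D.Rel y w → (a = y ∨ D.Rel a y) → (a = w ∨ D.Rel a w) := by
    rintro y w ⟨k', l', hg', hy, hw⟩ (rfl | ⟨k, l, hg, ha, hy'⟩)
    · exact Or.inr ⟨k', l', hg', hy, hw⟩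
    · left
      have hk : k' = l := by
        refine side_unique hn (z := (y.2 : ℂ)) ?_ ?_ hy
        · rw [hy', sideMap_mem_range_vtx_iff hn ha]; exact hz
        · rw [hy']; exact sideMap_mem_side ha
      subst hk
      rw [glue_symm hg] at hg'
      have h1 : a.1 = w.1 := congrArg Prod.fst hg'
      have h2 : k = l' := congrArg Prod.snd hg'
      rw [← h2, hy', sideMap_sideMap] at hw
      obtain ⟨wf, wz⟩ := w
      dsimp only at h1 hw
      subst h1
      exact congrArg (Sigma.mk f) (Subtype.ext hw.symm)
  have hS : ∀ y w, D.Rel y w → (a = y ∨ D.Rel a y) = (a = w ∨ D.Rel a w) := fun y w hyw =>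
    propext ⟨step y w hyw, step w y (rel_symm hyw)⟩
  have key := congrArg (Quot.lift (fun y => a = y ∨ D.Rel a y) hS) h'
  have key2 : (a = ⟨f', ⟨z', hzP'⟩⟩ ∨ D.Rel a ⟨f', ⟨z', hzP'⟩⟩) = (a = a ∨ D.Rel a a) := key
  rcases key2.mpr (Or.inl rfl) with h | ⟨k, l, hg, hk, hl⟩
  · left
    have h1 : f = f' := congrArg Sigma.fst h
    subst h1
    refine ⟨rfl, ?_⟩
    have := eq_of_heq (Sigma.mk.inj h).2
    exact congrArg Subtype.val this
  · exact Or.inr ⟨k, l, hg, hk, hl⟩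

theorem HasCoord.eq_of_mem_interior {f f' : D.Face} {z z' : ℂ} {x : D.Surface}
    (h : D.HasCoord f z x) (h' : D.HasCoord f' z' x) (hz : z ∈ interior (RegPoly n)) :
    f = f' ∧ z = z' := by
  rcases h.eq_or hn h' (notMem_range_vtx_of_mem_interior hn hz) with h | ⟨k, l, -, hk, -⟩
  · exact h
  · exact absurd hz (notMem_interior_of_mem_side hn hk)

theorem HasCoord.mem_range_vtx {f f' : D.Face} {z z' : ℂ} {x : D.Surface}
    (h : D.HasCoord f z x) (h' : D.HasCoord f' z' x) (hz : z ∈ Set.range (vtx : ZMod n → ℂ)) :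
    z' ∈ Set.range (vtx : ZMod n → ℂ) := by
  by_contra hz'
  rcases h'.eq_or hn h hz' with ⟨-, rfl⟩ | ⟨k, l, -, hk, rfl⟩
  · exact hz' hz
  · exact hz' ((sideMap_mem_range_vtx_iff hn hk).mp hz)

theorem HasCoord.mem_sing_iff {f : D.Face} {z : ℂ} {x : D.Surface} (h : D.HasCoord f z x) :
    x ∈ D.sing ↔ z ∈ Set.range (vtx : ZMod n → ℂ) := by
  constructor
  · rintro ⟨c, hc⟩
    exact HasCoord.mem_range_vtx hn (f := c.1) ⟨vtx_mem_regPoly c.2, hc⟩ h ⟨c.2, rfl⟩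
  · rintro ⟨j, rfl⟩
    obtain ⟨hz, rfl⟩ := h
    exact ⟨(f, j), rfl⟩

end

theorem chartRegion_eq (c : D.Face × ZMod n) : D.chartRegion c = interior (lens c.2) := by
  simp only [chartRegion, lens, sideMap_mem_regPoly_iff]

theorem chartCoord_iff {f g : D.Face} {k l : ZMod n} (hg : D.glue (f, k) = (g, l)) {z : ℂ}
    {x : D.Surface} :
    D.ChartCoord (f, k) z x ↔ D.HasCoord f z x ∨ D.HasCoord g (sideMap k l z) x := by
  rw [ChartCoord, hg]

/-- The charts based at the two polygons along an edge are the same chart up to `sideMap`, so either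
polygon may serve as the base. -/
theorem chartCoord_swap {f g : D.Face} {k l : ZMod n} (hg : D.glue (f, k) = (g, l)) {z : ℂ}
    {x : D.Surface} :
    D.ChartCoord (f, k) z x ↔ D.ChartCoord (g, l) (sideMap k l z) x := by
  rw [chartCoord_iff hg, chartCoord_iff (glue_symm hg), sideMap_sideMap, or_comm]

theorem sideMap_mem_interior_lens {k l : ZMod n} {z : ℂ} (hz : z ∈ interior (lens k)) :
    sideMap k l z ∈ interior (lens l) := by
  have h1 : sideMap l k ⁻¹' interior (lens k) ⊆ lens l := by
    intro w hw
    rcases interior_subset hw with h | h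
    · exact Or.inr (sideMap_mem_regPoly_iff.mp h)
    · left
      have := sideMap_mem_regPoly_iff (l := l).mpr h
      rwa [sideMap_sideMap] at this
  refine interior_maximal h1 (isOpen_interior.preimage (continuous_sideMap l k)) ?_
  rw [Set.mem_preimage, sideMap_sideMap]
  exact hz

section
variable (hn : 3 ≤ n)
include hn

theorem ChartCoord.hasCoord {f : D.Face} {k : ZMod n} {z : ℂ} {x : D.Surface}
    (h : D.ChartCoord (f, k) z x) (hz : z ∈ RegPoly n) : D.HasCoord f z x := by
  rcases h with h | h
  · exact h
  · have h1 := h.mem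
    rw [sideMap_mem_regPoly_iff] at h1
    have hs := mem_side_of_mem_of_sub_mem hn hz h1
    have := HasCoord.glue (D.glue_glue (f, k)) (sideMap_mem_side hs) h
    rwa [sideMap_sideMap] at this

theorem ChartCoord.unique {c : D.Face × ZMod n} {z : ℂ} {x y : D.Surface}
    (h : D.ChartCoord c z x) (h' : D.ChartCoord c z y) : x = y := by
  obtain ⟨f, k⟩ := c
  by_cases hz : z ∈ RegPoly n
  · exact (h.hasCoord hn hz).unique (h'.hasCoord hn hz)
  · exact (h.resolve_left fun q => hz q.mem).unique (h'.resolve_left fun q => hz q.mem)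

end

/-! ### Maps that carry polygons to polygons -/

/-- The side to which a side is carried. -/
def PolyHom.dart (φ : PolyHom D E) (c : D.Face × ZMod n) : E.Face × ZMod n :=
  (φ.face c.1, c.2 + φ.rot c.1)

theorem PolyHom.glue_dart (φ : PolyHom D E) (c : D.Face × ZMod n) :
    E.glue (φ.dart c) = φ.dart (D.glue c) := φ.compat c.1 c.2

theorem PolyHom.map_pt (φ : PolyHom D E) (f : D.Face) (z : RegPoly n) :
    φ.map (D.pt f z) = E.pt (φ.face f) ⟨vtx (φ.rot f) * z, vtx_mul_mem_regPoly _ z.2⟩ := rfl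

theorem PolyHom.hasCoord (φ : PolyHom D E) {f : D.Face} {z : ℂ} {x : D.Surface}
    (h : D.HasCoord f z x) : E.HasCoord (φ.face f) (vtx (φ.rot f) * z) (φ.map x) := by
  obtain ⟨hz, rfl⟩ := h
  exact ⟨vtx_mul_mem_regPoly _ hz, rfl⟩

theorem PolyHom.chartCoord (φ : PolyHom D E) {c : D.Face × ZMod n} {z : ℂ} {x : D.Surface}
    (h : D.ChartCoord c z x) : E.ChartCoord (φ.dart c) (vtx (φ.rot c.1) * z) (φ.map x) := by
  rcases h with h | h
  · exact Or.inl (φ.hasCoord h)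
  · right
    have := φ.hasCoord h
    rw [φ.glue_dart]
    rw [← sideMap_vtx_mul c.2 (D.glue c).2 (φ.rot c.1) (φ.rot (D.glue c).1) z] at this
    exact this

theorem PolyHom.mem_chartRegion (φ : PolyHom D E) {c : D.Face × ZMod n} {z : ℂ}
    (h : z ∈ D.chartRegion c) : vtx (φ.rot c.1) * z ∈ E.chartRegion (φ.dart c) := by
  rw [chartRegion_eq] at h ⊢
  exact vtx_mul_mem_interior_lens h

theorem PolyHom.map_corner (φ : PolyHom D E) (c : D.Face × ZMod n) :
    φ.map (D.corner c) = E.corner (φ.dart c) := by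
  rw [corner, corner, PolyHom.map_pt]
  congr 1
  apply Subtype.ext
  change vtx _ * vtx _ = vtx _
  rw [PolyHom.dart, add_comm, vtx_add]

theorem PolyHom.map_mem_sing_iff (hn : 3 ≤ n) (φ : PolyHom D E) {x : D.Surface} :
    φ.map x ∈ E.sing ↔ x ∈ D.sing := by
  obtain ⟨f, z, h⟩ := exists_hasCoord x
  rw [h.mem_sing_iff hn, (φ.hasCoord h).mem_sing_iff hn, vtx_mul_mem_range_iff]

theorem PolyHom.continuous_map (φ : PolyHom D E) : Continuous φ.map := by
  refine continuous_quot_lift _ ?_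
  apply continuous_sigma
  intro f
  have h : Continuous (E.pt (φ.face f)) := continuous_quot_mk.comp continuous_sigmaMk
  exact h.comp (by fun_prop)

end Coordinates

end PolygonGluing

namespace PolygonGluing

/-! ### Tangent vectors and geodesics -/

section Geodesics

variable {n : ℕ} [NeZero n] {D E : PolygonGluing n}

/-- Two tangent vectors, given in coordinates of polygons, agree in the surface. -/
def TangentEq (D : PolygonGluing n) (f : D.Face) (z u : ℂ) (f' : D.Face) (z' u' : ℂ) : Prop :=
  (f = f' ∧ z = z' ∧ u = u') ∨
    ∃ k l, D.glue (f, k) = (f', l) ∧ z ∈ side k ∧ z' = sideMap k l z ∧ u' = -(vtx (l - k) * u)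

/-- The path `γ` is at the time `t` a straight segment of the surface, which passes through
the point `z` of the polygon `f` with velocity `u`. -/
structure PassesThrough (D : PolygonGluing n) (γ : ℝ → D.Surface) (t : ℝ) (f : D.Face)
    (z u : ℂ) : Prop where
  mem : z ∈ RegPoly n
  exists_chart : ∃ k, z ∈ interior (lens k) ∧
    ∀ᶠ r : ℝ in 𝓝 0, D.ChartCoord (f, k) (z + r * u) (γ (t + r))

/-- From the time `t` on, `γ` is for some time a straight segment of the polygon `f`. -/
def StartsAt (D : PolygonGluing n) (γ : ℝ → D.Surface) (t : ℝ) (f : D.Face) (z u : ℂ) : Prop :=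
  ∀ᶠ r : ℝ in 𝓝[≥] 0, D.HasCoord f (z + r * u) (γ (t + r))

/-- `γ` is a straight path on the interval `(a, b)`. -/
def StraightOn (D : PolygonGluing n) (γ : ℝ → D.Surface) (a b : ℝ) : Prop :=
  ∀ t ∈ Set.Ioo a b, ∃ f z u, u ≠ 0 ∧ D.PassesThrough γ t f z u

theorem sideMap_add_mul (k l : ZMod n) (z u : ℂ) (r : ℝ) :
    sideMap k l (z + r * u) = sideMap k l z + r * -(vtx (l - k) * u) := by
  rw [sideMap, sideMap]; ring

theorem vtx_sub_mul_vtx_sub (k l : ZMod n) : vtx (k - l) * vtx (l - k) = 1 := by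
  rw [← vtx_add]; simp [vtx_zero]

theorem TangentEq.symm {f f' : D.Face} {z u z' u' : ℂ} (h : D.TangentEq f z u f' z' u') :
    D.TangentEq f' z' u' f z u := by
  rcases h with ⟨rfl, rfl, rfl⟩ | ⟨k, l, hg, hz, rfl, rfl⟩
  · exact Or.inl ⟨rfl, rfl, rfl⟩
  · refine Or.inr ⟨l, k, glue_symm hg, sideMap_mem_side hz, (sideMap_sideMap _ _ _).symm, ?_⟩
    linear_combination (-u) * vtx_sub_mul_vtx_sub k l

/-- Two successive gluings at a nonvertex cross the same edge back and forth. At a vertex they could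
continue around it, which `TangentEq` does not record. -/
theorem TangentEq.trans (hn : 3 ≤ n) {f f' f'' : D.Face} {z u z' u' z'' u'' : ℂ}
    (hz : z ∉ Set.range (vtx : ZMod n → ℂ))
    (h : D.TangentEq f z u f' z' u') (h' : D.TangentEq f' z' u' f'' z'' u'') :
    D.TangentEq f z u f'' z'' u'' := by
  rcases h with ⟨rfl, rfl, rfl⟩ | ⟨k, l, hg, hk, rfl, rfl⟩
  · exact h'
  rcases h' with ⟨rfl, rfl, rfl⟩ | ⟨k', l', hg', hk', rfl, rfl⟩
  · exact Or.inr ⟨k, l, hg, hk, rfl, rfl⟩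
  have hl : k' = l := side_unique hn (by rwa [sideMap_mem_range_vtx_iff hn hk])
    (sideMap_mem_side hk) hk'
  subst hl
  rw [glue_symm hg, Prod.mk.injEq] at hg'
  obtain ⟨rfl, rfl⟩ := hg'
  refine Or.inl ⟨rfl, (sideMap_sideMap _ _ _).symm, ?_⟩
  linear_combination (-u) * vtx_sub_mul_vtx_sub k k'

theorem TangentEq.hasCoord {f f' : D.Face} {z u z' u' : ℂ} {x : D.Surface}
    (h : D.TangentEq f z u f' z' u') (hx : D.HasCoord f z x) : D.HasCoord f' z' x := by
  rcases h with ⟨rfl, rfl, rfl⟩ | ⟨k, l, hg, hk, rfl, rfl⟩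
  · exact hx
  · exact hx.glue hg hk

theorem TangentEq.norm_eq {f f' : D.Face} {z u z' u' : ℂ} (h : D.TangentEq f z u f' z' u') :
    ‖u'‖ = ‖u‖ := by
  rcases h with ⟨rfl, rfl, rfl⟩ | ⟨k, l, hg, hk, rfl, rfl⟩
  · rfl
  · rw [norm_neg, norm_mul, norm_vtx, one_mul]

theorem TangentEq.neg {f f' : D.Face} {z u z' u' : ℂ} (h : D.TangentEq f z u f' z' u') :
    D.TangentEq f z (-u) f' z' (-u') := by
  rcases h with ⟨rfl, rfl, rfl⟩ | ⟨k, l, hg, hk, rfl, rfl⟩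
  · exact Or.inl ⟨rfl, rfl, rfl⟩
  · exact Or.inr ⟨k, l, hg, hk, rfl, by ring⟩

theorem tendsto_ray (z u : ℂ) : Tendsto (fun r : ℝ => z + r * u) (𝓝 0) (𝓝 z) := by
  have hcont : Continuous (fun r : ℝ => z + r * u) := by fun_prop
  have h2 := hcont.tendsto 0
  simpa only [Complex.ofReal_zero, zero_mul, add_zero] using h2

theorem eventually_ray_notMem_range_vtx (z : ℂ) {u : ℂ} (hu : u ≠ 0) :
    ∀ᶠ r : ℝ in 𝓝[>] 0, z + r * u ∉ Set.range (vtx : ZMod n → ℂ) := by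
  have hinj : Function.Injective (fun r : ℝ => z + r * u) := by
    intro a b hab
    have h1 : (a : ℂ) * u = b * u := add_left_cancel hab
    exact_mod_cast mul_right_cancel₀ hu h1
  have hfin : ((fun r : ℝ => z + r * u) ⁻¹' Set.range (vtx : ZMod n → ℂ)).Finite :=
    (Set.finite_range _).preimage hinj.injOn
  have h1 : ∀ᶠ r : ℝ in 𝓝[≠] 0, r ∉ (fun r : ℝ => z + r * u) ⁻¹' Set.range (vtx : ZMod n → ℂ) :=
    nhdsNE_le_cofinite _ hfin.compl_mem_cofinite
  exact h1.filter_mono (nhdsWithin_mono _ fun r hr => ne_of_gt hr)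

/-- If the point lies in the developed half of the chart, the roles of the two polygons are swapped,
so that the base polygon always contains the point. -/
theorem exists_passesThrough {γ : ℝ → D.Surface} {t : ℝ}
    (h : ∃ c, ∃ z ∈ D.chartRegion c, ∃ u : ℂ, ‖u‖ = 1 ∧
      ∀ᶠ s : ℝ in 𝓝 t, D.ChartCoord c (z + ((s - t : ℝ) : ℂ) * u) (γ s)) :
    ∃ f z u, ‖u‖ = 1 ∧ D.PassesThrough γ t f z u := by
  obtain ⟨⟨f, k⟩, z, hz, u, hu, hs⟩ := h
  have hr : ∀ᶠ r : ℝ in 𝓝 0, D.ChartCoord (f, k) (z + r * u) (γ (t + r)) := by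
    have ht : Tendsto (fun r : ℝ => t + r) (𝓝 0) (𝓝 t) := by
      have : Continuous (fun r : ℝ => t + r) := by fun_prop
      simpa using this.tendsto 0
    simpa using ht.eventually hs
  rw [chartRegion_eq] at hz
  rcases interior_subset hz with h | h
  · exact ⟨f, z, u, hu, h, k, hz, hr⟩
  · obtain ⟨⟨g, l⟩, hg⟩ : ∃ c, D.glue (f, k) = c := ⟨_, rfl⟩
    refine ⟨g, sideMap k l z, -(vtx (l - k) * u), ?_, sideMap_mem_regPoly_iff.mpr h, l,
      sideMap_mem_interior_lens hz, ?_⟩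
    · rw [norm_neg, norm_mul, norm_vtx, one_mul, hu]
    · filter_upwards [hr] with r hr
      rwa [chartCoord_swap hg, sideMap_add_mul] at hr

theorem PassesThrough.straight {γ : ℝ → D.Surface} {t : ℝ} {f : D.Face} {z u : ℂ}
    (h : D.PassesThrough γ t f z u) (hu : ‖u‖ = 1) :
    ∃ c, ∃ z ∈ D.chartRegion c, ∃ u : ℂ, ‖u‖ = 1 ∧
      ∀ᶠ s : ℝ in 𝓝 t, D.ChartCoord c (z + ((s - t : ℝ) : ℂ) * u) (γ s) := by
  obtain ⟨k, hk, hr⟩ := h.exists_chart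
  refine ⟨(f, k), z, by rwa [chartRegion_eq], u, hu, ?_⟩
  have ht : Tendsto (fun s : ℝ => s - t) (𝓝 t) (𝓝 0) := by
    have : Continuous (fun s : ℝ => s - t) := by fun_prop
    simpa using this.tendsto t
  simpa using ht.eventually hr

theorem PassesThrough.sub {γ : ℝ → D.Surface} {t : ℝ} {f : D.Face} {z u : ℂ}
    (h : D.PassesThrough γ t f z u) (a : ℝ) :
    D.PassesThrough (fun s => γ (a - s)) (a - t) f z (-u) := by
  obtain ⟨k, hk, hr⟩ := h.exists_chart
  refine ⟨h.mem, k, hk, ?_⟩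
  have ht : Tendsto (fun s : ℝ => -s) (𝓝 0) (𝓝 0) := by
    have : Continuous (fun s : ℝ => -s) := by fun_prop
    simpa using this.tendsto 0
  filter_upwards [ht.eventually hr] with r hr
  have e1 : a - (a - t + r) = t + -r := by ring
  have e2 : z + r * -u = z + ((-r : ℝ) : ℂ) * u := by push_cast; ring
  rw [e1, e2]; exact hr

theorem StraightOn.sub {γ : ℝ → D.Surface} {b c : ℝ} (h : D.StraightOn γ b c) (a : ℝ) :
    D.StraightOn (fun s => γ (a - s)) (a - c) (a - b) := by
  intro t ht
  obtain ⟨f, z, u, hu, h⟩ := h (a - t) ⟨by linarith [ht.2], by linarith [ht.1]⟩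
  have := h.sub a
  rw [sub_sub_cancel] at this
  exact ⟨f, z, -u, neg_ne_zero.mpr hu, this⟩

theorem StraightOn.mono {γ : ℝ → D.Surface} {a b a' b' : ℝ} (h : D.StraightOn γ a b)
    (ha : a ≤ a') (hb : b' ≤ b) : D.StraightOn γ a' b' :=
  fun t ht => h t ⟨ha.trans_lt ht.1, ht.2.trans_le hb⟩

theorem PassesThrough.congr {γ γ' : ℝ → D.Surface} {t : ℝ} {f : D.Face} {z u : ℂ}
    (h : D.PassesThrough γ t f z u) (he : ∀ᶠ s in 𝓝 t, γ s = γ' s) :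
    D.PassesThrough γ' t f z u := by
  obtain ⟨k, hk, hr⟩ := h.exists_chart
  refine ⟨h.mem, k, hk, ?_⟩
  have ht : Tendsto (fun r : ℝ => t + r) (𝓝 0) (𝓝 t) := by
    have : Continuous (fun r : ℝ => t + r) := by fun_prop
    simpa using this.tendsto 0
  filter_upwards [hr, ht.eventually he] with r hr he
  rwa [← he]

theorem PassesThrough.map (φ : PolyHom D E) {γ : ℝ → D.Surface} {t : ℝ} {f : D.Face} {z u : ℂ}
    (h : D.PassesThrough γ t f z u) :
    E.PassesThrough (fun s => φ.map (γ s)) t (φ.face f) (vtx (φ.rot f) * z)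
      (vtx (φ.rot f) * u) := by
  obtain ⟨k, hk, hr⟩ := h.exists_chart
  refine ⟨vtx_mul_mem_regPoly _ h.mem, k + φ.rot f, vtx_mul_mem_interior_lens hk, ?_⟩
  filter_upwards [hr] with r hr
  have := φ.chartCoord hr
  rw [mul_add, mul_left_comm] at this
  exact this

theorem StartsAt.map (φ : PolyHom D E) {γ : ℝ → D.Surface} {t : ℝ} {f : D.Face} {z u : ℂ}
    (h : D.StartsAt γ t f z u) :
    E.StartsAt (fun s => φ.map (γ s)) t (φ.face f) (vtx (φ.rot f) * z) (vtx (φ.rot f) * u) := by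
  filter_upwards [h] with r hr
  have := φ.hasCoord hr
  rwa [mul_add, mul_left_comm] at this

theorem startsAt_iff {γ : ℝ → D.Surface} {t : ℝ} {f : D.Face} {z u : ℂ} :
    D.StartsAt γ t f z u ↔ D.HasCoord f z (γ t) ∧
      ∀ᶠ r : ℝ in 𝓝[>] 0, D.HasCoord f (z + r * u) (γ (t + r)) := by
  rw [StartsAt, ← Set.Ioi_insert, nhdsWithin_insert, eventually_sup, eventually_pure]
  simp only [Complex.ofReal_zero, zero_mul, add_zero]

theorem StartsAt.hasCoord {γ : ℝ → D.Surface} {t : ℝ} {f : D.Face} {z u : ℂ}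
    (h : D.StartsAt γ t f z u) : D.HasCoord f z (γ t) :=
  (startsAt_iff.mp h).1

theorem StartsAt.eventually_gt {γ : ℝ → D.Surface} {t : ℝ} {f : D.Face} {z u : ℂ}
    (h : D.StartsAt γ t f z u) : ∀ᶠ r : ℝ in 𝓝[>] 0, D.HasCoord f (z + r * u) (γ (t + r)) :=
  (startsAt_iff.mp h).2

section
variable (hn : 3 ≤ n)
include hn

theorem PassesThrough.hasCoord {γ : ℝ → D.Surface} {t : ℝ} {f : D.Face} {z u : ℂ}
    (h : D.PassesThrough γ t f z u) : D.HasCoord f z (γ t) := by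
  obtain ⟨k, hk, hr⟩ := h.exists_chart
  have := hr.self_of_nhds
  simp only [Complex.ofReal_zero, zero_mul, add_zero] at this
  exact this.hasCoord hn h.mem

theorem PassesThrough.notMem_range_vtx {γ : ℝ → D.Surface} {t : ℝ} {f : D.Face} {z u : ℂ}
    (h : D.PassesThrough γ t f z u) : z ∉ Set.range (vtx : ZMod n → ℂ) := by
  obtain ⟨k, hk, -⟩ := h.exists_chart
  exact notMem_range_vtx_of_mem_interior_lens hn hk

theorem PassesThrough.notMem_sing {γ : ℝ → D.Surface} {t : ℝ} {f : D.Face} {z u : ℂ}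
    (h : D.PassesThrough γ t f z u) : γ t ∉ D.sing := by
  rw [(h.hasCoord hn).mem_sing_iff hn]
  exact h.notMem_range_vtx hn

theorem StraightOn.notMem_sing {γ : ℝ → D.Surface} {a b t : ℝ} (h : D.StraightOn γ a b)
    (ht : t ∈ Set.Ioo a b) : γ t ∉ D.sing := by
  obtain ⟨f, z, u, -, h⟩ := h t ht
  exact h.notMem_sing hn

/-- Straight paths with the same tangent vector agree for some time. -/
theorem PassesThrough.eventuallyEq {γ₁ γ₂ : ℝ → D.Surface} {t₁ t₂ : ℝ} {f f' : D.Face}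
    {z u z' u' : ℂ} (h₁ : D.PassesThrough γ₁ t₁ f z u) (h₂ : D.PassesThrough γ₂ t₂ f' z' u')
    (h : D.TangentEq f z u f' z' u') : ∀ᶠ r in 𝓝 0, γ₁ (t₁ + r) = γ₂ (t₂ + r) := by
  obtain ⟨k₁, hk₁, hr₁⟩ := h₁.exists_chart
  obtain ⟨k₂, hk₂, hr₂⟩ := h₂.exists_chart
  rcases h with ⟨rfl, rfl, rfl⟩ | ⟨k, l, hg, hk, rfl, rfl⟩
  · rcases mem_interior_or_mem_side hn h₁.mem hk₁ with hz | hz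
    · filter_upwards [hr₁, hr₂, (tendsto_ray z u).eventually (isOpen_interior.mem_nhds hz)]
        with r h1 h2 h3
      exact (h1.hasCoord hn (interior_subset h3)).unique (h2.hasCoord hn (interior_subset h3))
    · have := eq_of_mem_side_of_mem_interior_lens hn hz hk₂
      subst this
      filter_upwards [hr₁, hr₂] with r h1 h2
      exact h1.unique hn h2
  · have e1 := eq_of_mem_side_of_mem_interior_lens hn hk hk₁
    have e2 := eq_of_mem_side_of_mem_interior_lens hn (sideMap_mem_side hk) hk₂
    subst e1 e2
    filter_upwards [hr₁, hr₂] with r h1 h2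
    rw [chartCoord_swap hg, sideMap_add_mul] at h1
    exact h1.unique hn h2

/-- A straight path runs for some time in one polygon. -/
theorem PassesThrough.exists_startsAt {γ : ℝ → D.Surface} {t : ℝ} {f : D.Face} {z u : ℂ}
    (h : D.PassesThrough γ t f z u) :
    ∃ f' z' u', D.TangentEq f z u f' z' u' ∧ D.StartsAt γ t f' z' u' := by
  have hx := h.hasCoord hn
  obtain ⟨k, hk, hr⟩ := h.exists_chart
  have hr' := hr.filter_mono (nhdsWithin_le_nhds (s := Set.Ioi 0))
  have fin : ∀ f' z' u', D.TangentEq f z u f' z' u' →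
      (∀ᶠ r : ℝ in 𝓝[>] 0, D.HasCoord f' (z' + r * u') (γ (t + r))) →
      ∃ f' z' u', D.TangentEq f z u f' z' u' ∧ D.StartsAt γ t f' z' u' := by
    intro f' z' u' hT hgt
    exact ⟨f', z', u', hT, startsAt_iff.mpr ⟨hT.hasCoord hx, hgt⟩⟩
  rcases eventually_mem_lens_cases hk u with hP | hQ
  · refine fin f z u (Or.inl ⟨rfl, rfl, rfl⟩) ?_
    filter_upwards [hr', hP] with r h1 h2
    exact h1.hasCoord hn h2
  · obtain ⟨⟨g, l⟩, hg⟩ : ∃ c, D.glue (f, k) = c := ⟨_, rfl⟩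
    have hzk : z ∈ side k := by
      refine mem_side_of_mem_of_sub_mem hn h.mem ?_
      refine (regPoly_isClosed hn).mem_of_tendsto ?_ hQ
      exact ((tendsto_ray z u).mono_left nhdsWithin_le_nhds).const_sub _
    refine fin g (sideMap k l z) (-(vtx (l - k) * u)) (Or.inr ⟨k, l, hg, hzk, rfl, rfl⟩) ?_
    filter_upwards [hr', hQ] with r h1 h2
    rw [chartCoord_swap hg] at h1
    rw [← sideMap_add_mul]
    exact h1.hasCoord hn (sideMap_mem_regPoly_iff.mpr h2)

/-- Straight segments that share points arbitrarily close to their initial points start with the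
same tangent vector. -/
theorem tangentEq_of_frequently {f f' : D.Face} {z u z' u' : ℂ} (hu : u ≠ 0)
    (h : ∃ᶠ r : ℝ in 𝓝[>] 0, ∃ x, D.HasCoord f (z + r * u) x ∧ D.HasCoord f' (z' + r * u') x) :
    D.TangentEq f z u f' z' u' := by
  have h2 : ∃ᶠ r : ℝ in 𝓝[>] 0, (f = f' ∧ z + r * u = z' + r * u') ∨
      ∃ p : ZMod n × ZMod n, D.glue (f, p.1) = (f', p.2) ∧ z + r * u ∈ side p.1 ∧
        z' + r * u' = sideMap p.1 p.2 (z + r * u) := by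
    refine (h.and_eventually (eventually_ray_notMem_range_vtx (n := n) z hu)).mono ?_
    rintro r ⟨⟨x, hx, hx'⟩, hv⟩
    rcases hx.eq_or hn hx' hv with h | ⟨k, l, h⟩
    · exact Or.inl h
    · exact Or.inr ⟨(k, l), h⟩
  -- Affine functions of time that agree at two different times coincide.
  have affine : ∀ a b a' b' : ℂ, (∃ᶠ r : ℝ in 𝓝[>] 0, a + r * b = a' + r * b') →
      a = a' ∧ b = b' := by
    intro a b a' b' hf
    obtain ⟨r, hr, hr0⟩ := (hf.and_eventually self_mem_nhdsWithin).exists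
    obtain ⟨q, hq, hq0⟩ := (hf.and_eventually (Ioo_mem_nhdsGT hr0)).exists
    have hne : ((r : ℂ) - q) ≠ 0 := by
      rw [sub_ne_zero]; exact_mod_cast hq0.2.ne'
    have hb : b = b' := mul_left_cancel₀ hne (by linear_combination hr - hq)
    subst hb
    exact ⟨add_right_cancel hr, rfl⟩
  rw [frequently_or_distrib] at h2
  rcases h2 with h2 | h2
  · left
    obtain ⟨h3, h4⟩ := affine z u z' u' (h2.mono fun r h => h.2)
    exact ⟨h2.exists.choose_spec.1, h3, h4⟩
  -- Pigeonhole over the finitely many pairs of sides: one gluing occurs at arbitrarily small times.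
  · have h3 : ∃ p : ZMod n × ZMod n, ∃ᶠ r : ℝ in 𝓝[>] 0, D.glue (f, p.1) = (f', p.2) ∧
        z + r * u ∈ side p.1 ∧ z' + r * u' = sideMap p.1 p.2 (z + r * u) := by
      by_contra hc
      simp only [not_exists, not_frequently] at hc
      exact h2 ((eventually_all.mpr hc).mono fun r hr ⟨p, hp⟩ => hr p hp)
    obtain ⟨⟨k, l⟩, hp⟩ := h3
    refine Or.inr ⟨k, l, hp.exists.choose_spec.1, ?_, ?_⟩
    · have hcl : IsClosed (side k) := by
        rw [side, ← convexHull_pair]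
        exact (Set.toFinite _).isClosed_convexHull ℝ
      exact hcl.mem_of_frequently_of_tendsto (hp.mono fun r h => h.2.1)
        ((tendsto_ray z u).mono_left nhdsWithin_le_nhds)
    · exact affine _ _ _ _ (hp.mono fun r h => by rw [h.2.2, sideMap_add_mul])

theorem StartsAt.tangentEq {γ₁ γ₂ : ℝ → D.Surface} {t₁ t₂ : ℝ} {f f' : D.Face}
    {z u z' u' : ℂ} (h₁ : D.StartsAt γ₁ t₁ f z u) (h₂ : D.StartsAt γ₂ t₂ f' z' u') (hu : u ≠ 0)
    (h : ∃ᶠ r : ℝ in 𝓝[>] 0, γ₁ (t₁ + r) = γ₂ (t₂ + r)) : D.TangentEq f z u f' z' u' := by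
  refine tangentEq_of_frequently hn hu ((h.and_eventually
    (h₁.eventually_gt.and h₂.eventually_gt)).mono ?_)
  rintro r ⟨h1, h2, h3⟩
  exact ⟨_, h2, h1 ▸ h3⟩

theorem StartsAt.eq {γ₁ γ₂ : ℝ → D.Surface} {t₁ t₂ : ℝ} {f f' : D.Face}
    {z u z' u' : ℂ} (h₁ : D.StartsAt γ₁ t₁ f z u) (h₂ : D.StartsAt γ₂ t₂ f' z' u') (hu : u ≠ 0)
    (h : ∃ᶠ r : ℝ in 𝓝[>] 0, γ₁ (t₁ + r) = γ₂ (t₂ + r)) : γ₁ t₁ = γ₂ t₂ :=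
  ((h₁.tangentEq hn h₂ hu h).hasCoord h₁.hasCoord).unique h₂.hasCoord

theorem PassesThrough.tangentEq {γ₁ γ₂ : ℝ → D.Surface} {t₁ t₂ : ℝ} {f f' : D.Face}
    {z u z' u' : ℂ} (h₁ : D.PassesThrough γ₁ t₁ f z u) (h₂ : D.PassesThrough γ₂ t₂ f' z' u')
    (hu : u ≠ 0) (h : ∃ᶠ r : ℝ in 𝓝[>] 0, γ₁ (t₁ + r) = γ₂ (t₂ + r)) :
    D.TangentEq f z u f' z' u' := by
  obtain ⟨f₁, z₁, u₁, hT₁, hS₁⟩ := h₁.exists_startsAt hn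
  obtain ⟨f₂, z₂, u₂, hT₂, hS₂⟩ := h₂.exists_startsAt hn
  have hu₁ : u₁ ≠ 0 := by
    rw [← norm_ne_zero_iff, hT₁.norm_eq, norm_ne_zero_iff]; exact hu
  have hT := hS₁.tangentEq hn hS₂ hu₁ h
  have hv := h₁.notMem_range_vtx hn
  exact (hT₁.trans hn hv hT).trans hn hv hT₂.symm

theorem PassesThrough.tangentEq_self {γ : ℝ → D.Surface} {t : ℝ} {f f' : D.Face}
    {z u z' u' : ℂ} (h₁ : D.PassesThrough γ t f z u) (h₂ : D.PassesThrough γ t f' z' u')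
    (hu : u ≠ 0) : D.TangentEq f z u f' z' u' :=
  h₁.tangentEq hn h₂ hu (Frequently.of_forall fun _ => rfl)

/-- Unique continuation of straight paths. -/
theorem StraightOn.eqOn {γ₁ γ₂ : ℝ → D.Surface} {a b t₀ : ℝ} (h₁ : D.StraightOn γ₁ a b)
    (h₂ : D.StraightOn γ₂ a b) (ht₀ : t₀ ∈ Set.Ioo a b) (h : ∀ᶠ s in 𝓝 t₀, γ₁ s = γ₂ s) :
    ∀ t ∈ Set.Ioo a b, γ₁ t = γ₂ t := by
  have hU : IsOpen {t | ∀ᶠ s in 𝓝 t, γ₁ s = γ₂ s} := by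
    rw [isOpen_iff_mem_nhds]
    intro t ht
    exact eventually_eventually_nhds.mpr ht
  -- The times near which the paths agree form an open set. At a limit of such times the paths agree
  -- at times accumulating from one side, which forces equal tangent vectors and hence agreement
  -- nearby.
  have key := isPreconnected_Ioo.subset_of_closure_inter_subset hU ⟨t₀, ht₀, h⟩ (by
    rintro t ⟨htc, ht⟩
    by_contra hnot
    have hfr : ∃ᶠ s in 𝓝 t, s ≠ t ∧ γ₁ s = γ₂ s := by
      have h3 := mem_closure_iff_frequently.mp htc
      refine h3.mono fun s hs => ⟨?_, hs.self_of_nhds⟩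
      rintro rfl
      exact hnot hs
    obtain ⟨f₁, z₁, u₁, hu₁, hp₁⟩ := h₁ t ht
    obtain ⟨f₂, z₂, u₂, hu₂, hp₂⟩ := h₂ t ht
    have hT : D.TangentEq f₁ z₁ u₁ f₂ z₂ u₂ := by
      have hfr' : ∃ᶠ s in 𝓝 t, (t < s ∧ γ₁ s = γ₂ s) ∨ (s < t ∧ γ₁ s = γ₂ s) := by
        refine hfr.mono fun s hs => ?_
        rcases lt_or_gt_of_ne hs.1 with h | h
        · exact Or.inr ⟨h, hs.2⟩
        · exact Or.inl ⟨h, hs.2⟩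
      rcases frequently_or_distrib.mp hfr' with hf | hf
      · refine hp₁.tangentEq hn hp₂ hu₁ ?_
        rw [frequently_nhdsWithin_iff]
        have ht' : Tendsto (fun s : ℝ => s - t) (𝓝 t) (𝓝 0) := by
          have : Continuous (fun s : ℝ => s - t) := by fun_prop
          simpa using this.tendsto t
        refine ht'.frequently (hf.mono fun s hs => ⟨?_, by simpa using hs.1⟩)
        rw [add_sub_cancel]; exact hs.2
      -- Accumulation from the left is accumulation from the right for the reversed paths.
      · have := (hp₁.sub 0).tangentEq hn (hp₂.sub 0) (neg_ne_zero.mpr hu₁) (by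
          rw [frequently_nhdsWithin_iff]
          have ht' : Tendsto (fun s : ℝ => t - s) (𝓝 t) (𝓝 0) := by
            have : Continuous (fun s : ℝ => t - s) := by fun_prop
            simpa using this.tendsto t
          refine ht'.frequently (hf.mono fun s hs => ⟨?_, by simpa using hs.1⟩)
          have e : 0 - (0 - t + (t - s)) = s := by ring
          rw [e]; exact hs.2)
        simpa using this.neg
    apply hnot
    have h4 := hp₁.eventuallyEq hn hp₂ hT
    have ht' : Tendsto (fun s : ℝ => s - t) (𝓝 t) (𝓝 0) := by
      have : Continuous (fun s : ℝ => s - t) := by fun_prop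
      simpa using this.tendsto t
    filter_upwards [ht'.eventually h4] with s hs
    simpa using hs)
  exact fun t ht => (key ht).self_of_nhds

end

end Geodesics

end PolygonGluing

namespace PolygonGluing

/-! ### Saddle connections -/

section Saddles

variable {n : ℕ} [NeZero n] {D E : PolygonGluing n}

/-- The final end is treated as the initial end of the reversed path, so that one theory of initial
vectors serves both; the sign of the final vector changes accordingly. -/
theorem isSaddleConnection_iff {L : ℝ} {γ : ℝ → D.Surface} :
    D.IsSaddleConnection L γ ↔ 0 < L ∧ γ 0 ∈ D.sing ∧ γ L ∈ D.sing ∧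
      (∃ f z u, ‖u‖ = 1 ∧ D.StartsAt γ 0 f z u) ∧
      (∃ f z u, ‖u‖ = 1 ∧ D.StartsAt (fun s => γ (L - s)) 0 f z u) ∧
      ∀ t ∈ Set.Ioo 0 L, ∃ f z u, ‖u‖ = 1 ∧ D.PassesThrough γ t f z u := by
  have ht1 : Tendsto (fun r : ℝ => L - r) (𝓝[≥] 0) (𝓝[≤] L) := by
    refine tendsto_nhdsWithin_of_tendsto_nhds_of_eventually_within _ ?_ ?_
    · have : Continuous (fun r : ℝ => L - r) := by fun_prop
      simpa using (this.tendsto 0).mono_left nhdsWithin_le_nhds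
    · filter_upwards [self_mem_nhdsWithin] with r hr
      have hr : 0 ≤ r := hr
      simpa using hr
  have ht2 : Tendsto (fun s : ℝ => L - s) (𝓝[≤] L) (𝓝[≥] 0) := by
    refine tendsto_nhdsWithin_of_tendsto_nhds_of_eventually_within _ ?_ ?_
    · have : Continuous (fun r : ℝ => L - r) := by fun_prop
      simpa using (this.tendsto L).mono_left nhdsWithin_le_nhds
    · filter_upwards [self_mem_nhdsWithin] with r hr
      have hr : r ≤ L := hr
      simpa using hr
  constructor
  · rintro ⟨h1, h2, h3, ⟨f, z, u, hu, hs⟩, ⟨f', z', u', hu', hs'⟩, h6⟩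
    refine ⟨h1, h2, h3, ⟨f, z, u, hu, ?_⟩, ⟨f', z', -u', by rwa [norm_neg], ?_⟩, fun t ht =>
      exists_passesThrough (h6 t ht)⟩
    · simpa [StartsAt] using hs
    · filter_upwards [ht1.eventually hs'] with r hr
      rw [zero_add]
      convert hr using 1
      push_cast; ring
  · rintro ⟨h1, h2, h3, ⟨f, z, u, hu, hs⟩, ⟨f', z', u', hu', hs'⟩, h6⟩
    refine ⟨h1, h2, h3, ⟨f, z, u, hu, ?_⟩, ⟨f', z', -u', by rwa [norm_neg], ?_⟩, fun t ht => ?_⟩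
    · simpa [StartsAt] using hs
    · filter_upwards [ht2.eventually hs'] with s hs
      simp only [zero_add, sub_sub_cancel] at hs
      convert hs using 1
      push_cast; ring
    · obtain ⟨f, z, u, hu, hp⟩ := h6 t ht
      exact hp.straight hu

theorem IsSaddleConnection.reverse {L : ℝ} {γ : ℝ → D.Surface} (h : D.IsSaddleConnection L γ) :
    D.IsSaddleConnection L (fun s => γ (L - s)) := by
  rw [isSaddleConnection_iff] at h ⊢
  obtain ⟨h1, h2, h3, h4, h5, h6⟩ := h
  refine ⟨h1, by simpa using h3, by simpa using h2, h5, by simpa using h4, fun t ht => ?_⟩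
  obtain ⟨f, z, u, hu, hp⟩ := h6 (L - t) ⟨by linarith [ht.2], by linarith [ht.1]⟩
  have := hp.sub L
  rw [sub_sub_cancel] at this
  exact ⟨f, z, -u, by rwa [norm_neg], this⟩

theorem IsSaddleConnection.map (hn : 3 ≤ n) (φ : PolyHom D E) {L : ℝ} {γ : ℝ → D.Surface}
    (h : D.IsSaddleConnection L γ) : E.IsSaddleConnection L (fun s => φ.map (γ s)) := by
  rw [isSaddleConnection_iff] at h ⊢
  obtain ⟨h1, h2, h3, ⟨f, z, u, hu, h4⟩, ⟨f', z', u', hu', h5⟩, h6⟩ := h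
  refine ⟨h1, (φ.map_mem_sing_iff hn).mpr h2, (φ.map_mem_sing_iff hn).mpr h3,
    ⟨_, _, _, ?_, h4.map φ⟩, ⟨_, _, _, ?_, h5.map φ⟩, fun t ht => ?_⟩
  · rw [norm_mul, norm_vtx, one_mul, hu]
  · rw [norm_mul, norm_vtx, one_mul, hu']
  · obtain ⟨f, z, u, hu, hp⟩ := h6 t ht
    exact ⟨_, _, _, by rw [norm_mul, norm_vtx, one_mul, hu], hp.map φ⟩

theorem ne_zero_of_norm_eq_one {u : ℂ} (hu : ‖u‖ = 1) : u ≠ 0 := by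
  rw [← norm_ne_zero_iff, hu]; exact one_ne_zero

theorem IsSaddleConnection.straightOn {L : ℝ} {γ : ℝ → D.Surface} (h : D.IsSaddleConnection L γ) :
    D.StraightOn γ 0 L := by
  intro t ht
  obtain ⟨f, z, u, hu, hp⟩ := (isSaddleConnection_iff.mp h).2.2.2.2.2 t ht
  exact ⟨f, z, u, ne_zero_of_norm_eq_one hu, hp⟩

theorem IsSaddleConnection.exists_startsAt (hn : 3 ≤ n) {L : ℝ} {γ : ℝ → D.Surface}
    (h : D.IsSaddleConnection L γ) {t : ℝ} (ht : t ∈ Set.Ico 0 L) :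
    ∃ f z u, u ≠ 0 ∧ D.StartsAt γ t f z u := by
  rcases eq_or_lt_of_le ht.1 with rfl | h0
  · obtain ⟨f, z, u, hu, hp⟩ := (isSaddleConnection_iff.mp h).2.2.2.1
    exact ⟨f, z, u, ne_zero_of_norm_eq_one hu, hp⟩
  · obtain ⟨f, z, u, hu, hp⟩ := h.straightOn t ⟨h0, ht.2⟩
    obtain ⟨f', z', u', hT, hS⟩ := hp.exists_startsAt hn
    refine ⟨f', z', u', ?_, hS⟩
    rw [← norm_ne_zero_iff, hT.norm_eq, norm_ne_zero_iff]; exact hu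

theorem StartsAt.congr_sub {γ γ' : ℝ → D.Surface} {t t' : ℝ} {f : D.Face} {z u : ℂ}
    (h : D.StartsAt γ t f z u) (he : ∀ r, γ (t + r) = γ' (t' + r)) : D.StartsAt γ' t' f z u := by
  filter_upwards [h] with r hr
  rwa [← he]

theorem eventually_of_eventually_add {P : ℝ → Prop} {t : ℝ} (h : ∀ᶠ r in 𝓝 0, P (t + r)) :
    ∀ᶠ s in 𝓝 t, P s := by
  have ht' : Tendsto (fun s : ℝ => s - t) (𝓝 t) (𝓝 0) := by
    have : Continuous (fun s : ℝ => s - t) := by fun_prop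
    simpa using this.tendsto t
  simpa using ht'.eventually h

/-- If a map reverses a saddle connection at an interior point, then it reverses the whole saddle
connection. -/
theorem IsSaddleConnection.map_start_eq_end (hn : 3 ≤ n) {L : ℝ} {γ : ℝ → D.Surface}
    (h : D.IsSaddleConnection L γ) (ψ : PolyHom D D) {m : ℝ} (hm : m ∈ Set.Ioo 0 L) {f : D.Face}
    {z u : ℂ} (hp : D.PassesThrough γ m f z u)
    (hT : D.TangentEq (ψ.face f) (vtx (ψ.rot f) * z) (vtx (ψ.rot f) * u) f z (-u)) :
    ψ.map (γ 0) = γ L := by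
  have hψ := h.map hn ψ
  have hrev := h.reverse
  have hp2 := hp.sub (2 * m)
  have e0 : 2 * m - m = m := by ring
  rw [e0] at hp2
  have hnear := eventually_of_eventually_add
    (P := fun s => ψ.map (γ s) = γ (2 * m - s)) ((hp.map ψ).eventuallyEq hn hp2 hT)
  have hs2 := h.straightOn.sub (2 * m)
  rw [sub_zero] at hs2
  -- The image path and the path reflected in the time `m` are both straight between `max 0 (2m -
  -- L)` and `min L (2m)`, an interval that contains `m`.
  have hb : m < min L (2 * m) := lt_min hm.2 (by linarith [hm.1])
  have ha : max 0 (2 * m - L) < m := max_lt hm.1 (by linarith [hm.2])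
  have heq := (hψ.straightOn.mono (le_max_left 0 (2 * m - L)) (min_le_left L (2 * m))).eqOn hn
    (hs2.mono (le_max_right _ _) (min_le_right _ _)) ⟨ha, hb⟩ hnear
  set a := max 0 (2 * m - L) with hadef
  have ha0 : 0 ≤ a := le_max_left _ _
  have ha1 : 2 * m - L ≤ a := le_max_right _ _
  obtain ⟨f₁, z₁, u₁, hu₁, hS₁⟩ := hψ.exists_startsAt hn (t := a) ⟨ha0, by linarith [hm.2]⟩
  obtain ⟨f₂, z₂, u₂, hu₂, hS₂⟩ := hrev.exists_startsAt hn (t := a - (2 * m - L))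
    ⟨by linarith, by linarith [hm.1, hm.2]⟩
  have hS₂' : D.StartsAt (fun s => γ (2 * m - s)) a f₂ z₂ u₂ :=
    hS₂.congr_sub (γ' := fun s => γ (2 * m - s)) fun r =>
      congrArg γ (by ring)
  have hae : ψ.map (γ a) = γ (2 * m - a) := by
    refine StartsAt.eq (γ₂ := fun s => γ (2 * m - s)) hn hS₁ hS₂' hu₁ (Eventually.frequently ?_)
    filter_upwards [Ioo_mem_nhdsGT (sub_pos.mpr (ha.trans hb))] with r hr
    exact heq (a + r) ⟨by linarith [hr.1], by linarith [hr.2]⟩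
  have hreg : ∀ t ∈ Set.Ioo 0 L, γ t ∉ D.sing := fun t ht => h.straightOn.notMem_sing hn ht
  -- If `m` were not the middle, the left end of the common interval would match a singular endpoint
  -- with a regular point, but the map preserves the singular set in both directions.
  have hmL : 2 * m = L := by
    rcases lt_trichotomy (2 * m) L with hlt | heq | hgt
    · have : a = 0 := max_eq_left (by linarith)
      rw [this, sub_zero] at hae
      refine absurd ?_ (hreg (2 * m) ⟨by linarith [hm.1], hlt⟩)
      rw [← hae, ψ.map_mem_sing_iff hn]
      exact h.start_mem
    · exact heq
    · have : a = 2 * m - L := max_eq_right (by linarith)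
      rw [this, sub_sub_cancel] at hae
      refine absurd ?_ (hreg (2 * m - L) ⟨by linarith, by linarith [hm.2]⟩)
      rw [← ψ.map_mem_sing_iff hn, hae]
      exact h.end_mem
  have : a = 0 := max_eq_left (by linarith)
  rwa [this, sub_zero, hmL] at hae

/-! ### Properties that are transported along straight paths -/

/-- The chart at time `t` also works at nearby times, read from whichever of its two polygons
contains the point. This is the local step of every transport argument below. -/
theorem PassesThrough.eventually_passesThrough {γ : ℝ → D.Surface} {t : ℝ} {f : D.Face} {z u : ℂ}
    (h : D.PassesThrough γ t f z u) : ∃ k, z ∈ interior (lens k) ∧ ∀ᶠ r : ℝ in 𝓝 0,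
      (z + r * u ∈ RegPoly n ∧ D.PassesThrough γ (t + r) f (z + r * u) u) ∨
      D.PassesThrough γ (t + r) (D.glue (f, k)).1 (sideMap k (D.glue (f, k)).2 (z + r * u))
        (-(vtx ((D.glue (f, k)).2 - k) * u)) := by
  obtain ⟨k, hk, hr⟩ := h.exists_chart
  refine ⟨k, hk, ?_⟩
  filter_upwards [eventually_eventually_nhds.mpr hr,
    (tendsto_ray z u).eventually (isOpen_interior.mem_nhds hk)] with r hr hmem
  have hr' : ∀ᶠ q : ℝ in 𝓝 0, D.ChartCoord (f, k) (z + r * u + q * u) (γ (t + r + q)) := by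
    have ht : Tendsto (fun q : ℝ => r + q) (𝓝 0) (𝓝 r) := by
      have : Continuous (fun q : ℝ => r + q) := by fun_prop
      simpa using this.tendsto 0
    filter_upwards [ht.eventually hr] with q hq
    rw [add_assoc t]
    convert hq using 1
    push_cast; ring
  rcases interior_subset hmem with hP | hQ
  · exact Or.inl ⟨hP, hP, k, hmem, hr'⟩
  · right
    refine ⟨sideMap_mem_regPoly_iff.mpr hQ, (D.glue (f, k)).2, sideMap_mem_interior_lens hmem, ?_⟩
    filter_upwards [hr'] with q hq
    rwa [chartCoord_swap rfl, sideMap_add_mul] at hq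

section
variable (hn : 3 ≤ n)
include hn

theorem StartsAt.eventually_passesThrough {γ : ℝ → D.Surface} {t : ℝ} {f : D.Face} {z u : ℂ}
    (h : D.StartsAt γ t f z u) (hu : u ≠ 0) :
    ∀ᶠ r : ℝ in 𝓝[>] 0, D.PassesThrough γ (t + r) f (z + r * u) u := by
  obtain ⟨e, he, hsub⟩ := mem_nhdsGT_iff_exists_Ioo_subset.mp
    (h.eventually_gt.and (eventually_ray_notMem_range_vtx (n := n) z hu))
  filter_upwards [Ioo_mem_nhdsGT he] with r hr
  obtain ⟨h1, h2⟩ := hsub hr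
  obtain ⟨k, hk⟩ := exists_mem_interior_lens hn h1.mem h2
  refine ⟨h1.mem, k, hk, ?_⟩
  have ht : Tendsto (fun q : ℝ => r + q) (𝓝 0) (𝓝 r) := by
    have : Continuous (fun q : ℝ => r + q) := by fun_prop
    simpa using this.tendsto 0
  filter_upwards [ht.eventually (isOpen_Ioo.mem_nhds hr)] with q hq
  left
  have := (hsub hq).1
  rw [add_assoc t]
  convert this using 1
  push_cast; ring

omit hn in
theorem TangentEq.transport {Q : D.Face → ℂ → Prop}
    (hQ : ∀ f k u, Q f u → Q (D.glue (f, k)).1 (-(vtx ((D.glue (f, k)).2 - k) * u)))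
    {f f' : D.Face} {z u z' u' : ℂ} (h : D.TangentEq f z u f' z' u') (hf : Q f u) : Q f' u' := by
  rcases h with ⟨rfl, rfl, rfl⟩ | ⟨k, l, hg, hk, rfl, rfl⟩
  · exact hf
  · have := hQ f k u hf
    rwa [hg] at this

/-- A property of a polygon and a direction which is invariant under parallel transport is
transported along straight paths. -/
theorem StraightOn.transport {Q : D.Face → ℂ → Prop}
    (hQ : ∀ f k u, Q f u → Q (D.glue (f, k)).1 (-(vtx ((D.glue (f, k)).2 - k) * u)))
    {γ : ℝ → D.Surface} {a b t₀ : ℝ} (h : D.StraightOn γ a b) (ht₀ : t₀ ∈ Set.Ioo a b)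
    {f₀ : D.Face} {z₀ u₀ : ℂ} (hu₀ : u₀ ≠ 0) (h₀ : D.PassesThrough γ t₀ f₀ z₀ u₀)
    (hQ₀ : Q f₀ u₀) {t : ℝ} (ht : t ∈ Set.Ioo a b) {f : D.Face} {z u : ℂ}
    (hp : D.PassesThrough γ t f z u) (hu : u ≠ 0) : Q f u := by
  -- Crossing the same edge back inverts the transport, so invariance holds both ways and the
  -- validity of `Q` is locally constant in time.
  have hQ' : ∀ f k u, Q (D.glue (f, k)).1 (-(vtx ((D.glue (f, k)).2 - k) * u)) → Q f u := by
    intro f k u h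
    obtain ⟨⟨g, l⟩, hg⟩ : ∃ c, D.glue (f, k) = c := ⟨_, rfl⟩
    rw [hg] at h
    have := hQ g l _ h
    rw [glue_symm hg] at this
    convert this using 1
    linear_combination (-u) * vtx_sub_mul_vtx_sub k l
  let R : ℝ → Prop := fun s => ∃ f z u, u ≠ 0 ∧ D.PassesThrough γ s f z u ∧ Q f u
  have hRQ : ∀ s f z u, u ≠ 0 → D.PassesThrough γ s f z u → R s → Q f u := by
    rintro s f z u hu hp ⟨f', z', u', hu', hp', hq⟩
    exact (hp'.tangentEq_self hn hp hu').transport hQ hq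
  have hloc : ∀ s f z u, u ≠ 0 → D.PassesThrough γ s f z u →
      ∀ᶠ q in 𝓝 s, (R q ↔ Q f u) := by
    intro s f z u hu hp
    obtain ⟨k, -, hr⟩ := hp.eventually_passesThrough
    apply eventually_of_eventually_add
    filter_upwards [hr] with r hr
    rcases hr with ⟨-, hr⟩ | hr
    · exact ⟨fun h => hRQ _ _ _ _ hu hr h, fun h => ⟨_, _, _, hu, hr, h⟩⟩
    · have hu' : -(vtx ((D.glue (f, k)).2 - k) * u) ≠ 0 :=
        neg_ne_zero.mpr (mul_ne_zero (vtx_ne_zero _) hu)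
      exact ⟨fun h => hQ' _ _ _ (hRQ _ _ _ _ hu' hr h), fun h => ⟨_, _, _, hu', hr, hQ _ _ _ h⟩⟩
  have hU : IsOpen {s | ∀ᶠ q in 𝓝 s, R q} := by
    rw [isOpen_iff_mem_nhds]
    intro s hs
    exact eventually_eventually_nhds.mpr hs
  have key := isPreconnected_Ioo.subset_of_closure_inter_subset hU
    ⟨t₀, ht₀, (hloc _ _ _ _ hu₀ h₀).mono fun q hq => hq.mpr hQ₀⟩ (by
      rintro s ⟨hsc, hs⟩
      obtain ⟨f, z, u, hu, hp⟩ := h s hs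
      have hl := hloc s f z u hu hp
      obtain ⟨q, hq1, hq2⟩ := ((mem_closure_iff_frequently.mp hsc).and_eventually hl).exists
      have hq : Q f u := hq2.mp hq1.self_of_nhds
      exact hl.mono fun q h => h.mpr hq)
  exact hRQ t f z u hu hp (key ht).self_of_nhds

/-- The version of `StraightOn.transport` for a saddle connection and its initial vector. -/
theorem IsSaddleConnection.transport {Q : D.Face → ℂ → Prop}
    (hQ : ∀ f k u, Q f u → Q (D.glue (f, k)).1 (-(vtx ((D.glue (f, k)).2 - k) * u)))
    {L : ℝ} {γ : ℝ → D.Surface} (h : D.IsSaddleConnection L γ) {f₀ : D.Face} {z₀ u₀ : ℂ}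
    (hu₀ : u₀ ≠ 0) (h₀ : D.StartsAt γ 0 f₀ z₀ u₀) (hQ₀ : Q f₀ u₀) {t : ℝ}
    (ht : t ∈ Set.Ioo 0 L) {f : D.Face} {z u : ℂ} (hp : D.PassesThrough γ t f z u)
    (hu : u ≠ 0) : Q f u := by
  obtain ⟨r, hr, hr0⟩ :=
    ((h₀.eventually_passesThrough hn hu₀).and (Ioo_mem_nhdsGT h.pos)).exists
  rw [zero_add] at hr
  exact h.straightOn.transport hn hQ hr0 hu₀ hr hQ₀ ht hp hu

/-- The version of `StraightOn.transport` for the initial and the final vector of a saddle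
connection. -/
theorem IsSaddleConnection.transport_end {Q : D.Face → ℂ → Prop}
    (hQ : ∀ f k u, Q f u → Q (D.glue (f, k)).1 (-(vtx ((D.glue (f, k)).2 - k) * u)))
    {L : ℝ} {γ : ℝ → D.Surface} (h : D.IsSaddleConnection L γ) {f₀ : D.Face} {z₀ u₀ : ℂ}
    (hu₀ : u₀ ≠ 0) (h₀ : D.StartsAt γ 0 f₀ z₀ u₀) (hQ₀ : Q f₀ u₀) {f : D.Face} {z u : ℂ}
    (hp : D.StartsAt (fun s => γ (L - s)) 0 f z u) (hu : u ≠ 0) : Q f (-u) := by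
  obtain ⟨r, hr, hr0⟩ :=
    ((hp.eventually_passesThrough hn hu).and (Ioo_mem_nhdsGT h.pos)).exists
  have := hr.sub L
  rw [zero_add] at this
  simp only [sub_sub_cancel] at this
  exact h.transport hn hQ hu₀ h₀ hQ₀ ⟨by linarith [hr0.2], by linarith [hr0.1]⟩ this
    (neg_ne_zero.mpr hu)

end

/-! ### Translation structures -/

/-- The polygon `f`, placed in the plane after the multiplication by `dir f`: all gluings are then
translations. -/
def IsDirection (D : PolygonGluing n) (dir : D.Face → ℂ) : Prop :=
  ∀ f k, dir (D.glue (f, k)).1 = -(vtx (k - (D.glue (f, k)).2) * dir f)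

/-- `dir f * u` is the vector as seen in the plane after placing the polygon; translations do not
change it. -/
theorem IsDirection.transport {dir : D.Face → ℂ} (h : D.IsDirection dir) (U : ℂ) (f : D.Face)
    (k : ZMod n) (u : ℂ) (hu : dir f * u = U) :
    dir (D.glue (f, k)).1 * -(vtx ((D.glue (f, k)).2 - k) * u) = U := by
  rw [h f k]
  linear_combination hu + dir f * u * vtx_sub_mul_vtx_sub k (D.glue (f, k)).2

theorem IsDirection.tangentEq (hn : 3 ≤ n) {dir : D.Face → ℂ} (h : D.IsDirection dir)
    (h0 : ∀ f, dir f ≠ 0) {f f' : D.Face} {z u z' u' : ℂ} {x : D.Surface}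
    (hx : D.HasCoord f z x) (hx' : D.HasCoord f' z' x) (hz : z ∉ Set.range (vtx : ZMod n → ℂ))
    (hu : dir f * u = dir f' * u') : D.TangentEq f z u f' z' u' := by
  rcases hx.eq_or hn hx' hz with ⟨rfl, rfl⟩ | ⟨k, l, hg, hk, rfl⟩
  · exact Or.inl ⟨rfl, rfl, mul_left_cancel₀ (h0 f) hu⟩
  · refine Or.inr ⟨k, l, hg, hk, rfl, mul_left_cancel₀ (h0 f') ?_⟩
    have := h.transport _ f k u hu
    rw [hg] at this
    exact this.symm

end Saddles

/-! ### The surfaces made of one or two polygons -/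

section Veech

variable {n : ℕ} [NeZero n]

theorem vtx_halfTurn (h : Even n) : vtx (halfTurn n) = -1 := by
  rw [vtx, ZMod.stdAddChar_apply, ← neg_one_eq_toCircle_halfTurn h]
  rfl

/-- This unites both parities: the sign comes from the half-turn of the polygon for even `n`, and
from the change of polygon for odd `n`. -/
theorem VeechFace.coe_opp_mul_vtx (ε : VeechFace n) :
    ((ε.opp.1 : Circle) : ℂ) * vtx (halfTurn n) = -((ε.1 : Circle) : ℂ) := by
  by_cases h : Even n
  · rw [vtx_halfTurn h]
    simp [VeechFace.opp, h]
  · have h2 : halfTurn n = 0 := by simp [halfTurn, h]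
    rw [h2, vtx_zero, mul_one]
    simp only [VeechFace.opp, h, dif_neg, not_false_eq_true]
    rfl

theorem vtx_halfTurn_mul_self : vtx (halfTurn n) * vtx (halfTurn n) = 1 := by
  rw [← vtx_add, halfTurn_add_self, vtx_zero]

/-- The direction of the polygons of `Π_n`. -/
def veechDir (ε : (veechSurface n).Face) : ℂ := ((Subtype.val ε : Circle) : ℂ)

theorem veechDir_ne_zero (ε : (veechSurface n).Face) : veechDir ε ≠ 0 := Circle.coe_ne_zero _

theorem isDirection_veechDir : (veechSurface n).IsDirection veechDir := by
  intro ε k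
  change ((VeechFace.opp ε).1 : ℂ) = -(vtx (k - (k + halfTurn n)) * veechDir ε)
  have h1 : k - (k + halfTurn n) = halfTurn n := by
    linear_combination -(halfTurn_add_self n)
  rw [h1]
  have h2 := VeechFace.coe_opp_mul_vtx ε
  have h3 : ((ε.1 : Circle) : ℂ) = veechDir ε := rfl
  rw [h3] at h2
  linear_combination vtx (halfTurn n) * h2 - ((VeechFace.opp (n := n) ε).1 : ℂ)
    * vtx_halfTurn_mul_self (n := n)

theorem veechDir_hyperelliptic (ε : (veechSurface n).Face) (u : ℂ) :
    veechDir ((hyperelliptic n).face ε) * (vtx ((hyperelliptic n).rot ε) * u)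
      = -(veechDir ε * u) := by
  have : veechDir ((hyperelliptic n).face ε) * vtx ((hyperelliptic n).rot ε) = -veechDir ε :=
    VeechFace.coe_opp_mul_vtx ε
  rw [← mul_assoc, this, neg_mul]

theorem hyperelliptic_map_map (x : (veechSurface n).Surface) :
    (hyperelliptic n).map ((hyperelliptic n).map x) = x := by
  obtain ⟨f, z, hz⟩ := exists_hasCoord x
  have h := (hyperelliptic n).hasCoord ((hyperelliptic n).hasCoord hz)
  have h1 : (hyperelliptic n).face ((hyperelliptic n).face f) = f := VeechFace.opp_opp f
  have h2 : vtx ((hyperelliptic n).rot ((hyperelliptic n).face f)) *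
      (vtx ((hyperelliptic n).rot f) * z) = z := by
    rw [← mul_assoc]
    change vtx (halfTurn n) * vtx (halfTurn n) * z = z
    rw [vtx_halfTurn_mul_self, one_mul]
  rw [h1, h2] at h
  exact h.unique hz

section
variable (hn : 3 ≤ n)
include hn

/-- The regular fixed points of the hyperelliptic involution are centers of polygons and midpoints
of sides. -/
theorem hyperelliptic_fixed {ε : (veechSurface n).Face} {w : ℂ} {y : (veechSurface n).Surface}
    (hy : (veechSurface n).HasCoord ε w y) (hw : w ∉ Set.range (vtx : ZMod n → ℂ))
    (hfix : (hyperelliptic n).map y = y) :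
    (Even n ∧ w = 0) ∨ ∃ l : ZMod n, w = sideSum l / 2 := by
  have h1 := (hyperelliptic n).hasCoord hy
  rw [hfix] at h1
  have hdir := veechDir_hyperelliptic ε w
  rcases h1.eq_or hn hy (by rwa [vtx_mul_mem_range_iff]) with ⟨hf, hz⟩ | ⟨k, l, hg, hk, hz⟩
  · left
    rw [hf, hz] at hdir
    have h2 : veechDir ε * w = 0 := by linear_combination hdir / 2
    have h3 : w = 0 := (mul_eq_zero.mp h2).resolve_left (veechDir_ne_zero ε)
    refine ⟨?_, h3⟩
    -- For odd `n` the involution exchanges the two polygons, so no interior point is fixed.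
    by_contra ho
    have h4 := VeechFace.coe_opp_mul_vtx (n := n) ε
    have h5 : VeechFace.opp ε = ε := hf
    have h6 : halfTurn n = 0 := by simp [halfTurn, ho]
    rw [h5, h6, vtx_zero, mul_one] at h4
    exact Circle.coe_ne_zero ε.1 (self_eq_neg.mp h4)
  · right
    have hl : k + halfTurn n = l := congrArg Prod.snd hg
    refine ⟨l, ?_⟩
    have h2 : sideSum l = vtx (halfTurn n) * sideSum k := by rw [← hl, sideSum_add]
    have h3 : l - k = halfTurn n := by rw [← hl]; ring
    have h4 : w = vtx (halfTurn n) * (sideSum k - vtx (halfTurn n) * w) := by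
      conv_lhs => rw [hz, sideMap_eq, h3]
      rfl
    rw [h2]
    linear_combination h4 / 2 - w / 2 * vtx_halfTurn_mul_self (n := n)

/-- A saddle connection of `Π_n` which is invariant under the hyperelliptic involution contains a
regular fixed point. -/
theorem exists_hyperelliptic_fixed {L : ℝ} {α : ℝ → (veechSurface n).Surface}
    (h : (veechSurface n).IsSaddleConnection L α)
    (hJ : (hyperelliptic n).map '' (α '' Set.Icc 0 L) = α '' Set.Icc 0 L) :
    ∃ m ∈ Set.Ioo 0 L, (hyperelliptic n).map (α m) = α m := by
  have hL := h.pos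
  have ht : L / 2 ∈ Set.Ioo 0 L := ⟨by linarith, by linarith⟩
  obtain ⟨s, hs, hse⟩ : (hyperelliptic n).map (α (L / 2)) ∈ α '' Set.Icc 0 L := by
    rw [← hJ]
    exact ⟨_, ⟨L / 2, ⟨ht.1.le, ht.2.le⟩, rfl⟩, rfl⟩
  have hsreg : α s ∉ (veechSurface n).sing := by
    rw [hse, (hyperelliptic n).map_mem_sing_iff hn]
    exact h.straightOn.notMem_sing hn ht
  have hs' : s ∈ Set.Ioo 0 L := by
    refine ⟨lt_of_le_of_ne hs.1 ?_, lt_of_le_of_ne hs.2 ?_⟩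
    · rintro rfl; exact hsreg h.start_mem
    · rintro rfl; exact hsreg h.end_mem
  obtain ⟨f, z, u, hu, hp⟩ := h.straightOn _ ht
  obtain ⟨f', z', u', hu', hp'⟩ := h.straightOn _ hs'
  -- The direction is constant along the path, and the involution negates it. So the middle vector
  -- is carried to the negative of the vector at time `s`.
  have hdir : veechDir f' * u' = veechDir f * u :=
    h.straightOn.transport hn (Q := fun g v => veechDir g * v = veechDir f * u)
      (isDirection_veechDir.transport _) ht hu hp rfl hs' hp' hu'
  have hT : (veechSurface n).TangentEq ((hyperelliptic n).face f)
      (vtx ((hyperelliptic n).rot f) * z) (vtx ((hyperelliptic n).rot f) * u) f' z' (-u') := by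
    refine isDirection_veechDir.tangentEq hn veechDir_ne_zero
      ((hyperelliptic n).hasCoord (hp.hasCoord hn)) (hse ▸ hp'.hasCoord hn) ?_ ?_
    · rw [vtx_mul_mem_range_iff]; exact hp.notMem_range_vtx hn
    · rw [veechDir_hyperelliptic, mul_neg, hdir]
  have hp2 := hp'.sub (s + L / 2)
  rw [add_sub_cancel_left] at hp2
  have hnear := eventually_of_eventually_add
    (P := fun t => (hyperelliptic n).map (α t) = α (s + L / 2 - t)) ((hp.map (hyperelliptic n)).eventuallyEq hn hp2 hT)
  have hs2 := h.straightOn.sub (s + L / 2)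
  rw [sub_zero] at hs2
  have h0 := hs'.1
  have h1 := hs'.2
  have heq := ((h.map hn (hyperelliptic n)).straightOn.mono (le_max_left 0 (s + L / 2 - L))
    (min_le_left L (s + L / 2))).eqOn hn (hs2.mono (le_max_right _ _) (min_le_right _ _))
    ⟨max_lt ht.1 (by linarith), lt_min ht.2 (by linarith)⟩ hnear
  -- The involution acts on times by `t ↦ s + L / 2 - t`; this is the fixed time.
  refine ⟨(s + L / 2) / 2, ⟨by linarith, by linarith⟩, ?_⟩
  have := heq ((s + L / 2) / 2) ⟨max_lt (by linarith) (by linarith),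
    lt_min (by linarith) (by linarith)⟩
  rwa [sub_half] at this

/-- A virtual Weierstrass saddle connection passes through the center of a polygon with an even
number of sides, or through the midpoint of a side. -/
theorem IsVirtualWeierstrassSaddle.exists_passesThrough {D : PolygonGluing n} {o : D.Face} {L : ℝ}
    {γ : ℝ → D.Surface} (h : D.IsVirtualWeierstrassSaddle o L γ) :
    ∃ m ∈ Set.Ioo 0 L, D.IsVirtualWeierstrassPoint o (γ m) ∧
      ∃ f z u, D.PassesThrough γ m f z u ∧
        ((Even n ∧ z = 0) ∨ ∃ l : ZMod n, z = sideSum l / 2) := by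
  obtain ⟨δ, hδ, hγ, hJ⟩ := h
  have hα := hδ.map hn (D.veechHom o)
  obtain ⟨m, hm, hfix⟩ := exists_hyperelliptic_fixed hn hα hJ
  refine ⟨m, hm, ⟨δ m, hγ m ⟨hm.1.le, hm.2.le⟩, hfix⟩, ?_⟩
  obtain ⟨x, z, u, hu, hp⟩ := hδ.straightOn m hm
  have hp1 := hp.map (D.unfoldingHom o)
  have hp2 : D.PassesThrough γ m x.1.1 z u := by
    have := hp1.congr (γ' := γ) (by
      filter_upwards [isOpen_Ioo.mem_nhds hm] with s hs
      exact hγ s ⟨hs.1.le, hs.2.le⟩)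
    have e : vtx ((D.unfoldingHom o).rot x) = 1 := vtx_zero
    rw [e, one_mul, one_mul] at this
    exact this
  refine ⟨x.1.1, z, u, hp2, ?_⟩
  have hw := (hp.map (D.veechHom o))
  rcases hyperelliptic_fixed hn (hw.hasCoord hn) (hw.notMem_range_vtx hn) hfix with
    ⟨he, h0⟩ | ⟨l, hl⟩
  · exact Or.inl ⟨he, (mul_eq_zero.mp h0).resolve_left (vtx_ne_zero _)⟩
  · right
    refine ⟨l - (D.veechHom o).rot x, mul_left_cancel₀ (vtx_ne_zero ((D.veechHom o).rot x)) ?_⟩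
    rw [hl]
    have := sideSum_add (l - (D.veechHom o).rot x) ((D.veechHom o).rot x)
    rw [sub_add_cancel] at this
    rw [this]; ring

end

end Veech

end PolygonGluing

/-! ### Isometries of the plane are affine -/

section Isometries

theorem Isometry.apply_real_combo {A : ℂ → ℂ} (hA : Isometry A) (h0 : A 0 = 0) (s t : ℝ)
    (a b : ℂ) : A (s * a + t * b) = s * A a + t * A b := by
  have h : ∀ z, A z = hA.affineIsometryOfStrictConvexSpace.linear z := by
    intro z
    have := hA.affineIsometryOfStrictConvexSpace.toAffineMap.decomp
    have h1 := congrFun this z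
    simp only [Pi.add_apply] at h1
    have h2 : hA.affineIsometryOfStrictConvexSpace.toAffineMap 0 = 0 := h0
    rw [h2, add_zero] at h1
    exact h1
  rw [h, h a, h b, ← Complex.real_smul, ← Complex.real_smul, map_add, map_smul, map_smul,
    Complex.real_smul, Complex.real_smul]

/-- Isometries of the plane that agree near a point are equal. -/
theorem Isometry.eq_of_eventuallyEq {A B : ℂ → ℂ} (hA : Isometry A) (hB : Isometry B) {z₀ : ℂ}
    (h : ∀ᶠ w in 𝓝 z₀, A w = B w) : A = B := by
  funext y
  have ht : Tendsto (fun t : ℝ => AffineMap.lineMap (k := ℝ) z₀ y t) (𝓝 0) (𝓝 z₀) := by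
    have : Continuous (fun t : ℝ => AffineMap.lineMap (k := ℝ) z₀ y t) :=
      AffineMap.lineMap_continuous
    simpa using this.tendsto 0
  obtain ⟨t, h1, h2⟩ := (((ht.eventually h).filter_mono (nhdsWithin_le_nhds (s := {0}ᶜ))).and
    self_mem_nhdsWithin).exists
  have h0 : A z₀ = B z₀ := h.self_of_nhds
  have hAl : A (AffineMap.lineMap (k := ℝ) z₀ y t) = AffineMap.lineMap (A z₀) (A y) t :=
    hA.affineIsometryOfStrictConvexSpace.toAffineMap.apply_lineMap z₀ y t
  have hBl : B (AffineMap.lineMap (k := ℝ) z₀ y t) = AffineMap.lineMap (B z₀) (B y) t :=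
    hB.affineIsometryOfStrictConvexSpace.toAffineMap.apply_lineMap z₀ y t
  rw [hAl, hBl, h0, AffineMap.lineMap_apply_module, AffineMap.lineMap_apply_module] at h1
  have ht0 : t ≠ 0 := h2
  have := add_left_cancel h1
  exact smul_right_injective ℂ ht0 this

end Isometries

namespace PolygonGluing

section Platonic

variable {n : ℕ} [NeZero n] {D : PolygonGluing n}

/-! ### Connectedness -/

/-- The gluing is an involution, so `P` takes the same value on adjacent polygons. It defines a
clopen subset of the surface, which is everything by connectedness. -/
theorem face_induction [ConnectedSpace D.Surface] {P : D.Face → Prop}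
    (hP : ∀ f k, P f → P (D.glue (f, k)).1) {f₀ : D.Face} (h₀ : P f₀) (f : D.Face) : P f := by
  have hP' : ∀ x y, D.Rel x y → P x.1 → P y.1 := by
    rintro x y ⟨k, l, hg, -, -⟩ hx
    have := hP x.1 k hx
    rwa [hg] at this
  let Q : D.Surface → Prop := Quot.lift (fun x => P x.1) fun x y hxy =>
    propext ⟨hP' x y hxy, hP' y x (rel_symm hxy)⟩
  have key : ∀ T : Prop → Prop, IsOpen {x : D.Surface | T (Q x)} := by
    intro T
    have hq : IsQuotientMap (Quot.mk D.Rel) := isQuotientMap_quot_mk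
    refine hq.isOpen_preimage.mp ?_
    rw [isOpen_sigma_iff]
    intro g
    by_cases hT : T (P g)
    · convert isOpen_univ
      exact Set.eq_univ_of_forall fun z => hT
    · convert isOpen_empty
      exact Set.eq_empty_of_forall_notMem fun z hz => hT hz
  have hcl : IsClopen {x : D.Surface | Q x} := ⟨⟨key Not⟩, key id⟩
  have huniv := hcl.eq_univ ⟨D.corner (f₀, 0), h₀⟩
  have : D.corner (f, 0) ∈ {x : D.Surface | Q x} := by rw [huniv]; trivial
  exact this

/-- A map of the surface to itself that fixes a side is the identity. -/
theorem PolyHom.rigid [ConnectedSpace D.Surface] (φ : PolyHom D D) {f₀ : D.Face}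
    (h : φ.face f₀ = f₀ ∧ φ.rot f₀ = 0) (f : D.Face) : φ.face f = f ∧ φ.rot f = 0 := by
  refine face_induction (P := fun f => φ.face f = f ∧ φ.rot f = 0) ?_ h f
  rintro f k ⟨h1, h2⟩
  have := φ.compat f k
  rw [h1, h2, add_zero] at this
  refine ⟨(congrArg Prod.fst this).symm, ?_⟩
  have h3 : (D.glue (f, k)).2 = (D.glue (f, k)).2 + φ.rot (D.glue (f, k)).1 :=
    congrArg Prod.snd this
  exact left_eq_add.mp h3

/-- The composition of two maps. -/
def PolyHom.comp (φ ψ : PolyHom D D) : PolyHom D D where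
  face f := φ.face (ψ.face f)
  rot f := ψ.rot f + φ.rot (ψ.face f)
  compat f k := by
    have h1 := ψ.compat f k
    have h2 := φ.compat (ψ.face f) (k + ψ.rot f)
    rw [h1] at h2
    rw [← add_assoc, h2, ← add_assoc]

theorem PolyHom.map_eq_self {φ : PolyHom D D} (h : ∀ f, φ.face f = f ∧ φ.rot f = 0)
    (x : D.Surface) : φ.map x = x := by
  obtain ⟨f, z, hz⟩ := exists_hasCoord x
  have := φ.hasCoord hz
  rw [(h f).1, (h f).2, vtx_zero, one_mul] at this
  exact this.unique hz

theorem PolyHom.comp_map (φ ψ : PolyHom D D) (x : D.Surface) :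
    (φ.comp ψ).map x = φ.map (ψ.map x) := by
  obtain ⟨f, z, hz⟩ := exists_hasCoord x
  have h1 := (φ.comp ψ).hasCoord hz
  have h2 := φ.hasCoord (ψ.hasCoord hz)
  have e : vtx ((φ.comp ψ).rot f) * z = vtx (φ.rot (ψ.face f)) * (vtx (ψ.rot f) * z) := by
    rw [← mul_assoc, ← vtx_add]
    congr 2
    exact add_comm _ _
  rw [e] at h1
  exact h1.unique h2

/-- The homeomorphism that belongs to an involution. -/
noncomputable def PolyHom.toHomeomorph (φ : PolyHom D D) (h : ∀ x, φ.map (φ.map x) = x) :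
    D.Surface ≃ₜ D.Surface where
  toFun := φ.map
  invFun := φ.map
  left_inv := h
  right_inv := h
  continuous_toFun := φ.continuous_map
  continuous_invFun := φ.continuous_map

theorem PolyHom.isRotation (hn : 3 ≤ n) (φ : PolyHom D D) (h : ∀ x, φ.map (φ.map x) = x) :
    D.IsRotation (φ.toHomeomorph h) := by
  constructor
  · apply Set.Subset.antisymm
    · rintro _ ⟨x, hx, rfl⟩
      exact (φ.map_mem_sing_iff hn).mpr hx
    · intro x hx
      exact ⟨φ.map x, (φ.map_mem_sing_iff hn).mpr hx, h x⟩
  · intro c z hz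
    refine ⟨φ.dart c, fun w => vtx (φ.rot c.1) * w, ⟨vtx (φ.rot c.1), 0, norm_vtx _, ?_⟩,
      φ.mem_chartRegion hz, Eventually.of_forall fun w x hx => φ.chartCoord hx⟩
    funext w; rw [add_zero]

section
variable (hn : 3 ≤ n)
include hn

/-- A test point: it lies in one polygon only and, not being the center, it detects every nontrivial
rotation. -/
theorem half_mem_interior : ((1 / 2 : ℝ) : ℂ) * vtx (0 : ZMod n) ∈ interior (RegPoly n) :=
  mul_mem_interior_of_lt_one hn (vtx_mem_regPoly 0) (by norm_num) (by norm_num)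

theorem PolyHom.exists_map_ne (φ : PolyHom D D) {f : D.Face}
    (h : ¬ (φ.face f = f ∧ φ.rot f = 0)) : ∃ y, φ.map y ≠ y := by
  have hz := half_mem_interior hn
  set z : ℂ := ((1 / 2 : ℝ) : ℂ) * vtx (0 : ZMod n) with hzdef
  have hz0 : z ≠ 0 := mul_ne_zero (by norm_num) (vtx_ne_zero _)
  have hx : D.HasCoord f z (D.pt f ⟨z, interior_subset hz⟩) := ⟨_, rfl⟩
  refine ⟨D.pt f ⟨z, interior_subset hz⟩, fun he => h ?_⟩
  have h1 := φ.hasCoord hx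
  rw [he] at h1
  obtain ⟨h2, h3⟩ := hx.eq_of_mem_interior hn h1 hz
  refine ⟨h2.symm, vtx_injective ?_⟩
  rw [vtx_zero]
  exact mul_right_cancel₀ hz0 (by rw [one_mul]; exact h3.symm)

theorem interior_regPoly_dense {z : ℂ} (hz : z ∈ RegPoly n) : z ∈ closure (interior (RegPoly n)) :=
  ((convex_convexHull ℝ (Set.range (vtx : ZMod n → ℂ))).closure_interior_eq_closure_of_nonempty_interior
    ⟨0, zero_mem_interior hn⟩).symm ▸ subset_closure hz

theorem exists_interior_of_eventually {z : ℂ} (hz : z ∈ RegPoly n) {Q : ℂ → Prop}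
    (hQ : ∀ᶠ w in 𝓝 z, Q w) :
    ∃ z' ∈ interior (RegPoly n), ∀ᶠ w in 𝓝 z', w ∈ interior (RegPoly n) ∧ Q w := by
  obtain ⟨z', h1, h2⟩ := ((mem_closure_iff_frequently.mp
    (interior_regPoly_dense hn hz)).and_eventually (eventually_eventually_nhds.mpr hQ)).exists
  have h3 : ∀ᶠ w in 𝓝 z', w ∈ interior (RegPoly n) := isOpen_interior.mem_nhds h1
  exact ⟨z', h1, h3.and h2⟩

/-! ### Isometries that carry polygons to polygons -/

omit hn in
theorem isometry_vtx_mul (a : ZMod n) : Isometry (fun z : ℂ => vtx a * z) := by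
  apply Isometry.of_dist_eq
  intro x y
  rw [dist_eq_norm, dist_eq_norm, ← mul_sub, norm_mul, norm_vtx, one_mul]

omit hn in
theorem isometry_sideMap (k l : ZMod n) : Isometry (sideMap k l) := by
  apply Isometry.of_dist_eq
  intro x y
  rw [dist_eq_norm, dist_eq_norm, sideMap, sideMap, sub_sub_sub_cancel_left, ← mul_sub, norm_mul,
    norm_vtx, one_mul, norm_sub_rev]

/-- Only `0` and its mirror image `sideSum k` have distance `1` from both ends of a side, and the
latter has height `2 * sideHeight n`, so it is outside the polygon. -/
theorem eq_zero_of_dist_vtx {k : ZMod n} {w : ℂ} (hw : w ∈ RegPoly n)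
    (h1 : ‖w - vtx k‖ = 1) (h2 : ‖w - vtx (k + 1)‖ = 1) : w = 0 := by
  have hH := sideHeight_pos hn
  have ha := norm_vtx k
  have hb := norm_vtx (k + 1)
  have hle := height_le_of_mem hn hw k
  have hS := height_sideSum k
  have hne : vtx k ≠ vtx (k + 1) := by
    intro h; exact one_ne_zero_zmod hn (left_eq_add.mp (vtx_injective h))
  simp only [height, innerSL_apply_apply, Complex.inner, sideSum, Complex.mul_re, Complex.add_re,
    Complex.add_im, Complex.conj_re, Complex.conj_im] at hle hS
  have sq : ∀ z : ℂ, ‖z‖ = 1 → z.re * z.re + z.im * z.im = 1 := by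
    intro z hz
    rw [← Complex.normSq_apply, Complex.normSq_eq_norm_sq, hz, one_pow]
  have a1 := sq _ ha
  have b1 := sq _ hb
  have w1 := sq _ h1
  have w2 := sq _ h2
  simp only [Complex.sub_re, Complex.sub_im] at w1 w2
  set a := vtx k
  set b := vtx (k + 1)
  have c1 : a.re * w.re + a.im * w.im = b.re * w.re + b.im * w.im := by linarith
  have hcross : w.re * (a.im + b.im) = w.im * (a.re + b.re) := by
    have hr : (a.re - b.re) * (w.re * (a.im + b.im) - w.im * (a.re + b.re)) = 0 := by
      linear_combination (a.im + b.im) * c1 - w.im * (a1 - b1)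
    have hs : (a.im - b.im) * (w.re * (a.im + b.im) - w.im * (a.re + b.re)) = 0 := by
      linear_combination (-(a.re + b.re)) * c1 + w.re * (a1 - b1)
    by_contra hc
    have hc' : w.re * (a.im + b.im) - w.im * (a.re + b.re) ≠ 0 := sub_ne_zero.mpr hc
    have hr' := (mul_eq_zero.mp hr).resolve_right hc'
    have hs' := (mul_eq_zero.mp hs).resolve_right hc'
    exact hne (Complex.ext (by linarith) (by linarith))
  set N := w.re * w.re + w.im * w.im with hN
  have hN1 : N = (a.re + b.re) * w.re + (a.im + b.im) * w.im := by
    rw [hN]; linarith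
  -- Lagrange's identity for `w` and `sideSum k`, whose cross product vanishes. Thus `N`, which
  -- equals the height of `w`, is `0` or `2 * sideHeight n`.
  have hN2 : N * (2 * sideHeight n) = N * N := by
    have e : (w.re * (a.im + b.im) - w.im * (a.re + b.re)) = 0 := by linarith
    calc N * (2 * sideHeight n)
        = ((a.re + b.re) * w.re + (a.im + b.im) * w.im) ^ 2
          + (w.re * (a.im + b.im) - w.im * (a.re + b.re)) ^ 2 := by rw [← hS, hN]; ring
      _ = N * N := by rw [e, ← hN1]; ring
  have hN0 : N = 0 := by
    by_contra hc
    have := mul_left_cancel₀ hc hN2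
    linarith
  have hre : w.re = 0 := by nlinarith [mul_self_nonneg w.re, mul_self_nonneg w.im]
  have him : w.im = 0 := by nlinarith [mul_self_nonneg w.re, mul_self_nonneg w.im]
  exact Complex.ext hre him

theorem exists_combo (k : ZMod n) (z : ℂ) : ∃ s t : ℝ, z = s * vtx k + t * vtx (k + 1) := by
  have him : (vtx (1 : ZMod n)).im ≠ 0 := by
    intro him
    have h1 := norm_vtx (1 : ZMod n)
    have h2 := re_vtx_one_lt_one hn
    have h3 := sideHeight_pos hn
    rw [sideHeight] at h3
    have h4 : (vtx (1 : ZMod n)).re * (vtx (1 : ZMod n)).re = 1 := by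
      have := Complex.normSq_apply (vtx (1 : ZMod n))
      rw [Complex.normSq_eq_norm_sq, h1, him] at this
      linarith
    nlinarith
  set v := vtx (1 : ZMod n) with hv
  set w := vtx (-k) * z with hw
  have hz : z = vtx k * w := by rw [hw, ← mul_assoc, ← vtx_add, add_neg_cancel, vtx_zero, one_mul]
  refine ⟨w.re - w.im / v.im * v.re, w.im / v.im, ?_⟩
  have hwv : w = ((w.re - w.im / v.im * v.re : ℝ) : ℂ) + ((w.im / v.im : ℝ) : ℂ) * v := by
    apply Complex.ext
    · simp only [Complex.add_re, Complex.ofReal_re, Complex.re_ofReal_mul]; ring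
    · simp only [Complex.add_im, Complex.ofReal_im, Complex.im_ofReal_mul]
      field_simp
      ring
  conv_lhs => rw [hz, hwv]
  rw [vtx_add]; ring

/-- The plane isometry fixes the center, the only point of the polygon at distance `1` from both
ends of a side. Both flags use the initial endpoint, so it is a rotation and not a reflection. -/
theorem CarriesFlag.hasCoord {h : D.Surface → D.Surface} {f f' : D.Face} {k k' : ZMod n}
    (hc : D.CarriesFlag h (f, k, false) (f', k', false)) {z : ℂ} {x : D.Surface}
    (hx : D.HasCoord f z x) : D.HasCoord f' (vtx (k' - k) * z) (h x) := by
  obtain ⟨A, hA, h1, h2, h3⟩ := hc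
  have h1 : A (vtx k) = vtx k' := h1
  have h2 : A (vtx (k + 1)) = vtx (k' + 1) := h2
  have h0 : A 0 = 0 := by
    refine eq_zero_of_dist_vtx hn (k := k')
      (h3 0 (D.pt f ⟨0, zero_mem_regPoly hn⟩) ⟨zero_mem_regPoly hn, rfl⟩).mem ?_ ?_
    · rw [← h1, ← dist_eq_norm, hA.dist_eq, dist_zero_left, norm_vtx]
    · rw [← h2, ← dist_eq_norm, hA.dist_eq, dist_zero_left, norm_vtx]
  have hz := h3 z x hx
  obtain ⟨s, t, rfl⟩ := exists_combo hn k z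
  rw [hA.apply_real_combo h0, h1, h2] at hz
  have e1 : vtx k' = vtx (k' - k) * vtx k := by rw [← vtx_add, sub_add_cancel]
  have e2 : vtx (k' + 1) = vtx (k' - k) * vtx (k + 1) := by rw [← vtx_add]; congr 1; ring
  rw [e1, e2] at hz
  convert hz using 1
  ring

/-- The homeomorphism `h` carries the interior of the polygon `f` to that of the polygon `f'`, after
the rotation by `vtx a`. -/
def CarriesFace (D : PolygonGluing n) (h : D.Surface → D.Surface) (f f' : D.Face) (a : ZMod n) :
    Prop :=
  ∀ z ∈ interior (RegPoly n), ∀ x, D.HasCoord f z x → D.HasCoord f' (vtx a * z) (h x)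

theorem CarriesFace.unique {h : D.Surface → D.Surface} {f f₁ f₂ : D.Face} {a₁ a₂ : ZMod n}
    (h₁ : D.CarriesFace h f f₁ a₁) (h₂ : D.CarriesFace h f f₂ a₂) : f₁ = f₂ ∧ a₁ = a₂ := by
  have hz := half_mem_interior hn
  set z : ℂ := ((1 / 2 : ℝ) : ℂ) * vtx (0 : ZMod n) with hzdef
  have hz0 : z ≠ 0 := mul_ne_zero (by norm_num) (vtx_ne_zero _)
  have hx : D.HasCoord f z (D.pt f ⟨z, interior_subset hz⟩) := ⟨_, rfl⟩
  obtain ⟨h3, h4⟩ := (h₁ z hz _ hx).eq_of_mem_interior hn (h₂ z hz _ hx)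
    (vtx_mul_mem_interior hn _ hz)
  exact ⟨h3, vtx_injective (mul_right_cancel₀ hz0 h4)⟩

/-- A flat chart which is compatible with the polygon `f'` on an open set can be replaced by a
chart that extends the polygon `f'`. -/
theorem exists_chart_of_eventually {c' : D.Face × ZMod n} {B : ℂ → ℂ} (hB : Isometry B)
    {f' : D.Face} {a : ZMod n} {z₀ : ℂ}
    (h : ∀ᶠ w in 𝓝 z₀, w ∈ interior (RegPoly n) ∧
      ∃ y, D.HasCoord f' (vtx a * w) y ∧ D.ChartCoord c' (B w) y) :
    ∃ k, (∀ w y, D.ChartCoord c' (B w) y → D.ChartCoord (f', k) (vtx a * w) y) ∧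
      ∀ w, B w ∈ D.chartRegion c' → vtx a * w ∈ interior (lens k) := by
  obtain ⟨g, j⟩ := c'
  obtain ⟨⟨g', j'⟩, hg⟩ : ∃ c, D.glue (g, j) = c := ⟨_, rfl⟩
  by_cases h1 : g = f' ∧ B = fun w => vtx a * w
  · obtain ⟨rfl, rfl⟩ := h1
    exact ⟨j, fun w y hy => hy, fun w hw => by rwa [chartRegion_eq] at hw⟩
  have h2 : ∀ᶠ w in 𝓝 z₀, (g = f' ∧ B w = vtx a * w) ∨
      (g' = f' ∧ sideMap j j' (B w) = vtx a * w) := by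
    filter_upwards [h] with w ⟨hw, y, hy1, hy2⟩
    rw [chartCoord_iff hg] at hy2
    rcases hy2 with hy2 | hy2
    · obtain ⟨h3, h4⟩ := hy1.eq_of_mem_interior hn hy2 (vtx_mul_mem_interior hn a hw)
      exact Or.inl ⟨h3.symm, h4.symm⟩
    · obtain ⟨h3, h4⟩ := hy1.eq_of_mem_interior hn hy2 (vtx_mul_mem_interior hn a hw)
      exact Or.inr ⟨h3.symm, h4.symm⟩
  -- If the base polygon of the chart does not match `f'`, the mismatch persists on an open set.
  -- There the neighbour must match, and two isometries that agree on an open set agree everywhere.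
  have h3 : ∃ᶠ w in 𝓝 z₀, ¬ (g = f' ∧ B w = vtx a * w) := by
    intro hc
    simp only [not_not] at hc
    exact h1 ⟨hc.self_of_nhds.1,
      hB.eq_of_eventuallyEq (isometry_vtx_mul a) (hc.mono fun w hw => hw.2)⟩
  obtain ⟨w₁, hw₁, hw₁'⟩ := (h3.and_eventually (eventually_eventually_nhds.mpr h2)).exists
  have h4 : ∀ᶠ w in 𝓝 w₁, ¬ (g = f' ∧ B w = vtx a * w) := by
    by_cases hgf : g = f'
    · have hne : B w₁ ≠ vtx a * w₁ := fun h => hw₁ ⟨hgf, h⟩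
      have hne' : ∀ᶠ w in 𝓝 w₁, B w ≠ vtx a * w :=
        (isOpen_ne_fun hB.continuous (isometry_vtx_mul a).continuous).mem_nhds hne
      exact hne'.mono fun w hw hc => hw hc.2
    · exact Eventually.of_forall fun w hw => hgf hw.1
  have h5 : ∀ᶠ w in 𝓝 w₁, g' = f' ∧ sideMap j j' (B w) = vtx a * w := by
    filter_upwards [hw₁', h4] with w h h'
    exact h.resolve_left h'
  obtain rfl := h5.self_of_nhds.1
  have h6 : (fun w => sideMap j j' (B w)) = fun w => vtx a * w :=
    ((isometry_sideMap j j').comp hB).eq_of_eventuallyEq (isometry_vtx_mul a)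
      (h5.mono fun w hw => hw.2)
  refine ⟨j', fun w y hy => ?_, fun w hw => ?_⟩
  · rw [chartCoord_swap hg] at hy
    rwa [← congrFun h6 w]
  · rw [chartRegion_eq] at hw
    rw [← congrFun h6 w]
    exact sideMap_mem_interior_lens hw

/-- A rotation that describes `h` near one point describes it on the whole interior: the chart of
`h` at a limit point is compatible with the rotation on an open set, hence wherever it is valid. -/
theorem CarriesFace.of_eventually {h : D.Surface → D.Surface}
    (hh : D.LocallyIn {A | Isometry A} h) {f f' : D.Face} {a : ZMod n} {z₀ : ℂ}
    (hz₀ : z₀ ∈ interior (RegPoly n))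
    (h₀ : ∀ᶠ w in 𝓝 z₀, ∀ x, D.HasCoord f w x → D.HasCoord f' (vtx a * w) (h x)) :
    D.CarriesFace h f f' a := by
  have hU : IsOpen {z | ∀ᶠ w in 𝓝 z, ∀ x, D.HasCoord f w x → D.HasCoord f' (vtx a * w) (h x)} := by
    rw [isOpen_iff_mem_nhds]
    intro s hs
    exact eventually_eventually_nhds.mpr hs
  have hpre : IsPreconnected (interior (RegPoly n)) :=
    ((convex_convexHull ℝ _).interior).isPreconnected
  have key := hpre.subset_of_closure_inter_subset hU ⟨z₀, hz₀, h₀⟩ (by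
    rintro z ⟨hzc, hz⟩
    obtain ⟨c', B, hB, -, hev⟩ := hh (f, 0) z (by
      rw [chartRegion_eq]; exact interior_subset_interior_lens hn 0 hz)
    have hint : ∀ᶠ w in 𝓝 z, w ∈ interior (RegPoly n) := isOpen_interior.mem_nhds hz
    obtain ⟨z₁, hz₁, hz₁'⟩ := ((mem_closure_iff_frequently.mp hzc).and_eventually
      (eventually_eventually_nhds.mpr (hint.and hev))).exists
    obtain ⟨k, hk, -⟩ := exists_chart_of_eventually hn (c' := c') (f' := f') (a := a) (z₀ := z₁) hB
      (by
        have hz₁ : ∀ᶠ w in 𝓝 z₁, ∀ x, D.HasCoord f w x → D.HasCoord f' (vtx a * w) (h x) := hz₁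
        filter_upwards [hz₁, hz₁'] with w h1 ⟨h2, h3⟩
        have hx : D.HasCoord f w (D.pt f ⟨w, interior_subset h2⟩) := ⟨_, rfl⟩
        exact ⟨h2, _, h1 _ hx, h3 _ (Or.inl hx)⟩)
    change ∀ᶠ w in 𝓝 z, _
    filter_upwards [hint, hev] with w h1 h2 x hx
    exact (hk _ _ (h2 x (Or.inl hx))).hasCoord hn (vtx_mul_mem_regPoly a (interior_subset h1)))
  exact fun z hz => (key hz).self_of_nhds

/-- A chart of `h` at the midpoint of the common side covers parts of both polygons. It is fixed by
the known polygon and then read on the other side. -/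
theorem CarriesFace.glue {h : D.Surface → D.Surface} (hh : D.LocallyIn {A | Isometry A} h)
    {f f' g g' : D.Face} {a k l l' : ZMod n} (hf : D.CarriesFace h f f' a)
    (hg : D.glue (f, k) = (g, l)) (hg' : D.glue (f', k + a) = (g', l')) :
    D.CarriesFace h g g' (l' - l) := by
  have hms := midpoint_mem_side hn k
  have hmP := side_subset_regPoly hn k hms
  have hmv := midpoint_notMem_range_vtx hn k
  set m := sideSum k / 2
  obtain ⟨c', B, hB, hBm, hev⟩ := hh (f, k) m (by
    rw [chartRegion_eq]; exact mem_interior_lens_of_mem_side hn hms hmv)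
  obtain ⟨z₁, -, hz₁⟩ := exists_interior_of_eventually hn hmP hev
  obtain ⟨k', hk', hreg⟩ := exists_chart_of_eventually hn (c' := c') (f' := f') (a := a)
    (z₀ := z₁) hB (by
      filter_upwards [hz₁] with w ⟨h2, h3⟩
      have hx : D.HasCoord f w (D.pt f ⟨w, interior_subset h2⟩) := ⟨_, rfl⟩
      exact ⟨h2, _, hf w h2 _ hx, h3 _ (Or.inl hx)⟩)
  have hkk := eq_of_mem_side_of_mem_interior_lens hn (vtx_mul_mem_side a k hms) (hreg m hBm)
  subst hkk
  have ht : Tendsto (sideMap l k) (𝓝 (sideMap k l m)) (𝓝 m) := by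
    have := (continuous_sideMap l k).tendsto (sideMap k l m)
    rwa [sideMap_sideMap] at this
  obtain ⟨z₂, hz₂, hz₂'⟩ := exists_interior_of_eventually hn
    (side_subset_regPoly hn l (sideMap_mem_side hms)) (ht.eventually hev)
  refine CarriesFace.of_eventually hn hh hz₂ ?_
  filter_upwards [hz₂'] with v ⟨h1, h2⟩ x hx
  have h3 : D.ChartCoord (f, k) (sideMap l k v) x := by
    rw [chartCoord_swap hg, sideMap_sideMap]; exact Or.inl hx
  have h4 := hk' _ _ (h2 x h3)
  rw [chartCoord_swap hg'] at h4
  have e : sideMap (k + a) l' (vtx a * sideMap l k v) = vtx (l' - l) * v := by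
    have := sideMap_vtx_mul k l a (l' - l) (sideMap l k v)
    rwa [add_sub_cancel, sideMap_sideMap] at this
  rw [e] at h4
  exact h4.hasCoord hn (vtx_mul_mem_regPoly _ (interior_subset h1))

theorem CarriesFace.glue_fst {h : D.Surface → D.Surface} (hh : D.LocallyIn {A | Isometry A} h)
    {f f' : D.Face} {a : ZMod n} (hf : D.CarriesFace h f f' a) (k : ZMod n) :
    D.CarriesFace h (D.glue (f, k)).1 (D.glue (f', k + a)).1
      ((D.glue (f', k + a)).2 - (D.glue (f, k)).2) :=
  hf.glue hn hh (k := k) (l := (D.glue (f, k)).2) (l' := (D.glue (f', k + a)).2) rfl rfl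

/-- The symmetries of a Platonic surface. -/
theorem IsPlatonic.exists_polyHom (hD : D.IsPlatonic) (f f' : D.Face) (k k' : ZMod n) :
    ∃ φ : PolyHom D D, φ.face f = f' ∧ φ.rot f = k' - k := by
  have := hD.connected
  -- Initial endpoints are sent to initial endpoints, which selects an orientation preserving
  -- isometry.
  obtain ⟨h, hiso, hflag⟩ := hD.flag_transitive (f, k, false) (f', k', false)
  have h0 : D.CarriesFace h f f' (k' - k) := fun z hz x hx => hflag.hasCoord hn hx
  have hall : ∀ g, ∃ p : D.Face × ZMod n, D.CarriesFace h g p.1 p.2 := by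
    refine face_induction (P := fun g => ∃ p : D.Face × ZMod n, D.CarriesFace h g p.1 p.2) ?_
      ⟨(f', k' - k), h0⟩
    rintro g j ⟨p, hp⟩
    exact ⟨(_, _), hp.glue_fst hn hiso.2 j⟩
  choose p hp using hall
  refine ⟨⟨fun g => (p g).1, fun g => (p g).2, fun g j => ?_⟩, ?_, ?_⟩
  · obtain ⟨h1, h2⟩ := ((hp g).glue_fst hn hiso.2 j).unique hn (hp (D.glue (g, j)).1)
    refine Prod.ext h1 ?_
    change _ = _ + (p (D.glue (g, j)).1).2
    rw [← h2, add_sub_cancel]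
  · exact ((hp f).unique hn h0).1
  · exact ((hp f).unique hn h0).2

/-- The rotation of a Platonic surface by `π` about a midpoint of a side, or about the center of a
polygon with an even number of sides. -/
theorem IsPlatonic.exists_involution (hD : D.IsPlatonic) (f : D.Face) {z : ℂ}
    (hz : (Even n ∧ z = 0) ∨ ∃ l : ZMod n, z = sideSum l / 2) :
    ∃ φ : PolyHom D D, (∀ g, (φ.comp φ).face g = g ∧ (φ.comp φ).rot g = 0) ∧
      ¬ (φ.face f = f ∧ φ.rot f = 0) ∧
      ∀ u, D.TangentEq (φ.face f) (vtx (φ.rot f) * z) (vtx (φ.rot f) * u) f z (-u) := by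
  have := hD.connected
  rcases hz with ⟨he, rfl⟩ | ⟨k, rfl⟩
  · obtain ⟨φ, h1, h2⟩ := hD.exists_polyHom hn f f 0 (halfTurn n)
    rw [sub_zero] at h2
    refine ⟨φ, fun g => (φ.comp φ).rigid (f₀ := f) ⟨?_, ?_⟩ g, ?_, fun u => ?_⟩
    · change φ.face (φ.face f) = f
      rw [h1, h1]
    · change φ.rot f + φ.rot (φ.face f) = 0
      rw [h1, h2, halfTurn_add_self]
    · rintro ⟨-, h3⟩
      have h4 := vtx_halfTurn he
      rw [← h2, h3, vtx_zero] at h4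
      norm_num at h4
    · refine Or.inl ⟨h1, by simp, ?_⟩
      rw [h2, vtx_halfTurn he, neg_one_mul]
  · obtain ⟨⟨f', l⟩, hg⟩ : ∃ c, D.glue (f, k) = c := ⟨_, rfl⟩
    -- Adjacent polygons run along their common side in opposite directions. Carrying `k` to `l`
    -- start to start therefore turns this side about its midpoint.
    obtain ⟨φ, h1, h2⟩ := hD.exists_polyHom hn f f' k l
    have h3 : φ.face f' = f ∧ l + φ.rot f' = k := by
      have := φ.compat f k
      rw [h1, h2, add_sub_cancel, hg, glue_symm hg, Prod.mk.injEq] at this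
      exact ⟨this.1.symm, this.2.symm⟩
    refine ⟨φ, fun g => (φ.comp φ).rigid (f₀ := f) ⟨?_, ?_⟩ g, ?_, fun u => TangentEq.symm ?_⟩
    · change φ.face (φ.face f) = f
      rw [h1, h3.1]
    · change φ.rot f + φ.rot (φ.face f) = 0
      rw [h1, h2]
      linear_combination h3.2
    · rintro ⟨h4, h5⟩
      rw [h1] at h4
      rw [h2, sub_eq_zero] at h5
      rw [h4, h5] at hg
      exact D.glue_ne _ hg
    · rw [h1, h2]
      refine Or.inr ⟨k, l, hg, midpoint_mem_side hn k, ?_, by ring⟩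
      rw [sideMap_eq]; ring

end

end Platonic

end PolygonGluing

namespace PolygonGluing

/-! ### Excluding closed virtual-Weierstrass saddle connections -/

section ClosedSaddles

variable {n : ℕ} [NeZero n] {D : PolygonGluing n}

/-- An involution of a finite set with an odd number of elements has a fixed point. -/
theorem exists_fixed_of_odd {α : Type*} (h : Odd (Nat.card α)) {f : α → α}
    (hf : Function.Involutive f) : ∃ a, f a = a := by
  have hfin : Finite α := Nat.finite_of_card_ne_zero h.pos.ne'
  have := Fintype.ofFinite α
  classical
  obtain ⟨a, ha⟩ := Equiv.Perm.exists_fixed_point_of_prime (p := 2) (n := 1) (σ := hf.toPerm)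
    (by rw [← Nat.card_eq_fintype_card, ← even_iff_two_dvd]; exact Nat.not_even_iff_odd.mpr h)
    (by
      rw [pow_one, pow_two]
      exact Equiv.ext hf)
  exact ⟨a, ha⟩

/-- The rotation by `π` about a virtual Weierstrass point on a virtual Weierstrass saddle
connection exchanges the endpoints of the saddle connection. -/
theorem IsVirtualWeierstrassSaddle.exists_involution (hn : 3 ≤ n) (hD : D.IsPlatonic) {o : D.Face}
    {L : ℝ} {γ : ℝ → D.Surface} (hγ : D.IsSaddleConnection L γ)
    (h : D.IsVirtualWeierstrassSaddle o L γ) :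
    ∃ φ : PolyHom D D, (∀ g, (φ.comp φ).face g = g ∧ (φ.comp φ).rot g = 0) ∧
      (∀ f, ¬ (φ.face f = f ∧ φ.rot f = 0)) ∧ φ.map (γ 0) = γ L ∧
      ∃ x, x ∉ D.sing ∧ D.IsVirtualWeierstrassPoint o x ∧ φ.map x = x := by
  obtain ⟨m, hm, hW, f, z, u, hp, hz⟩ := h.exists_passesThrough hn
  obtain ⟨φ, h1, h2, h3⟩ := hD.exists_involution hn f hz
  have := hD.connected
  refine ⟨φ, h1, fun g hg => h2 (φ.rigid hg f), hγ.map_start_eq_end hn φ hm hp (h3 u),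
    γ m, hp.notMem_sing hn, hW, ?_⟩
  exact ((h3 u).hasCoord (φ.hasCoord (hp.hasCoord hn))).unique (hp.hasCoord hn)

theorem IsVirtualWeierstrassSaddle.not_closed (hn : 3 ≤ n) (hD : D.IsPlatonic) {o : D.Face}
    (hno : ¬ ∃ ι : D.Surface ≃ₜ D.Surface, D.IsRotation ι ∧ (∃ y, ι y ≠ y) ∧ (∀ y, ι (ι y) = y) ∧
        (∃ v ∈ D.sing, ι v = v) ∧
        ∃ x, x ∉ D.sing ∧ D.IsVirtualWeierstrassPoint o x ∧ ι x = x)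
    {L : ℝ} {γ : ℝ → D.Surface} (hγ : D.IsSaddleConnection L γ)
    (h : D.IsVirtualWeierstrassSaddle o L γ) : γ 0 ≠ γ L := by
  intro hcl
  obtain ⟨φ, h1, h2, h3, hx⟩ := h.exists_involution hn hD hγ
  have hinv : ∀ x, φ.map (φ.map x) = x := fun x => by
    rw [← φ.comp_map, PolyHom.map_eq_self h1]
  exact hno ⟨φ.toHomeomorph hinv, φ.isRotation hn hinv, φ.exists_map_ne hn (h2 o), hinv,
    ⟨γ 0, hγ.start_mem, h3.trans hcl.symm⟩, hx⟩

/-- If the saddle connection is closed, the involution that exchanges its ends acts on an odd number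
of corners. A fixed corner is a polygon fixed without rotation, which only the identity allows. -/
theorem IsVirtualWeierstrassSaddle.not_closed_of_odd (hn : 3 ≤ n) (hD : D.IsPlatonic)
    {o : D.Face} (hodd : ∀ v ∈ D.sing, Odd (D.valence v))
    {L : ℝ} {γ : ℝ → D.Surface} (hγ : D.IsSaddleConnection L γ)
    (h : D.IsVirtualWeierstrassSaddle o L γ) : γ 0 ≠ γ L := by
  intro hcl
  obtain ⟨φ, h1, h2, h3, -⟩ := h.exists_involution hn hD hγ
  let F : {c // D.corner c = γ 0} → {c // D.corner c = γ 0} := fun c =>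
    ⟨φ.dart c.1, by rw [← φ.map_corner, c.2, h3, hcl]⟩
  have hF : Function.Involutive F := by
    rintro ⟨⟨f, k⟩, hc⟩
    refine Subtype.ext (Prod.ext (h1 f).1 ?_)
    change k + φ.rot f + φ.rot (φ.face f) = k
    have := (h1 f).2
    change φ.rot f + φ.rot (φ.face f) = 0 at this
    rw [add_assoc, this, add_zero]
  obtain ⟨⟨⟨f, k⟩, hc⟩, hfix⟩ := exists_fixed_of_odd (hodd _ hγ.start_mem) hF
  have h4 : φ.dart (f, k) = (f, k) := congrArg Subtype.val hfix
  refine h2 f ⟨congrArg Prod.fst h4, ?_⟩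
  have h5 : k + φ.rot f = k := congrArg Prod.snd h4
  exact add_eq_left.mp h5

end ClosedSaddles

/-! ### Lifts of saddle connections to the unfolding -/

section Lift

variable {n : ℕ} [NeZero n] {D : PolygonGluing n}

/-- The vector `u` of the polygon `f` has the direction `U` for a polygon of the unfolding over
`f`. -/
def HasDirection (D : PolygonGluing n) (o : D.Face) (U : ℂ) (f : D.Face) (u : ℂ) : Prop :=
  ∃ ρ : Circle, D.Reachable o (f, ρ) ∧ (ρ : ℂ) * u = U

/-- The polygon of the unfolding that lies over `f` and has the direction `ρ`. -/
def liftFace {o f : D.Face} {ρ : Circle} (hρ : D.Reachable o (f, ρ)) : (D.unfolding o).Face :=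
  ⟨(f, ρ), hρ⟩

theorem coe_transport (x : D.Face × Circle) (k : ZMod n) :
    ((D.transport x k).2 : ℂ) = -(vtx (k - (D.glue (x.1, k)).2) * x.2) := by
  change -((ZMod.toCircle (k - (D.glue (x.1, k)).2) : Circle) : ℂ) * (x.2 : ℂ) = _
  rw [vtx, ZMod.stdAddChar_apply, neg_mul]

theorem HasDirection.transport {o : D.Face} {U : ℂ} (f : D.Face) (k : ZMod n) (u : ℂ)
    (h : D.HasDirection o U f u) :
    D.HasDirection o U (D.glue (f, k)).1 (-(vtx ((D.glue (f, k)).2 - k) * u)) := by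
  obtain ⟨ρ, hρ, hU⟩ := h
  refine ⟨(D.transport (f, ρ) k).2, hρ.tail ⟨k, rfl⟩, ?_⟩
  rw [coe_transport]
  linear_combination hU + (ρ : ℂ) * u * vtx_sub_mul_vtx_sub k (D.glue (f, k)).2

theorem exists_reachable [ConnectedSpace D.Surface] (o f : D.Face) :
    ∃ ρ : Circle, D.Reachable o (f, ρ) := by
  refine face_induction (P := fun f => ∃ ρ : Circle, D.Reachable o (f, ρ)) ?_
    ⟨1, Relation.ReflTransGen.refl⟩ f
  rintro f k ⟨ρ, hρ⟩
  exact ⟨_, hρ.tail ⟨k, rfl⟩⟩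

/-- A single nonzero vector with equal directions on both sides suffices to determine the parallel
transport across the edge. -/
theorem unfolding_glue (o : D.Face) {f g : D.Face} {k l : ZMod n} {ρ σ : Circle}
    (hρ : D.Reachable o (f, ρ)) (hσ : D.Reachable o (g, σ)) (hg : D.glue (f, k) = (g, l))
    {u : ℂ} (hu : u ≠ 0) (h : (ρ : ℂ) * u = σ * -(vtx (l - k) * u)) :
    (D.unfolding o).glue (D.liftFace hρ, k) = (D.liftFace hσ, l) := by
  refine Prod.ext (Subtype.ext (Prod.ext ?_ (Subtype.ext ?_))) ?_
  · change (D.glue (f, k)).1 = g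
    rw [hg]
  · change ((D.transport (f, ρ) k).2 : ℂ) = (σ : ℂ)
    rw [coe_transport, hg]
    apply mul_right_cancel₀ hu
    linear_combination (-(vtx (k - l))) * h + (σ : ℂ) * u * vtx_sub_mul_vtx_sub k l
  · change (D.glue (f, k)).2 = l
    rw [hg]

/-- Tangent vectors of the surface with the same direction in the unfolding agree in the
unfolding. -/
theorem TangentEq.unfolding (o : D.Face) {f g : D.Face} {z u z' u' : ℂ} {ρ σ : Circle}
    (h : D.TangentEq f z u g z' u') (hu : u ≠ 0)
    (hρ : D.Reachable o (f, ρ)) (hσ : D.Reachable o (g, σ)) (he : (ρ : ℂ) * u = σ * u') :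
    (D.unfolding o).TangentEq (D.liftFace hρ) z u (D.liftFace hσ) z' u' := by
  rcases h with ⟨rfl, rfl, rfl⟩ | ⟨k, l, hg, hk, rfl, rfl⟩
  · have : ρ = σ := Subtype.ext (mul_right_cancel₀ hu he)
    subst this
    exact Or.inl ⟨rfl, rfl, rfl⟩
  · exact Or.inr ⟨k, l, unfolding_glue o hρ hσ hg hu he, hk, rfl, rfl⟩

/-- Every saddle connection of a connected surface lifts to the unfolding. -/
theorem IsSaddleConnection.exists_lift (hn : 3 ≤ n) [ConnectedSpace D.Surface] (o : D.Face) {L : ℝ}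
    {γ : ℝ → D.Surface} (h : D.IsSaddleConnection L γ) :
    ∃ δ : ℝ → (D.unfolding o).Surface, (D.unfolding o).IsSaddleConnection L δ ∧
      ∀ t ∈ Set.Icc 0 L, (D.unfoldingHom o).map (δ t) = γ t := by
  obtain ⟨hL, hs0, hsL, ⟨f₀, z₀, u₀, hu₀, h₀⟩, ⟨f₁, z₁, u₁, hu₁, h₁⟩, hint⟩ :=
    isSaddleConnection_iff.mp h
  have hu₀' := ne_zero_of_norm_eq_one hu₀
  have hu₁' := ne_zero_of_norm_eq_one hu₁
  obtain ⟨ρ₀, hρ₀⟩ := exists_reachable o f₀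
  have hdir : ∀ t ∈ Set.Ioo 0 L, ∀ f z u, u ≠ 0 → D.PassesThrough γ t f z u →
      D.HasDirection o (ρ₀ * u₀) f u := fun t ht f z u hu hp =>
    h.transport hn HasDirection.transport hu₀' h₀ ⟨ρ₀, hρ₀, rfl⟩ ht hp hu
  obtain ⟨ρ₁, hρ₁, hU₁⟩ : D.HasDirection o (ρ₀ * u₀) f₁ (-u₁) :=
    h.transport_end hn HasDirection.transport hu₀' h₀ ⟨ρ₀, hρ₀, rfl⟩ h₁ hu₁'
  -- The lift at an interior time is the point over `γ t` at which the velocity has the transported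
  -- direction `ρ₀ * u₀`. It does not depend on the coordinates, so no continuation of lifts is
  -- needed.
  have hmid : ∀ t : ℝ, ∃ y : (D.unfolding o).Surface, t ∈ Set.Ioo 0 L →
      ∀ f z u ρ (hρ : D.Reachable o (f, ρ)), u ≠ 0 → D.PassesThrough γ t f z u →
        (ρ : ℂ) * u = ρ₀ * u₀ → (D.unfolding o).HasCoord (D.liftFace hρ) z y := by
    intro t
    by_cases ht : t ∈ Set.Ioo 0 L
    · obtain ⟨f, z, u, hu, hp⟩ := h.straightOn t ht
      obtain ⟨ρ, hρ, hU⟩ := hdir t ht f z u hu hp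
      refine ⟨(D.unfolding o).pt (D.liftFace hρ) ⟨z, hp.mem⟩, fun _ g w v σ hσ hv hq hV => ?_⟩
      exact ((hp.tangentEq_self hn hq hu).unfolding o hu hρ hσ (hU.trans hV.symm)).hasCoord
        ⟨hp.mem, rfl⟩
    · exact ⟨(D.unfolding o).corner (D.liftFace hρ₀, 0), fun h => absurd h ht⟩
  choose y hy using hmid
  have hz₀ : z₀ ∈ RegPoly n := h₀.hasCoord.mem
  have hz₁ : z₁ ∈ RegPoly n := h₁.hasCoord.mem
  -- The endpoints are lifted separately: velocities there are one-sided, and the polygons are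
  -- prescribed by the initial and the final germ.
  let δ : ℝ → (D.unfolding o).Surface := fun t =>
    if t ≤ 0 then (D.unfolding o).pt (D.liftFace hρ₀) ⟨z₀, hz₀⟩
    else if t < L then y t else (D.unfolding o).pt (D.liftFace hρ₁) ⟨z₁, hz₁⟩
  have hδ0 : δ 0 = (D.unfolding o).pt (D.liftFace hρ₀) ⟨z₀, hz₀⟩ := if_pos le_rfl
  have hδL : δ L = (D.unfolding o).pt (D.liftFace hρ₁) ⟨z₁, hz₁⟩ := by
    simp only [δ, hL.not_ge, if_false, lt_irrefl]
  have hδy : ∀ t ∈ Set.Ioo 0 L, δ t = y t := by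
    intro t ht
    simp only [δ, ht.1.not_ge, if_false, ht.2, if_true]
  have hδ : ∀ t ∈ Set.Ioo 0 L, ∀ f z u ρ (hρ : D.Reachable o (f, ρ)), u ≠ 0 →
      D.PassesThrough γ t f z u → (ρ : ℂ) * u = ρ₀ * u₀ →
        (D.unfolding o).HasCoord (D.liftFace hρ) z (δ t) := by
    intro t ht
    rw [hδy t ht]
    exact hy t ht
  have hmap : ∀ {f : D.Face} {ρ : Circle} (hρ : D.Reachable o (f, ρ)) {z : ℂ}
      {x : (D.unfolding o).Surface}, (D.unfolding o).HasCoord (D.liftFace hρ) z x →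
      D.HasCoord f z ((D.unfoldingHom o).map x) := by
    intro f ρ hρ z x hx
    have := (D.unfoldingHom o).hasCoord hx
    have e : vtx ((D.unfoldingHom o).rot (D.liftFace hρ)) = 1 := vtx_zero
    rwa [e, one_mul] at this
  refine ⟨δ, isSaddleConnection_iff.mpr ⟨hL, ?_, ?_, ⟨D.liftFace hρ₀, z₀, u₀, hu₀, ?_⟩,
    ⟨D.liftFace hρ₁, z₁, u₁, hu₁, ?_⟩, fun t ht => ?_⟩, fun t ht => ?_⟩
  · rw [hδ0, HasCoord.mem_sing_iff hn ⟨hz₀, rfl⟩]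
    have := h₀.hasCoord
    exact (this.mem_sing_iff hn).mp hs0
  · rw [hδL, HasCoord.mem_sing_iff hn ⟨hz₁, rfl⟩]
    have := h₁.hasCoord
    rw [sub_zero] at this
    exact (this.mem_sing_iff hn).mp hsL
  · refine startsAt_iff.mpr ⟨⟨hz₀, hδ0.symm⟩, ?_⟩
    filter_upwards [h₀.eventually_passesThrough hn hu₀', Ioo_mem_nhdsGT hL] with r hr hr0
    rw [zero_add] at hr ⊢
    exact hδ r hr0 _ _ _ _ hρ₀ hu₀' hr rfl
  · refine startsAt_iff.mpr ⟨⟨hz₁, by rw [sub_zero]; exact hδL.symm⟩, ?_⟩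
    filter_upwards [h₁.eventually_passesThrough hn hu₁', Ioo_mem_nhdsGT hL] with r hr hr0
    have hr' := hr.sub L
    rw [zero_add] at hr' ⊢
    simp only [sub_sub_cancel] at hr'
    exact hδ (L - r) ⟨by linarith [hr0.2], by linarith [hr0.1]⟩ _ _ _ _ hρ₁
      (neg_ne_zero.mpr hu₁') hr' hU₁
  · obtain ⟨f, z, u, hu, hp⟩ := hint t ht
    have hu' := ne_zero_of_norm_eq_one hu
    obtain ⟨ρ, hρ, hU⟩ := hdir t ht f z u hu' hp
    obtain ⟨k, hk, hev⟩ := hp.eventually_passesThrough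
    refine ⟨D.liftFace hρ, z, u, hu, hp.mem, k, hk, ?_⟩
    have htt : Tendsto (fun r : ℝ => t + r) (𝓝 0) (𝓝 t) := by
      have : Continuous (fun r : ℝ => t + r) := by fun_prop
      simpa using this.tendsto 0
    filter_upwards [hev, htt.eventually (isOpen_Ioo.mem_nhds ht)] with r hr hr0
    rcases hr with ⟨-, hr⟩ | hr
    · exact Or.inl (hδ _ hr0 _ _ _ _ hρ hu' hr hU)
    · have hσ : D.Reachable o (D.transport (f, ρ) k) := hρ.tail ⟨k, rfl⟩
      have hne : -(vtx ((D.glue (f, k)).2 - k) * u) ≠ 0 :=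
        neg_ne_zero.mpr (mul_ne_zero (vtx_ne_zero _) hu')
      have hc := coe_transport (f, ρ) k
      refine Or.inr (hδ _ hr0 _ _ _ _ hσ hne hr (hc ▸ ?_))
      linear_combination hU + (ρ : ℂ) * u * vtx_sub_mul_vtx_sub k (D.glue (f, k)).2
  · rcases eq_or_lt_of_le ht.1 with rfl | h0
    · exact (hmap hρ₀ ⟨hz₀, hδ0.symm⟩).unique h₀.hasCoord
    rcases eq_or_lt_of_le ht.2 with rfl | h1
    · have := h₁.hasCoord
      rw [sub_zero] at this
      exact (hmap hρ₁ ⟨hz₁, hδL.symm⟩).unique this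
    obtain ⟨f, z, u, hu, hp⟩ := hint t ⟨h0, h1⟩
    have hu' := ne_zero_of_norm_eq_one hu
    obtain ⟨ρ, hρ, hU⟩ := hdir t ⟨h0, h1⟩ f z u hu' hp
    exact (hmap hρ (hδ t ⟨h0, h1⟩ _ _ _ _ hρ hu' hp hU)).unique (hp.hasCoord hn)

end Lift

end PolygonGluing

namespace PolygonGluing

/-! ### Triangles and squares -/

section Corners

variable {n : ℕ} [NeZero n]

/-- The vectors that point from the vertex `vtx 0` into the polygon. -/
def InCorner (n : ℕ) [NeZero n] (v : ℂ) : Prop :=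
  height (0 : ZMod n) v ≤ 0 ∧ height (-1 : ZMod n) v ≤ 0

theorem inCorner_iff {v : ℂ} : InCorner n v ↔
    v.re * (1 + (vtx (1 : ZMod n)).re) + v.im * (vtx (1 : ZMod n)).im ≤ 0 ∧
    v.re * (1 + (vtx (1 : ZMod n)).re) - v.im * (vtx (1 : ZMod n)).im ≤ 0 := by
  have h1 : height (0 : ZMod n) v
      = v.re * (1 + (vtx (1 : ZMod n)).re) + v.im * (vtx (1 : ZMod n)).im := by
    rw [height_apply, neg_zero, zero_add, vtx_zero, ← conj_vtx]
    simp only [mul_one, Complex.mul_re, Complex.conj_re, Complex.conj_im]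
    ring
  have h2 : height (-1 : ZMod n) v
      = v.re * (1 + (vtx (1 : ZMod n)).re) - v.im * (vtx (1 : ZMod n)).im := by
    rw [height_apply, neg_neg, neg_add_cancel, neg_zero, vtx_zero]
    simp only [mul_one, Complex.mul_re]
    ring
  rw [InCorner, h1, h2]

theorem inCorner_of_eventually (hn : 3 ≤ n) {j : ZMod n} {v : ℂ}
    (h : ∀ᶠ r : ℝ in 𝓝[>] 0, vtx j + r * (vtx j * v) ∈ RegPoly n) : InCorner n v := by
  obtain ⟨r, hr, hr0⟩ := (h.and self_mem_nhdsWithin).exists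
  have hr0 : 0 < r := hr0
  have key : ∀ k : ZMod n, height (k + j) (vtx j) = sideHeight n → height k v ≤ 0 := by
    intro k hk
    have := height_le_of_mem hn hr (k + j)
    rw [map_add, hk, ← Complex.real_smul, map_smul, height_vtx_mul, smul_eq_mul] at this
    by_contra! hc
    have := mul_pos hr0 hc
    linarith
  refine ⟨key 0 (by rw [zero_add, height_vtx_self]), key (-1) ?_⟩
  have := height_vtx_succ (-1 + j)
  rwa [neg_add_cancel_comm] at this

theorem vtx_one_three : (vtx (1 : ZMod 3)).re = -1 / 2 ∧ 0 < (vtx (1 : ZMod 3)).im ∧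
    (vtx (1 : ZMod 3)).im * (vtx (1 : ZMod 3)).im = 3 / 4 := by
  have h := vtx_natCast (n := 3) 1
  rw [Nat.cast_one] at h
  have hpi := Real.pi_pos
  have e : 2 * Real.pi * ((1 : ℕ) : ℝ) / ((3 : ℕ) : ℝ) = Real.pi - Real.pi / 3 := by
    push_cast; ring
  rw [e] at h
  have hre : (vtx (1 : ZMod 3)).re = -1 / 2 := by
    rw [h, Complex.exp_ofReal_mul_I_re, Real.cos_pi_sub, Real.cos_pi_div_three]; ring
  refine ⟨hre, ?_, ?_⟩
  · rw [h, Complex.exp_ofReal_mul_I_im]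
    exact Real.sin_pos_of_pos_of_lt_pi (by linarith) (by linarith)
  · have h1 := Complex.normSq_apply (vtx (1 : ZMod 3))
    rw [Complex.normSq_eq_norm_sq, norm_vtx, hre] at h1
    linarith

theorem vtx_one_four : vtx (1 : ZMod 4) = Complex.I := by
  have h := vtx_natCast (n := 4) 1
  rw [Nat.cast_one] at h
  have e : 2 * Real.pi * ((1 : ℕ) : ℝ) / ((4 : ℕ) : ℝ) = Real.pi / 2 := by push_cast; ring
  rw [h, e]
  push_cast
  exact Complex.exp_pi_div_two_mul_I

theorem vtx_two : vtx (2 : ZMod n) = vtx (1 : ZMod n) * vtx (1 : ZMod n) := by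
  rw [← vtx_add, one_add_one_eq_two]

/-- The corners of a tiling of the plane by triangles meet only in edges. -/
theorem corner_cases_three {e e' : ℂ} (he : e = 1 ∨ e = -1) (he' : e' = 1 ∨ e' = -1) (d : ZMod 3)
    {v v' : ℂ} (hv0 : v ≠ 0) (hv0' : v' ≠ 0) (hv : InCorner 3 v) (hv' : InCorner 3 v')
    (h : e * v = e' * vtx d * v') :
    e' * vtx d = e ∨
    (e' * vtx d = -(e * vtx (-1 : ZMod 3)) ∧ ∃ s : ℝ, 0 < s ∧ v' = s * (vtx (1 : ZMod 3) - 1)) ∨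
    (e = -(e' * vtx d * vtx (-1 : ZMod 3)) ∧ ∃ s : ℝ, 0 < s ∧ v = s * (vtx (1 : ZMod 3) - 1)) := by
  obtain ⟨hp, hq, hqq⟩ := vtx_one_three
  rw [inCorner_iff] at hv hv'
  have hm1 : vtx (-1 : ZMod 3) = vtx (1 : ZMod 3) * vtx (1 : ZMod 3) := by rw [← vtx_two]; rfl
  have hcube : vtx (1 : ZMod 3) * vtx (1 : ZMod 3) * vtx (1 : ZMod 3) = 1 := by
    rw [← hm1, ← vtx_add, neg_add_cancel, vtx_zero]
  set w := vtx (1 : ZMod 3) with hw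
  set q := w.im
  rw [hp] at hv hv'
  obtain ⟨hv1, hv2⟩ := hv
  obtain ⟨hv1', hv2'⟩ := hv'
  have zero_of : ∀ z : ℂ, z.re = 0 → z.im * q = 0 → z = 0 := fun z h1 h2 =>
    Complex.ext h1 ((mul_eq_zero.mp h2).resolve_right hq.ne')
  have edge : ∀ z : ℂ, z ≠ 0 → z.re * (1 + -1 / 2) - z.im * q ≤ 0 →
      z.re * (1 + -1 / 2) + z.im * q = 0 → ∃ s : ℝ, 0 < s ∧ z = s * (w - 1) := by
    intro z hz h1 h2
    refine ⟨-2 * z.re / 3, ?_, Complex.ext ?_ ?_⟩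
    · have : z.re ≠ 0 := fun h0 => hz (zero_of z h0 (by rw [h0] at h2; linarith))
      have : z.re < 0 := lt_of_le_of_ne (by linarith) this
      linarith
    · rw [Complex.re_ofReal_mul, Complex.sub_re, hp, Complex.one_re]; ring
    · rw [Complex.im_ofReal_mul, Complex.sub_im, Complex.one_im]
      apply mul_right_cancel₀ hq.ne'
      have : w.im * q = 3 / 4 := hqq
      linear_combination h2 + 2 / 3 * z.re * this
  have hre : ∀ z : ℂ, (w * z).re = -1 / 2 * z.re - z.im * q := by
    intro z; rw [Complex.mul_re, hp]; ring
  have him : ∀ z : ℂ, (w * z).im * q = 3 / 4 * z.re - 1 / 2 * (z.im * q) := by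
    intro z; rw [Complex.mul_im, hp, ← hqq]; ring
  have hd : ∀ d : ZMod 3, d = 0 ∨ d = 1 ∨ d = 2 := by decide
  have hpm : e' = e ∨ e' = -e := by
    rcases he with rfl | rfl <;> rcases he' with rfl | rfl <;> simp
  have he0 : e ≠ 0 := by rcases he with rfl | rfl <;> simp
  have hvim : (-v).im = -v.im := Complex.neg_im v
  have hvre : (-v).re = -v.re := Complex.neg_re v
  -- The six quotients `e' * vtx d / e` are the sixth roots of unity, one for each corner around a
  -- lattice vertex: `1` is the same corner, the two neighbours share an edge, and the other three
  -- are disjoint apart from the apex.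
  rcases hpm with rfl | rfl <;> rcases hd d with rfl | rfl | rfl
  · left; rw [vtx_zero, mul_one]
  · exfalso
    have hvv : v = w * v' := mul_left_cancel₀ he0 (by rw [h]; ring)
    have h1 := hre v'
    have h2 := him v'
    rw [← hvv] at h1 h2
    exact hv0 (zero_of v (by linarith) (by linarith))
  · exfalso
    rw [vtx_two] at h
    have hvv : w * v = v' := mul_left_cancel₀ he0 (by linear_combination w * h + e' * v' * hcube)
    have h1 := hre v
    have h2 := him v
    rw [hvv] at h1 h2
    exact hv0' (zero_of v' (by linarith) (by linarith))
  · exfalso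
    rw [vtx_zero] at h
    have hvv : -v = v' := mul_left_cancel₀ he0 (by linear_combination -h)
    rw [← hvv, hvim, hvre] at hv1' hv2'
    exact hv0 (zero_of v (by linarith) (by linarith))
  · right; right
    have hvv : -v = w * v' := mul_left_cancel₀ he0 (by linear_combination -h)
    refine ⟨by rw [hm1]; linear_combination -e * hcube, edge v hv0 (by linarith) ?_⟩
    have h1 := hre v'
    have h2 := him v'
    rw [← hvv, hvim] at h2
    rw [← hvv, hvre] at h1
    linarith
  · right; left
    rw [vtx_two] at h ⊢
    have hvv : w * -v = v' := mul_left_cancel₀ he0 (by linear_combination -w * h + e * v' * hcube)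
    refine ⟨by rw [hm1]; ring, edge v' hv0' (by linarith) ?_⟩
    have h1 := hre (-v)
    have h2 := him (-v)
    rw [hvv, hvim, hvre] at h1 h2
    linarith

/-- The corners of a tiling of the plane by squares meet only in edges. -/
theorem corner_cases_four {e : ℂ} (he0 : e ≠ 0) (d : ZMod 4)
    {v v' : ℂ} (hv0 : v ≠ 0) (hv0' : v' ≠ 0) (hv : InCorner 4 v) (hv' : InCorner 4 v')
    (h : e * v = e * vtx d * v') :
    e * vtx d = e ∨
    (e * vtx d = -(e * vtx (-1 : ZMod 4)) ∧ ∃ s : ℝ, 0 < s ∧ v' = s * (vtx (1 : ZMod 4) - 1)) ∨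
    (e = -(e * vtx d * vtx (-1 : ZMod 4)) ∧ ∃ s : ℝ, 0 < s ∧ v = s * (vtx (1 : ZMod 4) - 1)) := by
  rw [inCorner_iff, vtx_one_four, Complex.I_re, Complex.I_im] at hv hv'
  obtain ⟨hv1, hv2⟩ := hv
  obtain ⟨hv1', hv2'⟩ := hv'
  have hm1 : vtx (-1 : ZMod 4) = -Complex.I := by rw [← conj_vtx, vtx_one_four, Complex.conj_I]
  have hd : ∀ d : ZMod 4, d = 0 ∨ d = 1 ∨ d = 2 ∨ d = -1 := by decide
  have hvv : v = vtx d * v' := mul_left_cancel₀ he0 (by rw [h]; ring)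
  have hI := Complex.I_mul_I
  have edge : ∀ z : ℂ, z ≠ 0 → z.re ≤ 0 → z.re + z.im = 0 →
      ∃ s : ℝ, 0 < s ∧ z = s * (vtx (1 : ZMod 4) - 1) := by
    intro z hz h1 h2
    refine ⟨-z.re, ?_, Complex.ext ?_ ?_⟩
    · have : z.re ≠ 0 := fun h0 => hz (Complex.ext h0 (by rw [h0] at h2; simpa using h2))
      have : z.re < 0 := lt_of_le_of_ne h1 this
      linarith
    · rw [Complex.re_ofReal_mul, vtx_one_four, Complex.sub_re, Complex.I_re, Complex.one_re]; ring
    · rw [Complex.im_ofReal_mul, vtx_one_four, Complex.sub_im, Complex.I_im, Complex.one_im]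
      linarith
  -- The four corners around a vertex of the square lattice: the same, the two neighbours, and the
  -- opposite one.
  rcases hd d with rfl | rfl | rfl | rfl
  · left; rw [vtx_zero, mul_one]
  · right; left
    refine ⟨by rw [hm1, vtx_one_four]; ring, edge v' hv0' (by linarith) ?_⟩
    rw [vtx_one_four] at hvv
    have h1 : v.re = -v'.im := by rw [hvv, Complex.I_mul_re]
    have h2 : v.im = v'.re := by rw [hvv, Complex.I_mul_im]
    linarith
  · exfalso
    rw [vtx_two, vtx_one_four, hI, neg_one_mul] at hvv
    have h1 : v.re = -v'.re := by rw [hvv, Complex.neg_re]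
    have h2 : v.im = -v'.im := by rw [hvv, Complex.neg_im]
    exact hv0 (Complex.ext (by rw [Complex.zero_re]; linarith) (by rw [Complex.zero_im]; linarith))
  · right; right
    refine ⟨by rw [hm1]; linear_combination e * hI, edge v hv0 (by linarith) ?_⟩
    rw [hm1, neg_mul] at hvv
    have h1 : v.re = v'.im := by rw [hvv, Complex.neg_re, Complex.I_mul_re, neg_neg]
    have h2 : v.im = -v'.re := by rw [hvv, Complex.neg_im, Complex.I_mul_im]
    linarith

theorem veechDir_eq_or (ε : (veechSurface n).Face) :
    veechDir ε = 1 ∨ (Odd n ∧ veechDir ε = -1) := by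
  rcases ε.2 with h | ⟨ho, h⟩
  · left; rw [veechDir, h]; rfl
  · right; refine ⟨ho, ?_⟩; rw [veechDir, h]; rfl

theorem veech_corner_unique {ε ε' : (veechSurface n).Face} {j j' : ZMod n}
    (h : veechDir ε * vtx j = veechDir ε' * vtx j') : ε = ε' ∧ j = j' := by
  refine veechFace_unique (Subtype.ext ?_)
  rw [vtx, vtx, ZMod.stdAddChar_apply, ZMod.stdAddChar_apply] at h
  exact h

/-- The partner of a side is the unique side opposite to it, and the product of direction and
starting vertex determines a side. -/
theorem veech_glue_eq {ε ε' : (veechSurface n).Face} {k l : ZMod n}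
    (h : veechDir ε' * vtx l = -(veechDir ε * vtx k)) :
    (veechSurface n).glue (ε, k) = (ε', l) := by
  have h1 := VeechFace.coe_opp_mul_vtx (n := n) ε
  have h2 : veechDir (n := n) (VeechFace.opp (n := n) ε) * vtx (k + halfTurn n)
      = veechDir ε' * vtx l := by
    rw [h, vtx_add]
    change ((VeechFace.opp (n := n) ε).1 : ℂ) * _ = -(((Subtype.val ε : Circle) : ℂ) * _)
    linear_combination vtx k * h1
  obtain ⟨h3, h4⟩ := veech_corner_unique h2
  exact Prod.ext h3 h4

/-- A germ that runs along an edge has two descriptions, one in each adjacent polygon: it follows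
the side `j'` forwards and the side `j - 1` backwards, and these sides are glued. -/
theorem veech_edge_germ (hn : 3 ≤ n) {ε ε' : (veechSurface n).Face} {j j' : ZMod n} {v v' : ℂ}
    (hdir : veechDir ε * (vtx j * v) = veechDir ε' * (vtx j' * v'))
    (h : veechDir ε' * vtx j' = -(veechDir ε * vtx (j - 1)))
    (hs : ∃ s : ℝ, 0 < s ∧ v' = s * (vtx (1 : ZMod n) - 1)) :
    ∀ᶠ r : ℝ in 𝓝[>] 0, ∃ x, (veechSurface n).HasCoord ε (vtx j + r * (vtx j * v)) x ∧
      (veechSurface n).HasCoord ε' (vtx j' + r * (vtx j' * v')) x := by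
  obtain ⟨s, hs, rfl⟩ := hs
  have hg := veech_glue_eq h
  have h1 : vtx (j - 1) * vtx (1 : ZMod n) = vtx j := by rw [← vtx_add, sub_add_cancel]
  have hu : vtx j * v = s * (vtx (j - 1) - vtx j) := by
    apply mul_left_cancel₀ (veechDir_ne_zero ε)
    rw [hdir]
    linear_combination (s : ℂ) * (vtx (1 : ZMod n) - 1) * h - veechDir ε * s * h1
  have h2 : vtx (j' - (j - 1)) * vtx (j - 1) = vtx j' := by rw [← vtx_add, sub_add_cancel]
  filter_upwards [Ioo_mem_nhdsGT (inv_pos.mpr hs)] with r hr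
  have hr1 : r * s ≤ 1 := by
    have := mul_lt_mul_of_pos_right hr.2 hs
    rw [inv_mul_cancel₀ hs.ne'] at this
    exact this.le
  have hside : vtx j + r * (vtx j * v) ∈ side (j - 1) := by
    rw [mem_side_iff_exists hn, sub_add_cancel]
    refine ⟨r * s, 1 - r * s, (mul_pos hr.1 hs).le, by linarith, by ring, ?_⟩
    rw [hu]; push_cast; ring
  have hx : (veechSurface n).HasCoord ε (vtx j + r * (vtx j * v))
    ((veechSurface n).pt ε ⟨_, side_subset_regPoly hn _ hside⟩) := ⟨_, rfl⟩
  refine ⟨_, hx, ?_⟩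
  have hx' := hx.glue hg hside
  convert hx' using 1
  have h3 := sideMap_end (j - 1) j'
  rw [sub_add_cancel] at h3
  rw [sideMap_add_mul, h3, hu]
  linear_combination (r : ℂ) * s * (1 - vtx (1 : ZMod n)) * h2
    + (r : ℂ) * s * vtx (j' - (j - 1)) * h1

/-- In the surfaces made of triangles or squares a germ of a straight path at a vertex is determined
by its direction. -/
theorem veech_corner_germ (hn : n = 3 ∨ n = 4) {ε ε' : (veechSurface n).Face} {j j' : ZMod n}
    {v v' : ℂ} (hv0 : v ≠ 0) (hv0' : v' ≠ 0)
    (hv : ∀ᶠ r : ℝ in 𝓝[>] 0, vtx j + r * (vtx j * v) ∈ RegPoly n)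
    (hv' : ∀ᶠ r : ℝ in 𝓝[>] 0, vtx j' + r * (vtx j' * v') ∈ RegPoly n)
    (hdir : veechDir ε * (vtx j * v) = veechDir ε' * (vtx j' * v')) :
    ∀ᶠ r : ℝ in 𝓝[>] 0, ∃ x, (veechSurface n).HasCoord ε (vtx j + r * (vtx j * v)) x ∧
      (veechSurface n).HasCoord ε' (vtx j' + r * (vtx j' * v')) x := by
  have hn3 : 3 ≤ n := by omega
  have hc := inCorner_of_eventually hn3 hv
  have hc' := inCorner_of_eventually hn3 hv'
  have hj : vtx j' = vtx j * vtx (j' - j) := by rw [← vtx_add, add_sub_cancel]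
  have hj1 : vtx (j - 1) = vtx j * vtx (-1 : ZMod n) := by rw [← vtx_add, sub_eq_add_neg]
  have hj1' : vtx (j' - 1) = vtx j * vtx (j' - j) * vtx (-1 : ZMod n) := by
    rw [← hj, ← vtx_add, sub_eq_add_neg]
  have h : veechDir ε * v = veechDir ε' * vtx (j' - j) * v' :=
    mul_left_cancel₀ (vtx_ne_zero j) (by linear_combination hdir + veechDir ε' * v' * hj)
  have key : veechDir ε' * vtx (j' - j) = veechDir ε ∨
      (veechDir ε' * vtx (j' - j) = -(veechDir ε * vtx (-1 : ZMod n)) ∧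
        ∃ s : ℝ, 0 < s ∧ v' = s * (vtx (1 : ZMod n) - 1)) ∨
      (veechDir ε = -(veechDir ε' * vtx (j' - j) * vtx (-1 : ZMod n)) ∧
        ∃ s : ℝ, 0 < s ∧ v = s * (vtx (1 : ZMod n) - 1)) := by
    rcases hn with rfl | rfl
    · exact corner_cases_three ((veechDir_eq_or ε).imp_right And.right)
        ((veechDir_eq_or ε').imp_right And.right) _ hv0 hv0' hc hc' h
    · have hone : ∀ ε : (veechSurface 4).Face, veechDir ε = 1 := fun ε =>
        (veechDir_eq_or ε).resolve_right fun h => absurd h.1 (by decide)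
      rw [hone ε, hone ε'] at h ⊢
      exact corner_cases_four one_ne_zero _ hv0 hv0' hc hc' h
  rcases key with h1 | ⟨h1, hs⟩ | ⟨h1, hs⟩
  · obtain ⟨rfl, rfl⟩ := veech_corner_unique (ε := ε) (ε' := ε') (j := j) (j' := j')
      (by rw [hj]; linear_combination -(vtx j) * h1)
    have hvv : v = v' := by
      rw [sub_self, vtx_zero, mul_one] at h
      exact mul_left_cancel₀ (veechDir_ne_zero ε) h
    subst hvv
    filter_upwards [hv] with r hr
    exact ⟨(veechSurface n).pt ε ⟨_, hr⟩, ⟨hr, rfl⟩, ⟨hr, rfl⟩⟩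
  · exact veech_edge_germ hn3 hdir (by rw [hj, hj1]; linear_combination vtx j * h1) hs
  · have := veech_edge_germ hn3 hdir.symm (by rw [hj1']; linear_combination vtx j * h1) hs
    filter_upwards [this] with r ⟨x, hx1, hx2⟩
    exact ⟨x, hx2, hx1⟩

/-- In the surfaces made of triangles or squares the hyperelliptic involution reverses every saddle
connection. -/
theorem hyperelliptic_reverses (hn : n = 3 ∨ n = 4) {L : ℝ} {α : ℝ → (veechSurface n).Surface}
    (h : (veechSurface n).IsSaddleConnection L α) :
    ∀ t ∈ Set.Icc 0 L, (hyperelliptic n).map (α t) = α (L - t) := by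
  have hn3 : 3 ≤ n := by omega
  obtain ⟨hL, hs0, hsL, ⟨f, z, u, hu, h₀⟩, ⟨f', z', u', hu', h₁⟩, -⟩ :=
    isSaddleConnection_iff.mp h
  have hu0 := ne_zero_of_norm_eq_one hu
  have hu0' := ne_zero_of_norm_eq_one hu'
  have hdir : veechDir f' * -u' = veechDir f * u :=
    h.transport_end hn3 (Q := fun g v => veechDir g * v = veechDir f * u)
      (isDirection_veechDir.transport _) hu0 h₀ rfl h₁ hu0'
  have hJ₀ := h₀.map (hyperelliptic n)
  obtain ⟨j, hj⟩ : vtx ((hyperelliptic n).rot f) * z ∈ Set.range (vtx : ZMod n → ℂ) := by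
    rw [vtx_mul_mem_range_iff]
    exact (h₀.hasCoord.mem_sing_iff hn3).mp hs0
  obtain ⟨j', rfl⟩ : z' ∈ Set.range (vtx : ZMod n → ℂ) := by
    refine (h₁.hasCoord.mem_sing_iff hn3).mp ?_
    rwa [sub_zero]
  obtain ⟨v, hv⟩ : ∃ v, vtx ((hyperelliptic n).rot f) * u = vtx j * v :=
    ⟨_, (mul_div_cancel₀ _ (vtx_ne_zero j)).symm⟩
  obtain ⟨v', hv'⟩ : ∃ v', u' = vtx j' * v' := ⟨_, (mul_div_cancel₀ _ (vtx_ne_zero j')).symm⟩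
  have hv0 : v ≠ 0 := by
    rintro rfl
    exact mul_ne_zero (vtx_ne_zero _) hu0 (by rw [hv, mul_zero])
  have hv0' : v' ≠ 0 := by
    rintro rfl
    exact hu0' (by rw [hv', mul_zero])
  have hd := veechDir_hyperelliptic f u
  rw [← hj, hv] at hJ₀
  rw [hv] at hd
  have hrev := h.reverse
  have hJ := h.map hn3 (hyperelliptic n)
  -- The involution negates the initial direction, and reversal negates the final direction, which
  -- equals the initial one by transport. So both germs leave a vertex in the same direction.
  have hgerm := veech_corner_germ hn hv0 hv0' (hJ₀.eventually_gt.mono fun r hr => hr.mem)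
    ((h₁.eventually_gt.mono fun r hr => hr.mem).mono fun r hr => by rwa [hv'] at hr)
    (by rw [hd, ← hv', ← hdir]; ring)
  have hev : ∀ᶠ r : ℝ in 𝓝[>] 0, (hyperelliptic n).map (α r) = α (L - r) := by
    filter_upwards [hgerm, hJ₀.eventually_gt, h₁.eventually_gt] with r ⟨x, hx, hx'⟩ h1 h2
    rw [zero_add] at h1 h2
    rw [hv'] at h2
    exact (h1.unique hx).trans (hx'.unique h2)
  have hIoo : ∀ t ∈ Set.Ioo 0 L, (hyperelliptic n).map (α t) = α (L - t) := by
    obtain ⟨e, he, hsub⟩ := mem_nhdsGT_iff_exists_Ioo_subset.mp hev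
    have he : 0 < e := he
    have hm : 0 < min e L := lt_min he hL
    refine StraightOn.eqOn hn3 hJ.straightOn hrev.straightOn (t₀ := min e L / 2)
      ⟨by linarith, by linarith [min_le_right e L]⟩ ?_
    filter_upwards [isOpen_Ioo.mem_nhds (show min e L / 2 ∈ Set.Ioo 0 e from
      ⟨by linarith, by linarith [min_le_left e L]⟩)] with s hs
    exact hsub hs
  have h0 : (hyperelliptic n).map (α 0) = α L := by
    have := StartsAt.eq (γ₁ := fun s => (hyperelliptic n).map (α s)) (γ₂ := fun s => α (L - s)) hn3
      hJ₀ h₁ (mul_ne_zero (vtx_ne_zero j) hv0) (by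
        refine hev.frequently.mono fun r hr => ?_
        rwa [zero_add])
    simpa using this
  intro t ht
  rcases eq_or_lt_of_le ht.1 with rfl | h1
  · rw [h0, sub_zero]
  rcases eq_or_lt_of_le ht.2 with rfl | h2
  · rw [← h0, hyperelliptic_map_map, sub_self]
  exact hIoo t ⟨h1, h2⟩

theorem IsSaddleConnection.isVirtualWeierstrassSaddle (hn : n = 3 ∨ n = 4) {D : PolygonGluing n}
    [ConnectedSpace D.Surface] (o : D.Face) {L : ℝ} {γ : ℝ → D.Surface}
    (h : D.IsSaddleConnection L γ) : D.IsVirtualWeierstrassSaddle o L γ := by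
  have hn3 : 3 ≤ n := by omega
  obtain ⟨δ, hδ, hγ⟩ := h.exists_lift hn3 o
  have hrev := hyperelliptic_reverses hn (hδ.map hn3 (D.veechHom o))
  refine ⟨δ, hδ, hγ, Set.Subset.antisymm ?_ ?_⟩
  · rintro _ ⟨_, ⟨t, ht, rfl⟩, rfl⟩
    exact ⟨L - t, ⟨by linarith [ht.2], by linarith [ht.1]⟩, (hrev t ht).symm⟩
  · rintro _ ⟨t, ht, rfl⟩
    have ht' : L - t ∈ Set.Icc 0 L := ⟨by linarith [ht.2], by linarith [ht.1]⟩
    refine ⟨_, ⟨L - t, ht', rfl⟩, ?_⟩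
    have := hrev (L - t) ht'
    rwa [sub_sub_cancel] at this

end Corners

end PolygonGluing

/-! ### The four assertions -/

theorem mainTheorem6 (p : ℕ) [NeZero p] (hp : 3 ≤ p) (D : PolygonGluing p) (hD : D.IsPlatonic)
    (o : D.Face) :
    -- no involution of the rotation group fixes a vertex and a regular virtual-Weierstrass point
    ((¬ ∃ ι : D.Surface ≃ₜ D.Surface, D.IsRotation ι ∧ (∃ y, ι y ≠ y) ∧ (∀ y, ι (ι y) = y) ∧
        (∃ v ∈ D.sing, ι v = v) ∧
        ∃ x, x ∉ D.sing ∧ D.IsVirtualWeierstrassPoint o x ∧ ι x = x) →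
      ∀ (L : ℝ) (γ : ℝ → D.Surface), D.IsSaddleConnection L γ →
        D.IsVirtualWeierstrassSaddle o L γ → γ 0 ≠ γ L) ∧
    -- an odd number of polygons at each vertex
    ((∀ v ∈ D.sing, Odd (D.valence v)) →
      ∀ (L : ℝ) (γ : ℝ → D.Surface), D.IsSaddleConnection L γ →
        D.IsVirtualWeierstrassSaddle o L γ → γ 0 ≠ γ L) ∧
    -- triangles or squares
    (p = 3 ∨ p = 4 →
      ∀ (L : ℝ) (γ : ℝ → D.Surface), D.IsSaddleConnection L γ →
        D.IsVirtualWeierstrassSaddle o L γ) ∧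
    -- triangles or squares, an odd number at each vertex
    (p = 3 ∨ p = 4 → (∀ v ∈ D.sing, Odd (D.valence v)) →
      ∀ (L : ℝ) (γ : ℝ → D.Surface), D.IsSaddleConnection L γ → γ 0 ≠ γ L) := by
  have := hD.connected
  refine ⟨fun hno L γ hγ h => h.not_closed hp hD hno hγ,
    fun hodd L γ hγ h => h.not_closed_of_odd hp hD hodd hγ,
    fun hp34 L γ hγ => hγ.isVirtualWeierstrassSaddle hp34 o,
    fun hp34 hodd L γ hγ => ?_⟩
  exact (hγ.isVirtualWeierstrassSaddle hp34 o).not_closed_of_odd hp hD hodd hγ
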